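/- Let $A$ be a finite dimensional connected algebra over a field $K$, and let $D=\operatorname{Hom}_K(-,K)$. Modules are finite dimensional right $A$-modules unless stated otherwise. We use the following notions. - The dominant dimension $\operatorname{domdim}(M)\in\{0,1,2,\dots,\infty\}$ of a (left or right) module $M$ with minimal injective resolution $0\to M\to I_0\to I_1\to\cdots$ is the supremum of all $n$ such that $I_0,\dots,I_{n-1}$ are projective. The codominant dimension of $M$ is the dominant dimension of the left module $D(M)$. The finitistic dominant dimension is $\operatorname{fdomdim}(A)=\sup\{\operatorname{domdim}(M)\mid \operatorname{domdim}(M)<\infty\}$. - $A$ is gendo-symmetric if $\operatorname{domdim}(A_A)\ge 2$ and there is an idempotent $e\in A$ such that $eA$ is a minimal faithful projective-injective right module (minimal faithful: faithful, and a direct summand of every faithful module) and $eA\cong D(Ae)$ as $(eAe,A)$-bimodules. - A module $M$ is Gorenstein projective if $\operatorname{Ext}^i(M,A)=0=\operatorname{Ext}^i(\operatorname{Tr}M,A)$ for all $i\ge 1$, where $\operatorname{Tr}M$ is the transpose; it is Gorenstein injective if the left module $D(M)$ is Gorenstein projective; it is Gorenstein projective-injective if it is both. - $A$ is nearly Gorenstein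 if the Gorenstein projective modules are exactly the modules $M$ with $\operatorname{Ext}^i(M,A)=0$ for all $i\ge1$, and the Gorenstein injective modules are exactly the modules $M$ with $\operatorname{Ext}^i(D(A),M)=0$ for all $i\ge1$. - $A$ is CM-finite if there are only finitely many indecomposable Gorenstein projective modules up to isomorphism; $A$ is Gorenstein of Gorenstein dimension $g\in\mathbb{N}$ if the left and the right injective dimension of $A$ are both equal to $g$. - $\nu^{-1}(M)=\operatorname{Hom}_A(D(M),A)$ is the inverse Nakayama functor. Assume that $A$ is not selfinjective, is gendo-symmetric, and is nearly Gorenstein. 1. For an indecomposable module $M$ that is neither injective nor projective, the following are equivalent: (i) $M$ has infinite dominant dimension; (ii) $M$ is Gorenstein projective-injective and $\nu^{-1}(M)\cong M$; (iii) $M$ is Gorenstein projective-injective; (iv) $M$ has infinite codominant dimension. 2. If, moreover, $A$ is CM-finite and Gorenstein of Gorenstein dimension $g$, then every noninjective module has finite dominant dimension, and $\operatorname{fdomdim}(A)\le g+1$. -/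

import Mathlib

open CategoryTheory MulOpposite

universe u

noncomputable section

namespace GendoSymm

/-! Throughout, a right module over a ring `A` is a module over `Aᵐᵒᵖ`. -/

section Dimensions

variable (R : Type u) [Ring R]

/-- A submodule `N` of `X` is essential if it meets every nonzero submodule nontrivially. -/
def IsEssential {R : Type u} [Ring R] {X : Type u} [AddCommGroup X] [Module R X]
    (N : Submodule R X) : Prop :=
  ∀ S : Submodule R X, S ⊓ N = ⊥ → S = ⊥

/-- A minimal injective resolution `0 → M → I 0 → I 1 → ⋯` by finitely generated modules: an
exact sequence in which every `I n` is an injective envelope of the image of the incoming map. -/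
structure MinimalInjectiveResolution (M : Type u) [AddCommGroup M] [Module R M] where
  I : ℕ → ModuleCat.{u} R
  finite : ∀ n, Module.Finite R (I n)
  injective : ∀ n, Module.Injective R (I n)
  ι : M →ₗ[R] I 0
  d : ∀ n, I n →ₗ[R] I (n + 1)
  ι_injective : Function.Injective ι
  exact_zero : Function.Exact ι (d 0)
  exact_succ : ∀ n, Function.Exact (d n) (d (n + 1))
  ι_essential : IsEssential (LinearMap.range ι)
  d_essential : ∀ n, IsEssential (LinearMap.range (d n))

/-- The dominant dimension of `M`: the supremum of all `n` such that the first `n` terms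
`I 0, …, I (n - 1)` of a minimal injective resolution of `M` are projective. -/
def domDim (M : Type u) [AddCommGroup M] [Module R M] : ℕ∞ :=
  ⨆ n ∈ {n : ℕ | ∃ J : MinimalInjectiveResolution R M,
    ∀ i < n, Module.Projective R (J.I i)}, (n : ℕ∞)

/-- The finitistic dominant dimension: the supremum of the dominant dimensions of those finitely
generated modules whose dominant dimension is finite. -/
def finitisticDomDim : ℕ∞ :=
  sSup {d : ℕ∞ | ∃ M : ModuleCat.{u} R, Module.Finite R M ∧ domDim R M = d ∧ d < ⊤}

/-- `Ext^i(M, N) = 0` for all `i ≥ 1`. -/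
def ExtVanishes (M N : Type u) [AddCommGroup M] [Module R M] [AddCommGroup N] [Module R N] :
    Prop :=
  ∀ i : ℕ, 1 ≤ i → Subsingleton (Abelian.Ext (ModuleCat.of R M) (ModuleCat.of R N) i)

end Dimensions

section GorensteinProjective

variable (R S : Type u) [Ring R] [Ring S]
  (A : Type u) [AddCommGroup A] [Module R A] [Module S A] [SMulCommClass R S A]

/-- The cokernel of `Hom_R(f, A) : Hom_R(P₀, A) → Hom_R(P₁, A)`, for `f : P₁ → P₀`, as an
`S`-module. If `P₁ → P₀ → M → 0` is a presentation of `M` by finitely generated projectives and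
`A` is the regular bimodule, this is the transpose `Tr M` (up to projective summands). -/
abbrev Transpose {P₁ P₀ : Type u} [AddCommGroup P₁] [Module R P₁] [AddCommGroup P₀] [Module R P₀]
    (f : P₁ →ₗ[R] P₀) : Type u :=
  (P₁ →ₗ[R] A) ⧸ LinearMap.range (LinearMap.lcomp S A f)

/-- `Ext^i(M, A) = 0 = Ext^i(Tr M, A)` for all `i ≥ 1`, where `M` is an `R`-module and `Tr M` is an
`S`-module. It is used only when `A` is a ring and `(R, S)` is `(A, Aᵐᵒᵖ)` or `(Aᵐᵒᵖ, A)`. The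
transpose is computed from a presentation by finitely generated projectives; another
presentation changes it by projective summands only, which do not affect the condition. -/
def GorensteinProjectiveAux (M : Type u) [AddCommGroup M] [Module R M] : Prop :=
  ExtVanishes R M A ∧
    ∃ (P₁ P₀ : ModuleCat.{u} R) (f : P₁ →ₗ[R] P₀) (p : P₀ →ₗ[R] M),
      Module.Finite R P₁ ∧ Module.Projective R P₁ ∧
      Module.Finite R P₀ ∧ Module.Projective R P₀ ∧
      Function.Exact f p ∧ Function.Surjective p ∧
      ExtVanishes S (Transpose R S A f) A

end GorensteinProjective

/-- The underlying space of `D(M) = Hom_K(M, K)`. -/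
def KDual (K M : Type u) [Field K] [AddCommGroup M] [Module K M] : Type u :=
  M →ₗ[K] K

section KDual

variable {K : Type u} [Field K] {M : Type u} [AddCommGroup M] [Module K M]

instance : AddCommGroup (KDual K M) := inferInstanceAs (AddCommGroup (M →ₗ[K] K))

/-- An element of `D(M)` as a linear form. -/
def KDual.toForm (f : KDual K M) : M →ₗ[K] K := f

variable {A : Type u} [Ring A] [Algebra K A]

/-- The dual of a left module is a right module, `(f · a)(m) = f (a m)`. -/
instance KDual.moduleOfLeft [Module A M] [IsScalarTower K A M] : Module Aᵐᵒᵖ (KDual K M) where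
  smul c f := f.toForm ∘ₗ Algebra.lsmul K K M (unop c)
  one_smul f := LinearMap.ext fun m => congrArg f.toForm (one_smul A m)
  mul_smul c c' f := LinearMap.ext fun m =>
    congrArg f.toForm (mul_smul (unop c') (unop c) m)
  smul_zero _ := LinearMap.ext fun _ => rfl
  smul_add _ _ _ := LinearMap.ext fun _ => rfl
  add_smul c c' f := LinearMap.ext fun m =>
    (congrArg f.toForm (add_smul (unop c) (unop c') m)).trans (map_add f.toForm _ _)
  zero_smul f := LinearMap.ext fun m =>
    (congrArg f.toForm (zero_smul A m)).trans (map_zero f.toForm)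

/-- The dual of a right module is a left module, `(a · f)(m) = f (m a)`. -/
instance KDual.moduleOfRight [Module Aᵐᵒᵖ M] [IsScalarTower K Aᵐᵒᵖ M] : Module A (KDual K M) where
  smul a f := f.toForm ∘ₗ Algebra.lsmul K K M (op a)
  one_smul f := LinearMap.ext fun m => congrArg f.toForm (one_smul Aᵐᵒᵖ m)
  mul_smul a a' f := LinearMap.ext fun m =>
    congrArg f.toForm (mul_smul (op a') (op a) m)
  smul_zero _ := LinearMap.ext fun _ => rfl
  smul_add _ _ _ := LinearMap.ext fun _ => rfl
  add_smul a a' f := LinearMap.ext fun m =>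
    (congrArg f.toForm (add_smul (op a) (op a') m)).trans (map_add f.toForm _ _)
  zero_smul f := LinearMap.ext fun m =>
    (congrArg f.toForm (zero_smul Aᵐᵒᵖ m)).trans (map_zero f.toForm)

theorem KDual.op_smul_apply [Module A M] [IsScalarTower K A M] (a : A) (f : KDual K M) (m : M) :
    (op a • f).toForm m = f.toForm (a • m) := rfl

theorem KDual.smul_apply [Module Aᵐᵒᵖ M] [IsScalarTower K Aᵐᵒᵖ M] (a : A) (f : KDual K M) (m : M) :
    (a • f).toForm m = f.toForm (op a • m) := rfl

end KDual

section RightModules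

variable (K A : Type u) [Field K] [Ring A] [Algebra K A]
  (M : Type u) [AddCommGroup M] [Module K M] [Module Aᵐᵒᵖ M] [IsScalarTower K Aᵐᵒᵖ M]

/-- The codominant dimension of the right module `M`: the dominant dimension of the left module
`D(M)`. -/
def codomDim : ℕ∞ := domDim A (KDual K M)

/-- The inverse Nakayama functor on a right module `M`: the right module `Hom_A(D(M), A)`. -/
abbrev NakayamaInv : Type u := KDual K M →ₗ[A] A

/-- Gorenstein projective right modules. -/
def IsGorensteinProjective (A : Type u) [Ring A] (M : Type u) [AddCommGroup M] [Module Aᵐᵒᵖ M] :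
    Prop :=
  GorensteinProjectiveAux Aᵐᵒᵖ A A M

/-- The right module `M` is Gorenstein injective if the left module `D(M)` is Gorenstein
projective. -/
def IsGorensteinInjective : Prop := GorensteinProjectiveAux A Aᵐᵒᵖ A (KDual K M)

/-- Gorenstein projective-injective right modules. -/
def IsGorensteinProjectiveInjective : Prop :=
  IsGorensteinProjective A M ∧ IsGorensteinInjective K A M

end RightModules

section Algebras

variable (K A : Type u) [Field K] [Ring A] [Algebra K A]

/-- `A` is connected (indecomposable as an algebra): it is nonzero, and `0` and `1` are its only
central idempotents. -/
def IsConnectedAlgebra (A : Type u) [Ring A] : Prop :=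
  Nontrivial A ∧ ∀ e : A, IsIdempotentElem e → (∀ a : A, e * a = a * e) → e = 0 ∨ e = 1

/-- The right ideal `eA`. -/
def rightIdeal {A : Type u} [Ring A] (e : A) : Submodule Aᵐᵒᵖ A where
  carrier := {x | ∃ a, e * a = x}
  add_mem' := by
    rintro _ _ ⟨a, rfl⟩ ⟨b, rfl⟩
    exact ⟨a + b, mul_add e a b⟩
  zero_mem' := ⟨0, mul_zero e⟩
  smul_mem' := by
    rintro c _ ⟨a, rfl⟩
    exact ⟨a * unop c, (mul_assoc e a (unop c)).symm⟩

/-- The left ideal `Ae`. -/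
def leftIdeal {A : Type u} [Ring A] (e : A) : Submodule A A where
  carrier := {x | ∃ a, a * e = x}
  add_mem' := by
    rintro _ _ ⟨a, rfl⟩ ⟨b, rfl⟩
    exact ⟨a + b, add_mul a b e⟩
  zero_mem' := ⟨0, zero_mul e⟩
  smul_mem' := by
    rintro c _ ⟨a, rfl⟩
    exact ⟨c * a, mul_assoc c a e⟩

/-- Left multiplication by `ebe` on `eA`. -/
def cornerMul {A : Type u} [Ring A] (e b : A) (x : rightIdeal e) : rightIdeal e :=
  ⟨e * b * e * x, b * e * x, by simp only [mul_assoc]⟩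

/-- Right multiplication by `ebe` on `Ae`. -/
def mulCorner {A : Type u} [Ring A] (e b : A) (y : leftIdeal e) : leftIdeal e :=
  ⟨y * (e * b * e), y * (e * b), by simp only [mul_assoc]⟩

/-- `N` is a minimal faithful right module: it is faithful, and a direct summand of every
finitely generated faithful right module. -/
def IsMinimalFaithful (A : Type u) [Ring A] (N : Type u) [AddCommGroup N] [Module Aᵐᵒᵖ N] : Prop :=
  FaithfulSMul Aᵐᵒᵖ N ∧
    ∀ X : ModuleCat.{u} Aᵐᵒᵖ, Module.Finite Aᵐᵒᵖ X → FaithfulSMul Aᵐᵒᵖ X →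
      ∃ (i : N →ₗ[Aᵐᵒᵖ] X) (r : X →ₗ[Aᵐᵒᵖ] N), r ∘ₗ i = LinearMap.id

/-- `A` is gendo-symmetric: it has dominant dimension at least two, and there is an idempotent `e`
such that `eA` is a minimal faithful projective-injective right module and `eA ≅ D(Ae)` as
`(eAe, A)`-bimodules. -/
def IsGendoSymmetric : Prop :=
  2 ≤ domDim Aᵐᵒᵖ A ∧
    ∃ e : A, IsIdempotentElem e ∧
      IsMinimalFaithful A (rightIdeal e) ∧
      Module.Projective Aᵐᵒᵖ (rightIdeal e) ∧ Module.Injective Aᵐᵒᵖ (rightIdeal e) ∧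
      ∃ φ : rightIdeal e ≃ₗ[Aᵐᵒᵖ] KDual K (leftIdeal e),
        ∀ (b : A) (x : rightIdeal e) (y : leftIdeal e),
          (φ (cornerMul e b x)).toForm y = (φ x).toForm (mulCorner e b y)

/-- `A` is nearly Gorenstein: for finite dimensional right modules `M`, being Gorenstein
injective means `Ext^i(D(A), M) = 0` for all `i ≥ 1`, and being Gorenstein projective means
`Ext^i(M, A) = 0` for all `i ≥ 1`. -/
def IsNearlyGorenstein : Prop :=
  ∀ (M : Type u) [AddCommGroup M] [Module K M] [Module Aᵐᵒᵖ M] [IsScalarTower K Aᵐᵒᵖ M]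
    [FiniteDimensional K M],
    (IsGorensteinInjective K A M ↔ ExtVanishes Aᵐᵒᵖ (KDual K A) M) ∧
    (IsGorensteinProjective A M ↔ ExtVanishes Aᵐᵒᵖ M A)

/-- `A` is CM-finite: up to isomorphism there are only finitely many indecomposable finitely
generated Gorenstein projective right modules. -/
def IsCMFinite (A : Type u) [Ring A] : Prop :=
  ∃ (n : ℕ) (G : Fin n → ModuleCat.{u} Aᵐᵒᵖ),
    ∀ M : ModuleCat.{u} Aᵐᵒᵖ, Module.Finite Aᵐᵒᵖ M → Indecomposable M →
      IsGorensteinProjective A M → ∃ i, Nonempty (M ≅ G i)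

/-- `A` is Gorenstein of Gorenstein dimension `g`: the injective dimensions of the right and of
the left regular module are both equal to `g`. -/
def IsGorensteinOfDim (A : Type u) [Ring A] (g : ℕ) : Prop :=
  injectiveDimension (ModuleCat.of Aᵐᵒᵖ A) = g ∧ injectiveDimension (ModuleCat.of A A) = g

end Algebras

end GendoSymm

end

/-! Everything rests on one comparison map. The isomorphism eA ≅ D(Ae) turns a gendo-symmetric
structure into a linear form tr on A which is symmetric on eAe and pairs eA perfectly with Ae;
dominant dimension at least two adds the double centralizer property (`GendoCore`). These data are
left-right symmetric, so each statement about them serves both sides. The rule tr(x θ(f) y) = f(yx),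
for x in eA and y in Ae, defines a bimodule map θ : D(A) → A (`GendoCore.theta`), hence a natural
map η : M → Hom(D(A), M). It is bijective on finitely generated projectives
(`GendoCore.etaBij_of_projective`). Dimension shifting along a minimal injective resolution then
shows that M has infinite dominant dimension exactly when η is bijective on M and Ext^i(D(A), M) = 0
for all i ≥ 1 (`GendoCore.domDim_eq_top_iff`).

First claim. Adjunction identifies Hom(D(A), M) with Hom(D(M), A), so bijectivity of η gives ν⁻¹(M)
≅ M (`nonempty_equiv_dual_right`). For infinite dominant dimension, near Gorensteinness turns the
Ext condition into Gorenstein injectivity. The A-dual of a Gorenstein projective module has no Ext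
with A (`GorensteinProjectiveAux.extVanishes_dual`); applied to D(M), this makes M ≅ Hom(D(M), A)
Gorenstein projective as well. Conversely, a Gorenstein projective module is the kernel of a map of
projectives (`GorensteinProjectiveAux.exists_copresentation`), so η is bijective on it. Codominant
dimension is the same argument on the left, carried across by `extVanishes_iff_dual`.

Second claim. Let 𝒳 be the class of modules of infinite dominant dimension. It is closed under
summands and extensions and has syzygies and cosyzygies taken in powers of Q = eA, the syzygies by
the equivalence with infinite codominant dimension. CM-finiteness makes it contravariantly finite,
and finite injective dimension of A makes its projective members injective: this is an
`AdmissibleClass`. By Wakamatsu's lemma and the trace duality between Hom(Qⁿ, Z) and Hom(Z, Qⁿ),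
every map from the kernel Z of a minimal 𝒳-approximation into 𝒳 factors through some Qᵖ
(`AdmissibleClass.exists_factor_ker`). Hence a simple module outside 𝒳 receiving nonzero maps from Q
has a projective-injective approximation, and a simple module that is outside 𝒳 or projective has no
Ext¹ with 𝒳 in either direction. If 𝒳 had a nonprojective member it would contain a nonprojective
simple module, and these simples would split off a block. Connectedness makes that block all of A,
so A lies in 𝒳 and is selfinjective, which is excluded (`AdmissibleClass.injective_of_mem`).

For the bound, dominant dimension at least g + 2 gives Ext^i(D(A), M) = 0 for 1 ≤ i ≤ g, and the
injective dimension g of the left regular module gives it for i > g; such a module has infinite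
dominant dimension. -/

noncomputable section

namespace GendoSymm

/-! ### Long exact Ext sequences in terms of linear maps -/

section ExtToolkit

open Abelian

variable {R : Type u} [Ring R]
  {X Y Z N : Type u} [AddCommGroup X] [Module R X] [AddCommGroup Y] [Module R Y]
  [AddCommGroup Z] [Module R Z] [AddCommGroup N] [Module R N]

/-- `Ext^i(M, N) = 0`. -/
def ExtZero (R : Type u) [Ring R] (M N : Type u) [AddCommGroup M] [Module R M]
    [AddCommGroup N] [Module R N] (i : ℕ) : Prop :=
  Subsingleton (Ext (ModuleCat.of R M) (ModuleCat.of R N) i)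

/-- A short exact sequence of modules, given by linear maps. -/
structure IsShortExact (f : X →ₗ[R] Y) (g : Y →ₗ[R] Z) : Prop where
  inj : Function.Injective f
  exact : Function.Exact f g
  surj : Function.Surjective g

theorem IsShortExact.shortExact {f : X →ₗ[R] Y} {g : Y →ₗ[R] Z} (h : IsShortExact f g) :
    (ShortComplex.mk (ModuleCat.ofHom f) (ModuleCat.ofHom g)
      (by ext x; exact h.exact.apply_apply_eq_zero x)).ShortExact where
  exact := by
    rw [ShortComplex.ShortExact.moduleCat_exact_iff_function_exact]
    exact h.exact
  mono_f := (ModuleCat.mono_iff_injective _).2 h.inj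
  epi_g := (ModuleCat.epi_iff_surjective _).2 h.surj

theorem IsShortExact.ker (g : Y →ₗ[R] Z) (hg : Function.Surjective g) :
    IsShortExact (LinearMap.ker g).subtype g :=
  ⟨Subtype.val_injective, LinearMap.exact_subtype_ker_map g, hg⟩

theorem IsShortExact.mkQ (S : Submodule R Y) : IsShortExact S.subtype S.mkQ :=
  ⟨Subtype.val_injective, LinearMap.exact_subtype_mkQ S, Submodule.mkQ_surjective S⟩

theorem IsShortExact.coker (f : X →ₗ[R] Y) (hf : Function.Injective f) :
    IsShortExact f (LinearMap.range f).mkQ :=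
  ⟨hf, LinearMap.exact_map_mkQ_range f, Submodule.mkQ_surjective _⟩

variable {f : X →ₗ[R] Y} {g : Y →ₗ[R] Z}

theorem IsShortExact.exists_extend (h : IsShortExact f g) (hE : ExtZero R Z N 1)
    (k : X →ₗ[R] N) : ∃ l : Y →ₗ[R] N, l ∘ₗ f = k := by
  obtain ⟨x, hx⟩ := Ext.contravariant_sequence_exact₁ h.shortExact (ModuleCat.of R N)
    (Ext.mk₀ (ModuleCat.ofHom k)) (n₁ := 1) rfl (hE.elim _ _)
  obtain ⟨l, rfl⟩ := Ext.homEquiv₀.symm.surjective x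
  refine ⟨l.hom, ?_⟩
  have : ModuleCat.ofHom f ≫ l = ModuleCat.ofHom k := Ext.homEquiv₀.symm.injective (by simpa using hx)
  simpa using congrArg ModuleCat.Hom.hom this

theorem IsShortExact.exists_lift (h : IsShortExact f g) (hE : ExtZero R N X 1)
    (k : N →ₗ[R] Z) : ∃ l : N →ₗ[R] Y, g ∘ₗ l = k := by
  obtain ⟨x, hx⟩ := Ext.covariant_sequence_exact₃ (ModuleCat.of R N) h.shortExact
    (Ext.mk₀ (ModuleCat.ofHom k)) (n₁ := 1) rfl (hE.elim _ _)
  obtain ⟨l, rfl⟩ := Ext.homEquiv₀.symm.surjective x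
  refine ⟨l.hom, ?_⟩
  have : l ≫ ModuleCat.ofHom g = ModuleCat.ofHom k := Ext.homEquiv₀.symm.injective (by simpa using hx)
  simpa using congrArg ModuleCat.Hom.hom this

theorem extZero_of_forall_eq_zero {i : ℕ}
    (h : ∀ x : Ext (ModuleCat.of R X) (ModuleCat.of R N) i, x = 0) : ExtZero R X N i :=
  ⟨fun a b => (h a).trans (h b).symm⟩

/-- Since Ext¹(Y, N) = 0, each class in Ext¹(Z, N) comes from a map X → N by the connecting
homomorphism, which kills the maps that extend to Y. -/
theorem IsShortExact.extZero_one_of_extend (h : IsShortExact f g) (hY : ExtZero R Y N 1)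
    (hext : ∀ k : X →ₗ[R] N, ∃ l : Y →ₗ[R] N, l ∘ₗ f = k) : ExtZero R Z N 1 := by
  refine extZero_of_forall_eq_zero fun x => ?_
  obtain ⟨y, rfl⟩ := Ext.contravariant_sequence_exact₃ h.shortExact (ModuleCat.of R N) x
    (hY.elim _ _) (n₀ := 0) rfl
  obtain ⟨k, rfl⟩ := Ext.homEquiv₀.symm.surjective y
  obtain ⟨l, hl⟩ := hext k.hom
  have : k = ModuleCat.ofHom f ≫ ModuleCat.ofHom l := by
    ext x; exact (LinearMap.congr_fun hl x).symm
  subst this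
  simp only [Ext.homEquiv₀_symm_apply, ← Ext.mk₀_comp_mk₀]
  exact h.shortExact.extClass_comp_assoc _

theorem IsShortExact.extZero_one_of_lift (h : IsShortExact f g) (hY : ExtZero R N Y 1)
    (hlift : ∀ k : N →ₗ[R] Z, ∃ l : N →ₗ[R] Y, g ∘ₗ l = k) : ExtZero R N X 1 := by
  refine extZero_of_forall_eq_zero fun x => ?_
  obtain ⟨y, rfl⟩ := Ext.covariant_sequence_exact₁ (ModuleCat.of R N) h.shortExact x
    (hY.elim _ _) (n₀ := 0) rfl
  obtain ⟨k, rfl⟩ := Ext.homEquiv₀.symm.surjective y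
  obtain ⟨l, hl⟩ := hlift k.hom
  have : k = ModuleCat.ofHom l ≫ ModuleCat.ofHom g := by
    ext x; exact (LinearMap.congr_fun hl x).symm
  subst this
  simp only [Ext.homEquiv₀_symm_apply, ← Ext.mk₀_comp_mk₀]
  rw [Ext.comp_assoc_of_second_deg_zero, h.shortExact.comp_extClass, Ext.comp_zero]

theorem IsShortExact.extZero_succ_right (h : IsShortExact f g) {i : ℕ}
    (hX : ExtZero R X N i) (hY : ExtZero R Y N (i + 1)) : ExtZero R Z N (i + 1) := by
  refine extZero_of_forall_eq_zero fun x => ?_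
  obtain ⟨y, rfl⟩ := Ext.contravariant_sequence_exact₃ h.shortExact (ModuleCat.of R N) x
    (hY.elim _ _) (n₀ := i) (add_comm _ _)
  rw [hX.elim y 0, Ext.comp_zero]

theorem IsShortExact.extZero_left (h : IsShortExact f g) {i : ℕ}
    (hY : ExtZero R Y N i) (hZ : ExtZero R Z N (i + 1)) : ExtZero R X N i := by
  refine extZero_of_forall_eq_zero fun x => ?_
  obtain ⟨y, rfl⟩ := Ext.contravariant_sequence_exact₁ h.shortExact (ModuleCat.of R N) x
    (n₁ := i + 1) (add_comm _ _) (hZ.elim _ _)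
  rw [hY.elim y 0, Ext.comp_zero]

theorem IsShortExact.extZero_succ_left' (h : IsShortExact f g) {i : ℕ}
    (hZ : ExtZero R N Z i) (hY : ExtZero R N Y (i + 1)) : ExtZero R N X (i + 1) := by
  refine extZero_of_forall_eq_zero fun x => ?_
  obtain ⟨y, rfl⟩ := Ext.covariant_sequence_exact₁ (ModuleCat.of R N) h.shortExact x
    (hY.elim _ _) (n₀ := i) rfl
  rw [hZ.elim y 0, Ext.zero_comp]

theorem IsShortExact.extZero_right' (h : IsShortExact f g) {i : ℕ}
    (hY : ExtZero R N Y i) (hX : ExtZero R N X (i + 1)) : ExtZero R N Z i := by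
  refine extZero_of_forall_eq_zero fun x => ?_
  obtain ⟨y, rfl⟩ := Ext.covariant_sequence_exact₃ (ModuleCat.of R N) h.shortExact x
    (n₁ := i + 1) rfl (hX.elim _ _)
  rw [hY.elim y 0, Ext.zero_comp]

theorem IsShortExact.extZero_mid' (h : IsShortExact f g) {i : ℕ}
    (hX : ExtZero R N X i) (hZ : ExtZero R N Z i) : ExtZero R N Y i := by
  refine extZero_of_forall_eq_zero fun x => ?_
  obtain ⟨y, rfl⟩ := Ext.covariant_sequence_exact₂ (ModuleCat.of R N) h.shortExact x
    (hZ.elim _ _)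
  rw [hX.elim y 0, Ext.zero_comp]

theorem extZero_of_projective [Module.Projective R X] {i : ℕ} (hi : 1 ≤ i) : ExtZero R X N i := by
  obtain ⟨i, rfl⟩ := Nat.exists_eq_add_of_le' hi
  have : Projective (ModuleCat.of R X) := (IsProjective.iff_projective X).1 inferInstance
  exact Ext.subsingleton_of_projective _ _ _

theorem extZero_of_injective [Module.Injective R N] {i : ℕ} (hi : 1 ≤ i) : ExtZero R X N i := by
  obtain ⟨i, rfl⟩ := Nat.exists_eq_add_of_le' hi
  have : Injective (ModuleCat.of R N) := (Module.injective_iff_injective_object R N).1 inferInstance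
  exact Ext.subsingleton_of_injective _ _ _

theorem extZero_of_retract_left {i : ℕ} (a : X →ₗ[R] Y) (b : Y →ₗ[R] X)
    (hab : b ∘ₗ a = LinearMap.id) (h : ExtZero R Y N i) : ExtZero R X N i := by
  refine extZero_of_forall_eq_zero fun x => ?_
  have h1 : ModuleCat.ofHom a ≫ ModuleCat.ofHom b = 𝟙 _ := by
    rw [← ModuleCat.ofHom_comp, hab]; rfl
  rw [← Ext.mk₀_id_comp x, ← h1, ← Ext.mk₀_comp_mk₀_assoc,
    h.elim ((Ext.mk₀ (ModuleCat.ofHom b)).comp x (zero_add i)) 0, Ext.comp_zero]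

theorem extZero_of_retract_right {i : ℕ} (a : X →ₗ[R] Y) (b : Y →ₗ[R] X)
    (hab : b ∘ₗ a = LinearMap.id) (h : ExtZero R N Y i) : ExtZero R N X i := by
  refine extZero_of_forall_eq_zero fun x => ?_
  have h1 : ModuleCat.ofHom a ≫ ModuleCat.ofHom b = 𝟙 _ := by
    rw [← ModuleCat.ofHom_comp, hab]; rfl
  rw [← Ext.comp_mk₀_id x, ← h1, ← Ext.mk₀_comp_mk₀, ← Ext.comp_assoc_of_third_deg_zero,
    h.elim (x.comp (Ext.mk₀ (ModuleCat.ofHom a)) (add_zero i)) 0, Ext.zero_comp]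

theorem extZero_congr_left (a : X ≃ₗ[R] Y) {i : ℕ} : ExtZero R X N i ↔ ExtZero R Y N i :=
  ⟨extZero_of_retract_left a.symm.toLinearMap a.toLinearMap (by ext; simp),
    extZero_of_retract_left a.toLinearMap a.symm.toLinearMap (by ext; simp)⟩

theorem extZero_congr_right (a : X ≃ₗ[R] Y) {i : ℕ} : ExtZero R N X i ↔ ExtZero R N Y i :=
  ⟨extZero_of_retract_right a.symm.toLinearMap a.toLinearMap (by ext; simp),
    extZero_of_retract_right a.toLinearMap a.symm.toLinearMap (by ext; simp)⟩

/-- An injective submodule map whose cokernel `Z` has `Ext^1(Z, X) = 0` splits. -/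
theorem IsShortExact.exists_retraction (h : IsShortExact f g) (hE : ExtZero R Z X 1) :
    ∃ r : Y →ₗ[R] X, r ∘ₗ f = LinearMap.id := h.exists_extend hE _

end ExtToolkit

end GendoSymm

end

/-! ### From a gendo-symmetric structure to a trace form -/

noncomputable section

namespace GendoSymm

theorem exists_resolution_of_le_domDim {R : Type u} [Ring R] {M : Type u} [AddCommGroup M]
    [Module R M] {n : ℕ} (h : ((n + 1 : ℕ) : ℕ∞) ≤ domDim R M) :
    ∃ J : MinimalInjectiveResolution R M, ∀ i < n + 1, Module.Projective R (J.I i) := by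
  have h1 : (n : ℕ∞) < domDim R M := lt_of_lt_of_le (by exact_mod_cast Nat.lt_succ_self n) h
  simp only [domDim, lt_iSup_iff] at h1
  obtain ⟨m, ⟨J, hJ⟩, hm⟩ := h1
  have hm' : n < m := by exact_mod_cast hm
  exact ⟨J, fun i hi => hJ i (by omega)⟩

theorem le_domDim {R : Type u} [Ring R] {M : Type u} [AddCommGroup M] [Module R M]
    (J : MinimalInjectiveResolution R M) {n : ℕ} (h : ∀ i < n, Module.Projective R (J.I i)) :
    (n : ℕ∞) ≤ domDim R M :=
  le_iSup₂_of_le (f := fun (n : ℕ) (_ : n ∈ {n : ℕ | ∃ J : MinimalInjectiveResolution R M,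
    ∀ i < n, Module.Projective R (J.I i)}) => (n : ℕ∞)) n ⟨J, h⟩ le_rfl

/-- An idempotent `e` of an algebra `R` with a form `tr` which is symmetric on `eRe`, induces a
perfect pairing `eR × Re → K`, and for which the balanced bilinear forms on `eR × Re` are exactly
the forms `(x, y) ↦ tr (x r y)`. The notion is left-right symmetric. -/
structure GendoCore (K R : Type u) [Field K] [Ring R] [Algebra K R] where
  e : R
  idem : e * e = e
  tr : R →ₗ[K] K
  tr_comm : ∀ a b, tr (e * a * e * b * e) = tr (e * b * e * a * e)
  nondeg_left : ∀ x, (∀ y, tr (e * x * y * e) = 0) → e * x = 0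
  nondeg_right : ∀ y, (∀ x, tr (e * x * y * e) = 0) → y * e = 0
  rep_left : ∀ μ : R →ₗ[K] K, ∃ x, ∀ y, tr (e * x * y * e) = μ (y * e)
  rep_right : ∀ μ : R →ₗ[K] K, ∃ y, ∀ x, tr (e * x * y * e) = μ (e * x)
  faithful : ∀ r, (∀ x y, tr (e * x * r * y * e) = 0) → r = 0
  balanced : ∀ β : R →ₗ[K] R →ₗ[K] K,
    (∀ b x y, β (e * b * e * x) (y * e) = β (e * x) (y * e * b * e)) →
      ∃ r, ∀ x y, β (e * x) (y * e) = tr (e * x * r * y * e)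

variable {K : Type u} [Field K]

/-- The opposite data. -/
def GendoCore.op {R : Type u} [Ring R] [Algebra K R] (D : GendoCore K R) : GendoCore K Rᵐᵒᵖ where
  e := MulOpposite.op D.e
  idem := by rw [← op_mul, D.idem]
  tr := D.tr ∘ₗ (opLinearEquiv K).symm.toLinearMap
  tr_comm a b := by
    have := D.tr_comm b.unop a.unop
    simpa [mul_assoc] using this
  nondeg_left x h := by
    refine unop_injective (D.nondeg_right x.unop fun y => ?_)
    have := h (MulOpposite.op y)
    simpa [mul_assoc] using this
  nondeg_right x h := by
    refine unop_injective (D.nondeg_left x.unop fun y => ?_)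
    have := h (MulOpposite.op y)
    simpa [mul_assoc] using this
  rep_left μ := by
    obtain ⟨x, hx⟩ := D.rep_right (μ ∘ₗ (opLinearEquiv K).toLinearMap)
    refine ⟨MulOpposite.op x, fun y => ?_⟩
    have := hx y.unop
    simpa [mul_assoc] using this
  rep_right μ := by
    obtain ⟨x, hx⟩ := D.rep_left (μ ∘ₗ (opLinearEquiv K).toLinearMap)
    refine ⟨MulOpposite.op x, fun y => ?_⟩
    have := hx y.unop
    simpa [mul_assoc] using this
  faithful r h := by
    refine unop_injective (D.faithful r.unop fun x y => ?_)
    have := h (MulOpposite.op y) (MulOpposite.op x)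
    simpa [mul_assoc] using this
  balanced β h := by
    obtain ⟨r, hr⟩ := D.balanced ((β.compl₁₂ (opLinearEquiv K).toLinearMap
      (opLinearEquiv K).toLinearMap).flip) (fun b x y => by
        have := h (MulOpposite.op b) (MulOpposite.op y) (MulOpposite.op x)
        simpa [mul_assoc] using this.symm)
    refine ⟨MulOpposite.op r, fun x y => ?_⟩
    have := hr y.unop x.unop
    simpa [mul_assoc] using this

section Extraction

variable {A : Type u} [Ring A] [Algebra K A]

theorem mem_rightIdeal_iff {e : A} (he : e * e = e) {x : A} : x ∈ rightIdeal e ↔ e * x = x :=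
  ⟨by rintro ⟨a, rfl⟩; rw [← mul_assoc, he], fun h => ⟨x, h⟩⟩

theorem mem_leftIdeal_iff {e : A} (he : e * e = e) {x : A} : x ∈ leftIdeal e ↔ x * e = x :=
  ⟨by rintro ⟨a, rfl⟩; rw [mul_assoc, he], fun h => ⟨x, h⟩⟩

variable {e : A} (he : e * e = e)
  (φ : rightIdeal e ≃ₗ[Aᵐᵒᵖ] KDual K (leftIdeal e))

/-- Right multiplication by `e`, as a map to `Ae`. -/
def mulIdem (K : Type u) [Field K] [Algebra K A] (e : A) : A →ₗ[K] leftIdeal e where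
  toFun a := ⟨a * e, a, rfl⟩
  map_add' a b := Subtype.ext (add_mul a b e)
  map_smul' c a := Subtype.ext (smul_mul_assoc c a e)

/-- The form `a ↦ φ(e)(ae)`. -/
def traceForm : A →ₗ[K] K := (φ ⟨e, ⟨e, he⟩⟩).toForm ∘ₗ mulIdem K e

/-- Write x as e · x and use that φ is right linear: the whole isomorphism is determined by the
single form φ(e). -/
theorem apply_eq_traceForm (x : rightIdeal e) (y : leftIdeal e) :
    (φ x).toForm y = traceForm he φ (x * y) := by
  have hx : x = (MulOpposite.op (x : A)) • (⟨e, ⟨e, he⟩⟩ : rightIdeal e) :=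
    Subtype.ext ((mem_rightIdeal_iff he).1 x.2).symm
  conv_lhs => rw [hx, map_smul, KDual.op_smul_apply]
  simp only [traceForm, LinearMap.comp_apply]
  congr 1
  exact Subtype.ext (by
    change (x : A) * y = x * y * e
    rw [mul_assoc, (mem_leftIdeal_iff he).1 y.2])

variable (hφ : ∀ (b : A) (x : rightIdeal e) (y : leftIdeal e),
  (φ (cornerMul e b x)).toForm y = (φ x).toForm (mulCorner e b y))

-- Left eAe-linearity of φ, evaluated at e, is precisely the symmetry of the form on eAe.
include hφ in
theorem traceForm_comm (a b : A) :
    traceForm he φ (e * a * e * b * e) = traceForm he φ (e * b * e * a * e) := by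
  have h := hφ b ⟨e, ⟨e, he⟩⟩ ⟨e * a * e, ⟨e * a, rfl⟩⟩
  rw [apply_eq_traceForm, apply_eq_traceForm] at h
  have h1 : ((cornerMul e b ⟨e, ⟨e, he⟩⟩ : rightIdeal e) : A) * (e * a * e) = e * b * e * a * e := by
    change e * b * e * e * (e * a * e) = _
    simp only [mul_assoc]
    rw [← mul_assoc e e (a * e), he, ← mul_assoc e e (a * e), he]
  have h2 : e * ((mulCorner e b ⟨e * a * e, ⟨e * a, rfl⟩⟩ : leftIdeal e) : A) =
      e * a * e * b * e := by
    change e * (e * a * e * (e * b * e)) = _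
    simp only [← mul_assoc]
    rw [he, mul_assoc (e * a) e e, he]
  dsimp only at h
  rw [h1, h2] at h
  exact h.symm

theorem eq_zero_of_traceForm_left (x : rightIdeal e)
    (h : ∀ y : leftIdeal e, traceForm he φ (x * y) = 0) : x = 0 := by
  refine φ.injective ?_
  rw [map_zero]
  exact LinearMap.ext fun y => (apply_eq_traceForm he φ x y).trans (h y)

theorem eq_zero_of_traceForm_right (y : leftIdeal e)
    (h : ∀ x : rightIdeal e, traceForm he φ (x * y) = 0) : y = 0 := by
  refine (Module.forall_dual_apply_eq_zero_iff K y).1 fun g => ?_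
  obtain ⟨x, hx⟩ := φ.surjective g
  have := apply_eq_traceForm he φ x y
  rw [h x, hx] at this
  exact this

/-- The pairing `eA × Ae → K`. -/
def tracePairing : rightIdeal e →ₗ[K] leftIdeal e →ₗ[K] K :=
  ((LinearMap.mul K A).compr₂ (traceForm he φ)).compl₁₂
    (LinearMap.restrictScalars K (rightIdeal e).subtype)
    (LinearMap.restrictScalars K (leftIdeal e).subtype)

instance [FiniteDimensional K A] : FiniteDimensional K (rightIdeal e) :=
  FiniteDimensional.of_injective (LinearMap.restrictScalars K (rightIdeal e).subtype)
    Subtype.val_injective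

instance [FiniteDimensional K A] : FiniteDimensional K (leftIdeal e) :=
  FiniteDimensional.of_injective (LinearMap.restrictScalars K (leftIdeal e).subtype)
    Subtype.val_injective

theorem tracePairing_isPerfPair [FiniteDimensional K A] : (tracePairing he φ).IsPerfPair :=
  .of_injective
    ((injective_iff_map_eq_zero _).2 fun x hx =>
      eq_zero_of_traceForm_left he φ x fun y => LinearMap.congr_fun hx y)
    ((injective_iff_map_eq_zero _).2 fun x hx =>
      eq_zero_of_traceForm_right he φ x fun y => LinearMap.congr_fun hx y)

/-- Elements of a projective right module are separated by maps to a faithful right ideal. -/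
theorem exists_map_rightIdeal_ne_zero [FaithfulSMul Aᵐᵒᵖ (rightIdeal e)] {P : Type u}
    [AddCommGroup P] [Module Aᵐᵒᵖ P] [Module.Projective Aᵐᵒᵖ P] (p : P)
    (h : ∀ ψ : P →ₗ[Aᵐᵒᵖ] rightIdeal e, ψ p = 0) : p = 0 := by
  refine (Module.forall_dual_apply_eq_zero_iff Aᵐᵒᵖ p).1 fun g => ?_
  refine FaithfulSMul.eq_of_smul_eq_smul (α := rightIdeal e) fun x => ?_
  rw [zero_smul]
  exact h ((LinearMap.toSpanSingleton Aᵐᵒᵖ (rightIdeal e) x) ∘ₗ g)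

/-- The second term of the resolution is used here. The embedding j and the map from A into I₀
extend through each other. The image of z in I₁ vanishes because I₁ is projective, hence separated
by maps to the faithful ideal eA. So the image of z in I₀ comes from A, and the coordinates of z -
i(r z) vanish by the same hypothesis on functionals. -/
theorem exists_mem_range_of_le_domDim (hdom : 2 ≤ domDim Aᵐᵒᵖ A)
    [FaithfulSMul Aᵐᵒᵖ (rightIdeal e)] [Module.Injective Aᵐᵒᵖ (rightIdeal e)] {n : ℕ}
    (j : A →ₗ[Aᵐᵒᵖ] (Fin n → rightIdeal e)) (hj : Function.Injective j)
    (z : Fin n → rightIdeal e)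
    (hz : ∀ ψ : (Fin n → rightIdeal e) →ₗ[Aᵐᵒᵖ] rightIdeal e, ψ ∘ₗ j = 0 → ψ z = 0) :
    ∃ a, j a = z := by
  obtain ⟨J, hJ⟩ := exists_resolution_of_le_domDim (n := 1) (by exact_mod_cast hdom)
  have := J.injective 0
  have := hJ 1 (by norm_num)
  obtain ⟨i, hi⟩ := Module.Injective.out J.ι J.ι_injective j
  obtain ⟨r, hr⟩ := Module.Injective.out j hj J.ι
  have h1 : J.d 0 (r z) = 0 := by
    refine exists_map_rightIdeal_ne_zero _ fun ψ => hz (ψ ∘ₗ J.d 0 ∘ₗ r) ?_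
    refine LinearMap.ext fun a => ?_
    simp [hr, J.exact_zero.apply_apply_eq_zero]
  have h2 : z - i (r z) = 0 := by
    funext s
    refine hz (LinearMap.proj s ∘ₗ (LinearMap.id - i ∘ₗ r)) ?_
    refine LinearMap.ext fun a => ?_
    simp [hr, hi]
  obtain ⟨a, ha⟩ := (J.exact_zero _).1 h1
  exact ⟨a, by rw [← hi, ha]; exact (sub_eq_zero.1 h2).symm⟩

theorem rightIdeal_map_apply (ψ : rightIdeal e →ₗ[Aᵐᵒᵖ] rightIdeal e) (x : rightIdeal e) :
    ψ x = cornerMul e (ψ ⟨e, ⟨e, he⟩⟩) x := by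
  have h1 : ∀ x : rightIdeal e, ((ψ x : rightIdeal e) : A) = ψ ⟨e, ⟨e, he⟩⟩ * x := by
    intro x
    have hx : x = (MulOpposite.op (x : A)) • (⟨e, ⟨e, he⟩⟩ : rightIdeal e) :=
      Subtype.ext ((mem_rightIdeal_iff he).1 x.2).symm
    conv_lhs => rw [hx, map_smul]
    rfl
  refine Subtype.ext ?_
  change _ = e * _ * e * (x : A)
  rw [(mem_rightIdeal_iff he).1 (Subtype.prop _), mul_assoc, (mem_rightIdeal_iff he).1 x.2, h1 x]

include he in
/-- The double centralizer property. -/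
theorem exists_mul_of_commute [FiniteDimensional K A] (hdom : 2 ≤ domDim Aᵐᵒᵖ A)
    [FaithfulSMul Aᵐᵒᵖ (rightIdeal e)] [Module.Injective Aᵐᵒᵖ (rightIdeal e)]
    (h : rightIdeal e →+ rightIdeal e)
    (hh : ∀ b x, h (cornerMul e b x) = cornerMul e b (h x)) :
    ∃ a : A, ∀ x, h x = MulOpposite.op a • x := by
  obtain ⟨n, v, hv⟩ := Module.Finite.exists_fin (R := K) (M := rightIdeal e)
  -- Evaluation on a finite spanning family v of eA. An additive map commuting with eAe, which
  -- contains the scalars, is determined by its values on v.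
  let j : A →ₗ[Aᵐᵒᵖ] (Fin n → rightIdeal e) :=
    LinearMap.pi fun s =>
      { toFun := fun a => MulOpposite.op a • v s
        map_add' := fun a b => by rw [MulOpposite.op_add, add_smul]
        map_smul' := fun c a => by
          change MulOpposite.op (a * c.unop) • v s = c • MulOpposite.op a • v s
          rw [op_mul, mul_smul, op_unop] }
  have key : ∀ (a : A) (g : rightIdeal e →+ rightIdeal e),
      (∀ b x, g (cornerMul e b x) = cornerMul e b (g x)) →
      (∀ s, g (v s) = MulOpposite.op a • v s) → ∀ x, g x = MulOpposite.op a • x := by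
    intro a g hg hs x
    have hsm : ∀ (c : K) (x : rightIdeal e), c • x = cornerMul e (algebraMap K A c) x := by
      intro c x
      refine Subtype.ext ?_
      change c • (x : A) = e * algebraMap K A c * e * x
      rw [mul_assoc, (mem_rightIdeal_iff he).1 x.2, ← Algebra.commutes, mul_assoc,
        (mem_rightIdeal_iff he).1 x.2, Algebra.smul_def]
    have hx : x ∈ Submodule.span K (Set.range v) := hv ▸ Submodule.mem_top
    induction hx using Submodule.span_induction with
    | mem x hx => obtain ⟨s, rfl⟩ := hx; exact hs s
    | zero => rw [map_zero, smul_zero]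
    | add x y _ _ hx hy => rw [map_add, hx, hy, smul_add]
    | smul c x _ hx => rw [hsm, hg, hx, ← hsm, ← hsm, smul_comm]
  have hj : Function.Injective j := by
    refine (injective_iff_map_eq_zero _).2 fun a ha => ?_
    have h0 := key a 0 (fun b x => Subtype.ext (by simp [cornerMul]))
      (fun s => (congrFun ha s).symm)
    refine op_injective (FaithfulSMul.eq_of_smul_eq_smul (α := rightIdeal e) fun x => ?_)
    rw [← h0 x, op_zero, zero_smul, AddMonoidHom.zero_apply]
  -- Every functional (eA)ⁿ → eA is a sum of left multiplications by elements of eAe. As h commutes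
  -- with these, a functional that kills v also kills h(v).
  obtain ⟨a, ha⟩ := exists_mem_range_of_le_domDim hdom j hj (fun s => h (v s)) (by
    intro ψ hψ
    have hdec : ∀ z : Fin n → rightIdeal e,
        ψ z = ∑ s, cornerMul e (ψ (Pi.single s ⟨e, ⟨e, he⟩⟩)) (z s) := by
      intro z
      conv_lhs => rw [← Finset.univ_sum_single z, map_sum]
      refine Finset.sum_congr rfl fun s _ => ?_
      exact rightIdeal_map_apply he (ψ ∘ₗ LinearMap.single Aᵐᵒᵖ (fun _ => rightIdeal e) s) (z s)
    rw [hdec]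
    simp_rw [← hh]
    rw [← map_sum]
    have hj1 : j 1 = v := by
      funext s
      change MulOpposite.op (1 : A) • v s = v s
      rw [op_one, one_smul]
    have : ψ v = 0 := by rw [← hj1]; exact LinearMap.congr_fun hψ 1
    rw [hdec] at this
    rw [this, map_zero])
  exact ⟨a, key a h hh fun s => (congrFun ha s).symm⟩

-- For fixed x in eA, β(x, ·) is a form on Ae, hence φ of some h(x). Balancedness says that h
-- commutes with eAe, so h is right multiplication by an element of A by the double centralizer
-- property.
include hφ in
theorem exists_traceForm_of_balanced [FiniteDimensional K A] (hdom : 2 ≤ domDim Aᵐᵒᵖ A)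
    [FaithfulSMul Aᵐᵒᵖ (rightIdeal e)] [Module.Injective Aᵐᵒᵖ (rightIdeal e)]
    (β : A →ₗ[K] A →ₗ[K] K)
    (hβ : ∀ b x y, β (e * b * e * x) (y * e) = β (e * x) (y * e * b * e)) :
    ∃ r, ∀ x y, β (e * x) (y * e) = traceForm he φ (e * x * r * y * e) := by
  let g : rightIdeal e → KDual K (leftIdeal e) := fun x =>
    (β x) ∘ₗ LinearMap.restrictScalars K (leftIdeal e).subtype
  let h : rightIdeal e →+ rightIdeal e :=
    φ.symm.toAddEquiv.toAddMonoidHom.comp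
      { toFun := g
        map_zero' := LinearMap.ext fun y => by simp [g]; rfl
        map_add' := fun x x' => LinearMap.ext fun y => by simp [g]; rfl }
  have hform : ∀ x y, (φ (h x)).toForm y = β x y := by
    intro x y
    have : φ (h x) = g x := φ.apply_symm_apply _
    rw [this]; rfl
  obtain ⟨a, ha⟩ := exists_mul_of_commute (K := K) he hdom h (by
    intro b x
    refine φ.injective (LinearMap.ext fun y => ?_)
    refine (hform _ y).trans (Eq.trans ?_ (hφ b (h x) y).symm)
    rw [hform]
    have := hβ b x y
    rw [(mem_rightIdeal_iff he).1 x.2, (mem_leftIdeal_iff he).1 y.2] at this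
    refine this.trans (congrArg (β x) ?_)
    change (y : A) * b * e = y * (e * b * e)
    rw [← mul_assoc, ← mul_assoc, (mem_leftIdeal_iff he).1 y.2])
  refine ⟨a, fun x y => ?_⟩
  have h1 := hform ⟨e * x, ⟨x, rfl⟩⟩ ⟨y * e, ⟨y, rfl⟩⟩
  rw [ha, apply_eq_traceForm he] at h1
  rw [← h1]
  congr 1
  change e * x * a * (y * e) = _
  rw [← mul_assoc]

end Extraction

/-- The data attached to a gendo-symmetric algebra. -/
theorem IsGendoSymmetric.nonempty_gendoCore {A : Type u} [Ring A] [Algebra K A]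
    [FiniteDimensional K A] (h : IsGendoSymmetric K A) : Nonempty (GendoCore K A) := by
  obtain ⟨hdom, e, he, ⟨hf, -⟩, -, hinj, φ, hφ⟩ := h
  have he : e * e = e := he
  have hp := tracePairing_isPerfPair he φ
  refine ⟨⟨e, he, traceForm he φ, traceForm_comm he φ hφ, fun x h => ?_, fun y h => ?_,
    fun μ => ?_, fun μ => ?_, fun r h => ?_, exists_traceForm_of_balanced he φ hφ hdom⟩⟩
  · refine congrArg Subtype.val (eq_zero_of_traceForm_left he φ ⟨e * x, ⟨x, rfl⟩⟩ fun y => ?_)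
    rw [← h y, mul_assoc _ (y : A) e, (mem_leftIdeal_iff he).1 y.2]
  · refine congrArg Subtype.val (eq_zero_of_traceForm_right he φ ⟨y * e, ⟨y, rfl⟩⟩ fun x => ?_)
    rw [← h x, (mem_rightIdeal_iff he).1 x.2, mul_assoc]
  · obtain ⟨x, hx⟩ := hp.bijective_left.2 (μ ∘ₗ LinearMap.restrictScalars K (leftIdeal e).subtype)
    refine ⟨x, fun y => ?_⟩
    have := LinearMap.congr_fun hx ⟨y * e, ⟨y, rfl⟩⟩
    refine Eq.trans ?_ this
    change _ = traceForm he φ (x * (y * e))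
    rw [(mem_rightIdeal_iff he).1 x.2, mul_assoc]
  · obtain ⟨y, hy⟩ := hp.bijective_right.2 (μ ∘ₗ LinearMap.restrictScalars K (rightIdeal e).subtype)
    refine ⟨y, fun x => ?_⟩
    have := LinearMap.congr_fun hy ⟨e * x, ⟨x, rfl⟩⟩
    refine Eq.trans ?_ this
    change _ = traceForm he φ (e * x * y)
    rw [mul_assoc, (mem_leftIdeal_iff he).1 y.2]
  · refine op_injective (FaithfulSMul.eq_of_smul_eq_smul (α := rightIdeal e) fun x => ?_)
    rw [op_zero, zero_smul]
    refine eq_zero_of_traceForm_left he φ _ fun y => ?_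
    change traceForm he φ (x * r * y) = 0
    rw [← h x y, (mem_rightIdeal_iff he).1 x.2, mul_assoc _ (y : A) e,
      (mem_leftIdeal_iff he).1 y.2]

end GendoSymm

end

/-! ### The map θ from the dual of the regular module, and the natural map η -/

noncomputable section

namespace GendoSymm

variable {K : Type u} [Field K] {R : Type u} [Ring R] [Algebra K R]

/-- The vector space structure of a module over a `K`-algebra. -/
abbrev scalarModule (K R : Type u) [Field K] [Ring R] [Algebra K R] (M : Type u) [AddCommGroup M]
    [Module R M] : Module K M := Module.compHom M (algebraMap K R)

theorem scalarModule_isScalarTower (K R : Type u) [Field K] [Ring R] [Algebra K R] (M : Type u)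
    [AddCommGroup M] [Module R M] :
    letI := scalarModule K R M; IsScalarTower K R M :=
  letI := scalarModule K R M
  ⟨fun c r m => by
    change (c • r) • m = algebraMap K R c • r • m
    rw [Algebra.smul_def, mul_smul]⟩

/-- `E` is the `K`-dual of the regular right module. -/
structure RegularDual (K R : Type u) [Field K] [Ring R] [Algebra K R] (E : Type u)
    [AddCommGroup E] [Module R E] where
  ev : E ≃+ (R →ₗ[K] K)
  ev_smul : ∀ r f x, ev (r • f) x = ev f (x * r)

section Eta

variable (D : GendoCore K R) {E : Type u} [AddCommGroup E] [Module R E] (V : RegularDual K R E)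

namespace GendoCore

theorem e_mul_e_mul (x : R) : D.e * (D.e * x) = D.e * x := by rw [← mul_assoc, D.idem]

-- The form (x, y) ↦ f(yx) on eR × Re is balanced over eRe, so the double centralizer property
-- represents it by an element.
include V in
theorem exists_theta (f : E) :
    ∃ r, ∀ x y, D.tr (D.e * x * r * y * D.e) = V.ev f (y * D.e * x) := by
  obtain ⟨r, hr⟩ := D.balanced ((LinearMap.mul K R).flip.compr₂ (V.ev f)) (fun b x y => by
    simp only [LinearMap.compr₂_apply, LinearMap.flip_apply, LinearMap.mul_apply', mul_assoc,
      D.e_mul_e_mul])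
  refine ⟨r, fun x y => ?_⟩
  rw [← hr x y]
  simp only [LinearMap.compr₂_apply, LinearMap.flip_apply, LinearMap.mul_apply', mul_assoc,
    D.e_mul_e_mul]

theorem eq_of_tr {r s : R}
    (h : ∀ x y, D.tr (D.e * x * r * y * D.e) = D.tr (D.e * x * s * y * D.e)) : r = s := by
  refine sub_eq_zero.1 (D.faithful _ fun x y => ?_)
  rw [mul_sub, sub_mul, sub_mul, map_sub, h, sub_self]

/-- The map `θ : E → R` characterized by `tr (x θ(f) y) = f (y x)`. -/
def theta : E →ₗ[R] R where
  toFun f := (D.exists_theta V f).choose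
  map_add' f g := D.eq_of_tr fun x y => by
    rw [(D.exists_theta V (f + g)).choose_spec, mul_add, add_mul, add_mul, map_add,
      map_add, (D.exists_theta V f).choose_spec, (D.exists_theta V g).choose_spec]
    rfl
  map_smul' r f := D.eq_of_tr fun x y => by
    rw [(D.exists_theta V (r • f)).choose_spec, V.ev_smul, RingHom.id_apply, smul_eq_mul,
      ← mul_assoc (D.e * x), mul_assoc D.e x r, (D.exists_theta V f).choose_spec, mul_assoc _ x r]

theorem tr_theta (f : E) (x y : R) :
    D.tr (D.e * x * D.theta V f * y * D.e) = V.ev f (y * D.e * x) :=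
  (D.exists_theta V f).choose_spec x y

/-- This is linearity of θ for the second module structure on the dual. It makes the comparison of M
with Hom(D(M), A) linear over A. -/
theorem theta_mul {f f' : E} {r : R} (h : ∀ x, V.ev f' x = V.ev f (r * x)) :
    D.theta V f' = D.theta V f * r :=
  D.eq_of_tr fun x y => by
    rw [tr_theta, h, ← mul_assoc (D.e * x), mul_assoc _ r y, tr_theta, mul_assoc, mul_assoc,
      mul_assoc]

variable {M N : Type u} [AddCommGroup M] [Module R M] [AddCommGroup N] [Module R N]

/-- The natural map `M → Hom(E, M)`, `m ↦ (f ↦ θ(f) m)`. -/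
def eta : M →+ (E →ₗ[R] M) where
  toFun m := (LinearMap.toSpanSingleton R M m) ∘ₗ D.theta V
  map_zero' := by ext; simp
  map_add' m m' := by ext; simp

theorem eta_apply (m : M) (f : E) : D.eta V m f = D.theta V f • m := rfl

theorem eta_map (k : M →ₗ[R] N) (m : M) : D.eta V (k m) = k ∘ₗ D.eta V m := by
  ext f; simp [eta_apply]

variable (M) in
/-- The natural map `M → Hom(E, M)` is injective. -/
def EtaInj : Prop := Function.Injective (D.eta V (M := M))

variable (M) in
/-- The natural map `M → Hom(E, M)` is bijective. -/
def EtaBij : Prop := Function.Bijective (D.eta V (M := M))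

variable {D V}

theorem EtaBij.etaInj (h : D.EtaBij V M) : D.EtaInj V M := h.1

theorem EtaInj.of_injective (k : M →ₗ[R] N) (hk : Function.Injective k) (h : D.EtaInj V N) :
    D.EtaInj V M := by
  refine (injective_iff_map_eq_zero _).2 fun m hm => hk (h ?_)
  rw [eta_map, hm, map_zero, map_zero, LinearMap.comp_zero]

/-- Hom(E, -) is left exact and η is natural, so a map E → M is found as an element of N, which dies
in J because η is injective there. -/
theorem EtaBij.of_exact {J : Type u} [AddCommGroup J] [Module R J] {k : M →ₗ[R] N}
    {l : N →ₗ[R] J} (hk : Function.Injective k) (hkl : Function.Exact k l)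
    (hN : D.EtaBij V N) (hJ : D.EtaInj V J) : D.EtaBij V M := by
  refine ⟨hN.etaInj.of_injective k hk, fun h => ?_⟩
  obtain ⟨n, hn⟩ := hN.2 (k ∘ₗ h)
  have hl : l n = 0 := by
    refine hJ ?_
    rw [eta_map, hn, map_zero]
    ext f; exact hkl.apply_apply_eq_zero _
  obtain ⟨m, rfl⟩ := (hkl n).1 hl
  refine ⟨m, ?_⟩
  ext f
  refine hk ?_
  rw [eta_map] at hn
  exact LinearMap.congr_fun hn f

theorem EtaBij.retract (a : M →ₗ[R] N) (b : N →ₗ[R] M) (hab : b ∘ₗ a = LinearMap.id)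
    (h : D.EtaBij V N) : D.EtaBij V M := by
  have hab' : ∀ m, b (a m) = m := LinearMap.congr_fun hab
  refine ⟨h.etaInj.of_injective a (Function.LeftInverse.injective hab'), fun k => ?_⟩
  obtain ⟨n, hn⟩ := h.2 (a ∘ₗ k)
  refine ⟨b n, ?_⟩
  rw [eta_map, hn]
  ext f; exact hab' _

theorem EtaBij.pi {n : ℕ} (h : D.EtaBij V M) : D.EtaBij V (Fin n → M) := by
  constructor
  · intro x y hxy
    funext i
    refine h.1 ?_
    have := congrArg (fun l => LinearMap.proj i ∘ₗ l) hxy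
    simp only [← eta_map] at this
    exact this
  · intro k
    choose m hm using fun i => h.2 (LinearMap.proj i ∘ₗ k)
    refine ⟨m, ?_⟩
    ext f i
    exact LinearMap.congr_fun (hm i) f

variable {X Y Z : Type u} [AddCommGroup X] [Module R X] [AddCommGroup Y] [Module R Y]
  [AddCommGroup Z] [Module R Z] {f : X →ₗ[R] Y} {g : Y →ₗ[R] Z}

theorem EtaInj.coker (hfg : IsShortExact f g) (hX : D.EtaBij V X) (hY : D.EtaInj V Y) :
    D.EtaInj V Z := by
  refine (injective_iff_map_eq_zero _).2 fun z hz => ?_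
  obtain ⟨y, rfl⟩ := hfg.surj z
  rw [eta_map] at hz
  have hmem : ∀ w, ∃ x, f x = D.eta V y w := fun w => (hfg.exact _).1 (LinearMap.congr_fun hz w)
  obtain ⟨k, hk⟩ : ∃ k : E →ₗ[R] X, f ∘ₗ k = D.eta V y :=
    ⟨(LinearEquiv.ofInjective f hfg.inj).symm.toLinearMap ∘ₗ
      (D.eta V y).codRestrict (LinearMap.range f) hmem, by
        ext w
        exact congrArg Subtype.val ((LinearEquiv.ofInjective f hfg.inj).apply_symm_apply _)⟩
  obtain ⟨x, rfl⟩ := hX.2 k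
  rw [← eta_map] at hk
  rw [← hY hk]
  exact hfg.exact.apply_apply_eq_zero x

/-- The condition Ext¹(E, X) = 0 lifts maps E → Z to Y, where they are values of η. This is where
the Ext condition enters the passage to cosyzygies. -/
theorem EtaBij.coker (hfg : IsShortExact f g) (hX : D.EtaBij V X) (hY : D.EtaBij V Y)
    (hE : ExtZero R E X 1) : D.EtaBij V Z := by
  refine ⟨EtaInj.coker hfg hX hY.etaInj, fun k => ?_⟩
  obtain ⟨l, rfl⟩ := hfg.exists_lift hE k
  obtain ⟨y, rfl⟩ := hY.2 l
  exact ⟨g y, eta_map D V g y⟩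

theorem EtaBij.extension (hfg : IsShortExact f g) (hX : D.EtaBij V X) (hZ : D.EtaBij V Z) :
    D.EtaBij V Y := by
  constructor
  · refine (injective_iff_map_eq_zero _).2 fun y hy => ?_
    have h1 : g y = 0 := hZ.1 (by rw [eta_map, hy, map_zero, LinearMap.comp_zero])
    obtain ⟨x, rfl⟩ := (hfg.exact y).1 h1
    have h2 : x = 0 := by
      refine hX.1 ?_
      ext w
      refine hfg.inj ?_
      rw [eta_map] at hy
      simpa using LinearMap.congr_fun hy w
    rw [h2, map_zero]
  · intro k
    obtain ⟨z, hz⟩ := hZ.2 (g ∘ₗ k)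
    obtain ⟨y, rfl⟩ := hfg.surj z
    rw [eta_map] at hz
    have hmem : ∀ w, ∃ x, f x = (k - D.eta V y) w := fun w => (hfg.exact _).1 (by
      rw [LinearMap.sub_apply, map_sub, sub_eq_zero]
      exact (LinearMap.congr_fun hz w).symm)
    obtain ⟨l, hl⟩ : ∃ l : E →ₗ[R] X, f ∘ₗ l = k - D.eta V y :=
      ⟨(LinearEquiv.ofInjective f hfg.inj).symm.toLinearMap ∘ₗ
        (k - D.eta V y).codRestrict (LinearMap.range f) hmem, by
          ext w
          exact congrArg Subtype.val ((LinearEquiv.ofInjective f hfg.inj).apply_symm_apply _)⟩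
    obtain ⟨x, rfl⟩ := hX.2 l
    refine ⟨f x + y, ?_⟩
    rw [map_add, eta_map, hl, sub_add_cancel]

end GendoCore

/-! ### The natural map on projective modules -/

namespace RegularDual

include V in
theorem ev_symm_smul (c : K) (μ : R →ₗ[K] K) :
    V.ev.symm (c • μ) = algebraMap K R c • V.ev.symm μ := by
  refine V.ev.injective (LinearMap.ext fun x => ?_)
  rw [V.ev.apply_symm_apply, V.ev_smul, V.ev.apply_symm_apply, ← Algebra.commutes,
    ← Algebra.smul_def, map_smul, LinearMap.smul_apply]

variable [FiniteDimensional K R]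

/-- Every additive family of linear forms on the dual is given by evaluation. -/
theorem exists_eval (h : E →ₗ[R] R) (τ : R →ₗ[K] R →ₗ[K] K) :
    ∃ ψ : R →ₗ[K] R, ∀ y f, V.ev f (ψ y) = τ y (h f) := by
  let L : R →ₗ[K] Module.Dual K (Module.Dual K R) :=
    { toFun := fun y =>
        { toFun := fun μ => τ y (h (V.ev.symm μ))
          map_add' := fun μ μ' => by rw [map_add, map_add, map_add]
          map_smul' := fun c μ => by
            rw [V.ev_symm_smul, map_smul, smul_eq_mul, ← Algebra.smul_def, map_smul]; rfl }
      map_add' := fun y y' => by ext; simp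
      map_smul' := fun c y => by ext; simp }
  refine ⟨(Module.evalEquiv K R).symm.toLinearMap ∘ₗ L, fun y f => ?_⟩
  have : Module.Dual.eval K R ((Module.evalEquiv K R).symm (L y)) = L y :=
    (Module.evalEquiv K R).apply_symm_apply (L y)
  have h2 := LinearMap.congr_fun this (V.ev f)
  refine h2.trans ?_
  change τ y (h (V.ev.symm (V.ev f))) = _
  rw [V.ev.symm_apply_apply]

theorem ev_separates {x y : R} (h : ∀ f, V.ev f x = V.ev f y) : x = y := by
  refine sub_eq_zero.1 ((Module.forall_dual_apply_eq_zero_iff K (x - y)).1 fun μ => ?_)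
  have := h (V.ev.symm μ)
  rw [V.ev.apply_symm_apply] at this
  rw [map_sub, this, sub_self]

end RegularDual

namespace GendoCore

variable [FiniteDimensional K R]

/-- Injectivity follows from faithfulness of the trace form. For surjectivity, a map h : E → R is
encoded by its adjoint ψ : R → R under the pairing of R with its dual; the balanced form (x, y) ↦
tr(x ψ(y)) recovers the element r with h(f) = θ(f) r. -/
theorem etaBij_self : D.EtaBij V R := by
  constructor
  · refine (injective_iff_map_eq_zero _).2 fun r hr => D.faithful r fun x y => ?_
    have h1 : ∀ f x, V.ev f (r * y * D.e * x) = 0 := fun f x => by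
      have h2 : D.theta V f * r = 0 := LinearMap.congr_fun hr f
      rw [← D.tr_theta, ← mul_assoc _ r y, mul_assoc _ _ r, h2, mul_zero, zero_mul, zero_mul,
        map_zero]
    have h3 : r * y * D.e = 0 := V.ev_separates fun f => by
      rw [← mul_one (r * y * D.e), h1, map_zero]
    rw [mul_assoc, mul_assoc, ← mul_assoc r, h3, mul_zero, map_zero]
  · intro h
    obtain ⟨ψ, hψ⟩ := V.exists_eval h ((LinearMap.mul K R).flip.compr₂
      (D.tr ∘ₗ LinearMap.mulLeft K D.e ∘ₗ LinearMap.mulRight K D.e))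
    have hψ : ∀ y f, V.ev f (ψ y) = D.tr (D.e * h f * y * D.e) := fun y f => by
      rw [hψ]; simp [mul_assoc]
    have hψe : ∀ y, ψ (y * D.e) = ψ y := fun y => V.ev_separates fun f => by
      rw [hψ, hψ]; simp only [mul_assoc, D.idem]
    have hψb : ∀ b y, ψ (y * D.e * b * D.e) = ψ y * D.e * b * D.e := fun b y =>
      V.ev_separates fun f => by
        have := D.tr_comm b (h f * y)
        simp only [mul_assoc] at this ⊢
        rw [← V.ev_smul, hψ, hψ, map_smul]
        simp only [mul_assoc, smul_eq_mul, D.e_mul_e_mul, D.idem]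
        exact this.symm
    have hψ1 : ∀ y, ψ y * D.e = ψ y := fun y => by
      have := hψb 1 y
      simp only [mul_one, mul_assoc, D.idem] at this
      rw [← this, hψe]
    -- By nondegeneracy, representing this form by r amounts to ψ(y) = r y e.
    obtain ⟨r, hr⟩ := D.balanced
      (((LinearMap.mul K R).compr₂ (D.tr ∘ₗ LinearMap.mulRight K D.e)).compl₁₂ LinearMap.id ψ)
      (fun b x y => by
        have := D.tr_comm b (x * ψ y)
        simp only [LinearMap.compl₁₂_apply, LinearMap.compr₂_apply, LinearMap.comp_apply,
          LinearMap.id_apply, LinearMap.mul_apply', LinearMap.mulRight_apply, hψb]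
        simp only [hψe, mul_assoc, D.idem] at this ⊢
        exact this)
    have hr' : ∀ y, ψ y = r * y * D.e := fun y => by
      have h0 : (ψ y - r * y) * D.e = 0 := D.nondeg_right _ fun x => by
        have := hr x y
        simp only [LinearMap.compl₁₂_apply, LinearMap.compr₂_apply, LinearMap.comp_apply,
          LinearMap.id_apply, LinearMap.mul_apply', LinearMap.mulRight_apply, hψe] at this
        rw [mul_sub, sub_mul, map_sub, this, ← mul_assoc, sub_self]
      rw [sub_mul, hψ1] at h0
      exact sub_eq_zero.1 h0
    refine ⟨r, LinearMap.ext fun f => D.eq_of_tr fun x y => ?_⟩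
    have h1 := hψ y (x • f)
    rw [V.ev_smul, hr', map_smul, smul_eq_mul, ← mul_assoc] at h1
    rw [← h1, eta_apply, smul_eq_mul, ← mul_assoc, mul_assoc _ r y, tr_theta]

theorem etaBij_of_projective {P : Type u} [AddCommGroup P] [Module R P] [Module.Finite R P]
    [Module.Projective R P] : D.EtaBij V P := by
  obtain ⟨n, p, s, -, -, hps⟩ := Module.Finite.exists_comp_eq_id_of_projective R P
  exact (EtaBij.pi (D.etaBij_self V)).retract s p hps

end GendoCore

end Eta

end GendoSymm

end

/-! ### Injectivity of Re, embeddings and injective envelopes -/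

noncomputable section

namespace GendoSymm

variable {K : Type u} [Field K] {R : Type u} [Ring R] [Algebra K R]

section Finiteness

variable (K)

theorem isArtinianRing_of_finiteDimensional (R : Type u) [Ring R] [Algebra K R]
    [FiniteDimensional K R] : IsArtinianRing R :=
  isArtinian_of_tower K inferInstance

theorem isNoetherianRing_of_finiteDimensional (R : Type u) [Ring R] [Algebra K R]
    [FiniteDimensional K R] : IsNoetherianRing R :=
  isNoetherian_of_tower K inferInstance

end Finiteness

theorem injective_of_retract {M N : Type u} [AddCommGroup M] [Module R M] [AddCommGroup N]
    [Module R N] [Module.Injective R N] (a : M →ₗ[R] N) (b : N →ₗ[R] M)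
    (hab : b ∘ₗ a = LinearMap.id) : Module.Injective R M where
  out X Y _ _ _ _ f hf g := by
    obtain ⟨h, hh⟩ := Module.Injective.out f hf (a ∘ₗ g)
    refine ⟨b ∘ₗ h, fun x => ?_⟩
    rw [LinearMap.comp_apply, hh]
    exact LinearMap.congr_fun hab (g x)

theorem injective_of_linearEquiv {M N : Type u} [AddCommGroup M] [Module R M] [AddCommGroup N]
    [Module R N] [Module.Injective R N] (a : M ≃ₗ[R] N) : Module.Injective R M :=
  injective_of_retract a.toLinearMap a.symm.toLinearMap (by ext; simp)

/-- Arbitrary test modules carry the vector space structure restricted from R, so extension problems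
may be solved with K-linear retractions. -/
theorem injective_of_forall_extend {Q : Type u} [AddCommGroup Q] [Module R Q]
    (h : ∀ (X Y : Type u) [AddCommGroup X] [AddCommGroup Y] [Module R X] [Module R Y]
      [Module K X] [Module K Y] [IsScalarTower K R X] [IsScalarTower K R Y] (f : X →ₗ[R] Y),
      Function.Injective f → ∀ g : X →ₗ[R] Q, ∃ h : Y →ₗ[R] Q, ∀ x, h (f x) = g x) :
    Module.Injective R Q where
  out X Y _ _ _ _ f hf g := by
    let := scalarModule K R X
    let := scalarModule K R Y
    have := scalarModule_isScalarTower K R X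
    have := scalarModule_isScalarTower K R Y
    exact h X Y f hf g

/-- A fitting decomposition: some power of an endomorphism has a complemented image. -/
theorem exists_pow_range_retract {M : Type u} [AddCommGroup M] [Module R M] [IsArtinian R M]
    [IsNoetherian R M] (h : M →ₗ[R] M) :
    ∃ n, 1 ≤ n ∧ IsCompl (LinearMap.ker (h ^ n)) (LinearMap.range (h ^ n)) := by
  obtain ⟨n, hn⟩ := Filter.eventually_atTop.1 (LinearMap.eventually_isCompl_ker_pow_range_pow h)
  exact ⟨n + 1, by omega, hn _ (by omega)⟩

/-- An endomorphism of a submodule which is minimal with a property `P` is bijective, if the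
complemented images of its powers have the property `P`. -/
theorem bijective_of_minimal {M : Type u} [AddCommGroup M] [Module R M] [IsArtinian R M]
    [IsNoetherian R M] {P : Submodule R M → Prop} {N : Submodule R M}
    (hmin : ∀ N', P N' → ¬ N' < N) (h : N →ₗ[R] N)
    (hP : ∀ k, IsCompl (LinearMap.ker (h ^ k)) (LinearMap.range (h ^ k)) →
      P ((LinearMap.range (h ^ k)).map N.subtype)) : Function.Bijective h := by
  obtain ⟨k, hk, hc⟩ := exists_pow_range_retract h
  have heq : (LinearMap.range (h ^ k)).map N.subtype = N := by
    by_contra hne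
    exact hmin _ (hP k hc) (lt_of_le_of_ne (Submodule.map_subtype_le _ _) hne)
  have htop : LinearMap.range (h ^ k) = ⊤ := by
    refine eq_top_iff.2 fun x _ => ?_
    have : (x : M) ∈ (LinearMap.range (h ^ k)).map N.subtype := heq.symm ▸ x.2
    obtain ⟨y, hy, hyx⟩ := this
    exact (Subtype.ext hyx : y = x) ▸ hy
  rw [htop] at hc
  have hker : LinearMap.ker (h ^ k) = ⊥ := by simpa using hc.inf_eq_bot
  obtain ⟨l, rfl⟩ := Nat.exists_eq_add_of_le' hk
  constructor
  · refine LinearMap.ker_eq_bot.1 (eq_bot_iff.2 fun s hs => ?_)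
    rw [← hker, LinearMap.mem_ker, pow_succ, Module.End.mul_apply, LinearMap.mem_ker.1 hs, map_zero]
  · refine fun x => ?_
    obtain ⟨y, hy⟩ := LinearMap.range_eq_top.1 htop x
    exact ⟨(h ^ l) y, by rw [← hy, pow_succ', Module.End.mul_apply]⟩

theorem pow_apply_of_apply_eq {M T : Type*} [AddCommGroup M] [Module R M] [AddCommGroup T]
    [Module R T] {h : M →ₗ[R] M} {f : M →ₗ[R] T} (hf : f ∘ₗ h = f) (k : ℕ) :
    f ∘ₗ (h ^ k) = f := by
  induction k with
  | zero => rfl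
  | succ k ih => rw [pow_succ', Module.End.mul_eq_comp, ← LinearMap.comp_assoc, hf, ih]

theorem exists_retraction_of_isCompl {M : Type u} [AddCommGroup M] [Module R M]
    {p q : Submodule R M} (h : IsCompl p q) :
    ∃ r : M →ₗ[R] q, r ∘ₗ q.subtype = LinearMap.id :=
  ⟨q.projectionOnto p h.symm, by ext x; simp⟩

section Maps

variable (D : GendoCore K R) {E : Type u} [AddCommGroup E] [Module R E] (V : RegularDual K R E)
  {M : Type u} [AddCommGroup M] [Module R M] [Module K M] [IsScalarTower K R M]

namespace GendoCore

theorem mul_e (q : leftIdeal D.e) : (q : R) * D.e = q := (mem_leftIdeal_iff D.idem).1 q.2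

theorem leftIdeal_ext {q q' : leftIdeal D.e}
    (h : ∀ x, D.tr (D.e * x * q) = D.tr (D.e * x * q')) : q = q' := by
  refine Subtype.ext (sub_eq_zero.1 ?_)
  have := D.nondeg_right (q - q') fun x => by
    rw [mul_sub, sub_mul, mul_assoc, D.mul_e, mul_assoc _ (q' : R), D.mul_e, map_sub, h, sub_self]
  rwa [sub_mul, D.mul_e, D.mul_e] at this

theorem exists_formMap (μ : M →ₗ[K] K) (m : M) :
    ∃ q : leftIdeal D.e, ∀ x, D.tr (D.e * x * q) = μ ((D.e * x) • m) := by
  obtain ⟨y, hy⟩ := D.rep_right (μ ∘ₗ (LinearMap.toSpanSingleton R M m).restrictScalars K)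
  refine ⟨⟨y * D.e, ⟨y, rfl⟩⟩, fun x => ?_⟩
  rw [← mul_assoc]
  exact hy x

/-- The map `M → Re` attached to a linear form `μ` on `M`. -/
def formMap (μ : M →ₗ[K] K) : M →ₗ[R] leftIdeal D.e where
  toFun m := (D.exists_formMap μ m).choose
  map_add' m m' := D.leftIdeal_ext fun x => by
    rw [(D.exists_formMap μ (m + m')).choose_spec, Submodule.coe_add, mul_add, map_add,
      (D.exists_formMap μ m).choose_spec, (D.exists_formMap μ m').choose_spec, smul_add, map_add]
  map_smul' r m := D.leftIdeal_ext fun x => by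
    rw [(D.exists_formMap μ (r • m)).choose_spec, RingHom.id_apply, Submodule.coe_smul, smul_eq_mul,
      ← mul_assoc, mul_assoc D.e x r, (D.exists_formMap μ m).choose_spec, ← mul_assoc,
      mul_smul (D.e * x)]

theorem tr_formMap (μ : M →ₗ[K] K) (m : M) (x : R) :
    D.tr (D.e * x * D.formMap μ m) = μ ((D.e * x) • m) :=
  (D.exists_formMap μ m).choose_spec x

/-- The perfect pairing makes Re the dual of eR: a map into Re is recovered from its composite with
the trace, and linear forms extend along injections of vector spaces. -/
theorem leftIdeal_injective : Module.Injective R (leftIdeal D.e) :=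
  injective_of_forall_extend (K := K) fun X Y _ _ _ _ _ _ _ _ f hf g => by
    obtain ⟨l, hl⟩ := LinearMap.exists_leftInverse_of_injective (f.restrictScalars K)
      (LinearMap.ker_eq_bot.2 hf)
    have hl' : ∀ x, l (f x) = x := LinearMap.congr_fun hl
    let μ : X →ₗ[K] K := D.tr ∘ₗ ((leftIdeal D.e).subtype ∘ₗ g).restrictScalars K
    refine ⟨D.formMap (μ ∘ₗ l), fun x => D.leftIdeal_ext fun y => ?_⟩
    rw [tr_formMap, ← map_smul, LinearMap.comp_apply, hl']
    simp [μ]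

instance leftIdeal_projective : Module.Projective R (leftIdeal D.e) :=
  Module.Projective.of_split (leftIdeal D.e).subtype
    (LinearMap.codRestrict (leftIdeal D.e) (LinearMap.toSpanSingleton R R D.e)
      fun x => ⟨x, rfl⟩) (by
        ext x
        exact D.mul_e x)

instance leftIdeal_finite : Module.Finite R (leftIdeal D.e) :=
  Module.Finite.of_surjective
    (LinearMap.codRestrict (leftIdeal D.e) (LinearMap.toSpanSingleton R R D.e)
      fun x => ⟨x, rfl⟩) fun x => ⟨x, Subtype.ext (D.mul_e x)⟩

end GendoCore

namespace RegularDual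

/-- The map `M → E` attached to a linear form `μ` on `M`. -/
def formMap (μ : M →ₗ[K] K) : M →ₗ[R] E where
  toFun m := V.ev.symm (μ ∘ₗ (LinearMap.toSpanSingleton R M m).restrictScalars K)
  map_add' m m' := V.ev.injective (by ext x; simp)
  map_smul' r m := V.ev.injective (by ext x; simp [V.ev_smul, mul_smul])

theorem ev_formMap (μ : M →ₗ[K] K) (m : M) (x : R) : V.ev (V.formMap μ m) x = μ (x • m) := by
  simp [formMap]

include V in
theorem injective : Module.Injective R E :=
  injective_of_forall_extend (K := K) fun X Y _ _ _ _ _ _ _ _ f hf g => by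
    obtain ⟨l, hl⟩ := LinearMap.exists_leftInverse_of_injective (f.restrictScalars K)
      (LinearMap.ker_eq_bot.2 hf)
    have hl' : ∀ x, l (f x) = x := LinearMap.congr_fun hl
    let μ : X →ₗ[K] K :=
      { toFun := fun x => V.ev (g x) 1
        map_add' := fun x y => by rw [map_add, map_add]; rfl
        map_smul' := fun c x => by
          rw [← algebraMap_smul R c x, map_smul, V.ev_smul, one_mul, ← mul_one (algebraMap K R c),
            ← Algebra.smul_def, map_smul]; rfl }
    refine ⟨V.formMap (μ ∘ₗ l), fun x => V.ev.injective (LinearMap.ext fun y => ?_)⟩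
    rw [ev_formMap, ← map_smul, LinearMap.comp_apply, hl']
    change V.ev (g (y • x)) 1 = _
    rw [map_smul, V.ev_smul, one_mul]

include V in
theorem finite [FiniteDimensional K R] : Module.Finite R E := by
  let := scalarModule K R E
  have := scalarModule_isScalarTower K R E
  let L : E →ₗ[K] (R →ₗ[K] K) :=
    { toFun := V.ev
      map_add' := V.ev.map_add
      map_smul' := fun c f => by
        ext x
        change V.ev (algebraMap K R c • f) x = c • V.ev f x
        rw [V.ev_smul, ← Algebra.commutes, ← Algebra.smul_def, map_smul] }
  have : Module.Finite K E := Module.Finite.of_injective L V.ev.injective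
  exact Module.Finite.of_restrictScalars_finite K R E

end RegularDual

section Envelope

namespace GendoCore

-- The coordinate forms of a K-basis give maps M → Re, and their common kernel is the set of m with
-- eR · m = 0.
variable (M) in
theorem exists_embedding_aux [FiniteDimensional K M]
    (hM : ∀ m : M, (∀ x, (D.e * x) • m = 0) → m = 0) :
    ∃ (n : ℕ) (j : M →ₗ[R] (Fin n → leftIdeal D.e)), Function.Injective j := by
  let b := Module.finBasis K M
  refine ⟨_, LinearMap.pi fun i => D.formMap (b.coord i), ?_⟩
  refine (injective_iff_map_eq_zero _).2 fun m hm => hM m fun x => ?_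
  refine b.ext_elem fun i => ?_
  have h1 : D.formMap (b.coord i) m = 0 := congrFun hm i
  have := D.tr_formMap (b.coord i) m x
  rw [h1] at this
  simpa using this.symm

end GendoCore

variable [FiniteDimensional K R]

omit [Module K M] [IsScalarTower K R M] in
include V in
theorem RegularDual.exists_injective [Module.Finite R M] :
    ∃ (n : ℕ) (j : M →ₗ[R] (Fin n → E)), Function.Injective j := by
  let := scalarModule K R M
  have := scalarModule_isScalarTower K R M
  have : Module.Finite K M := Module.Finite.trans R M
  let b := Module.finBasis K M
  refine ⟨_, LinearMap.pi fun i => V.formMap (b.coord i), ?_⟩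
  refine (injective_iff_map_eq_zero _).2 fun m hm => b.ext_elem fun i => ?_
  have h1 : V.formMap (b.coord i) m = 0 := congrFun hm i
  have := V.ev_formMap (b.coord i) m 1
  rw [h1] at this
  simpa using this.symm

-- The envelope is a minimal injective submodule of Eⁿ containing the image of M; the descending
-- chain condition supplies it.
omit [Module K M] [IsScalarTower K R M] in
variable (M) in
include V in
theorem exists_injectiveEnvelope [Module.Finite R M] :
    ∃ (I : ModuleCat.{u} R) (ι : M →ₗ[R] I), Module.Finite R I ∧ Module.Injective R I ∧
      Function.Injective ι ∧ IsEssential (LinearMap.range ι) := by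
  have := isArtinianRing_of_finiteDimensional K R
  have := isNoetherianRing_of_finiteDimensional K R
  obtain ⟨n, j, hj⟩ := V.exists_injective (M := M)
  have := V.injective
  have := V.finite
  let 𝒮 : Set (Submodule R (Fin n → E)) := {N | LinearMap.range j ≤ N ∧ Module.Injective R N}
  have hne : 𝒮.Nonempty := ⟨⊤, le_top, injective_of_linearEquiv Submodule.topEquiv⟩
  obtain ⟨N, ⟨hjN, hN⟩, hmin⟩ := IsArtinian.set_has_minimal 𝒮 hne
  let ι : M →ₗ[R] N := j.codRestrict N fun m => hjN ⟨m, rfl⟩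
  have hι : Function.Injective ι := fun a b h => hj (congrArg Subtype.val h)
  refine ⟨ModuleCat.of R N, ι, inferInstanceAs (Module.Finite R N), hN, hι, fun S hS => ?_⟩
  change Submodule R N at S
  have hdisj : Function.Injective (LinearMap.coprod ι S.subtype) := by
    refine (injective_iff_map_eq_zero _).2 ?_
    rintro ⟨m, s⟩ hms
    have h1 : ι m + (s : N) = 0 := hms
    have h2 : (s : N) ∈ S ⊓ LinearMap.range ι :=
      ⟨s.2, ⟨-m, by rw [map_neg]; exact (eq_neg_of_add_eq_zero_right h1).symm⟩⟩
    rw [hS, Submodule.mem_bot] at h2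
    rw [h2, add_zero] at h1
    exact Prod.ext (hι (h1.trans (map_zero ι).symm)) (Subtype.ext h2)
  -- Extend to N the map that is the identity on M and zero on S. By minimality this endomorphism is
  -- bijective, which forces S = 0.
  obtain ⟨h, hh⟩ := Module.Injective.out (X := M × S) (Y := N) (LinearMap.coprod ι S.subtype)
    hdisj (ι ∘ₗ LinearMap.fst R M S)
  have hM : ∀ m, h (ι m) = ι m := fun m => by simpa using hh (m, 0)
  have hS0 : ∀ s ∈ S, h s = 0 := fun s hs => by simpa using hh (0, ⟨s, hs⟩)
  have hbij : Function.Bijective h := bijective_of_minimal (P := fun N' => N' ∈ 𝒮) hmin h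
    fun k hc => by
      obtain ⟨r, hr⟩ := exists_retraction_of_isCompl hc
      have hinj : Module.Injective R (LinearMap.range (h ^ k)) := injective_of_retract _ r hr
      constructor
      · rintro _ ⟨m, rfl⟩
        refine ⟨ι m, ⟨ι m, ?_⟩, rfl⟩
        clear hc r hr hinj
        induction k with
        | zero => rfl
        | succ k ih => rw [pow_succ, Module.End.mul_apply, hM, ih]
      · exact injective_of_linearEquiv (N := LinearMap.range (h ^ k))
          (Submodule.equivMapOfInjective N.subtype Subtype.val_injective _).symm
  exact eq_bot_iff.2 fun s hs => hbij.1 ((hS0 s hs).trans (map_zero h).symm)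

end Envelope

end Maps

end GendoSymm

end

/-! ### Dominant dimension in terms of η and Ext -/

noncomputable section

namespace GendoSymm

variable {K : Type u} [Field K] {R : Type u} [Ring R] [Algebra K R]

/-- The resolution of the image of the first differential. -/
def MinimalInjectiveResolution.shift {M : Type u} [AddCommGroup M] [Module R M]
    (J : MinimalInjectiveResolution R M) :
    MinimalInjectiveResolution R (LinearMap.range (J.d 0)) where
  I n := J.I (n + 1)
  finite n := J.finite (n + 1)
  injective n := J.injective (n + 1)
  ι := (LinearMap.range (J.d 0)).subtype
  d n := J.d (n + 1)
  ι_injective := Subtype.val_injective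
  exact_zero x := by
    rw [J.exact_succ 0 x]
    simp
  exact_succ n := J.exact_succ (n + 1)
  ι_essential := by rw [Submodule.range_subtype]; exact J.d_essential 0
  d_essential n := J.d_essential (n + 1)

theorem MinimalInjectiveResolution.isShortExact {M : Type u} [AddCommGroup M] [Module R M]
    (J : MinimalInjectiveResolution R M) : IsShortExact J.ι (J.d 0).rangeRestrict where
  inj := J.ι_injective
  exact x := by
    rw [← J.exact_zero x, ← Subtype.coe_inj]
    rfl
  surj := LinearMap.surjective_rangeRestrict _

instance projective_pi (n : ℕ) (P : Type u) [AddCommGroup P] [Module R P] [Module.Projective R P] :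
    Module.Projective R (Fin n → P) :=
  Module.Projective.of_equiv (DFinsupp.linearEquivFunOnFintype (R := R) (M := fun _ : Fin n => P))

section DomDim

variable {D : GendoCore K R} {E : Type u} [AddCommGroup E] [Module R E] {V : RegularDual K R E}

namespace GendoCore

/-- Symmetry of the trace computes θ on the forms a ↦ tr(x a y): its values there lie in ReR. -/
theorem theta_form (x y : R) {f : E} (hf : ∀ a, V.ev f a = D.tr (D.e * x * a * y * D.e)) :
    D.theta V f = y * D.e * x :=
  D.eq_of_tr fun x' y' => by
    have := D.tr_comm (x * y') (x' * y)
    rw [tr_theta, hf]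
    simp only [mul_assoc] at this ⊢
    exact this

variable [FiniteDimensional K R]

/-- The image of θ lies in the ideal ReR, because forms of the type a ↦ tr(x a y) span the dual of
R. Hence eR · m = 0 implies that η(m) = 0. -/
theorem EtaInj.eq_zero {M : Type u} [AddCommGroup M] [Module R M] (h : D.EtaInj V M) {m : M}
    (hm : ∀ x, (D.e * x) • m = 0) : m = 0 := by
  refine h ?_
  rw [map_zero]
  ext f
  let form : R → R → (R →ₗ[K] K) := fun x y =>
    D.tr ∘ₗ LinearMap.mulRight K D.e ∘ₗ LinearMap.mulRight K y ∘ₗ LinearMap.mulLeft K (D.e * x)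
  let W : Subspace K (Module.Dual K R) := Submodule.span K {μ | ∃ x y, μ = form x y}
  -- Faithfulness of the trace form says that the common kernel of these forms is zero; in finite
  -- dimension they therefore span the dual.
  have hW : W = ⊤ := by
    have h0 : W.dualCoannihilator = ⊥ := by
      refine eq_bot_iff.2 fun r hr => D.faithful r fun x y => ?_
      rw [Submodule.mem_dualCoannihilator] at hr
      exact hr (form x y) (Submodule.subset_span ⟨x, y, rfl⟩)
    rw [← Subspace.dualCoannihilator_dualAnnihilator_eq (W := W), h0,
      Submodule.dualAnnihilator_bot]
  have key : ∀ μ ∈ W, D.theta V (V.ev.symm μ) • m = 0 := by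
    intro μ hμ
    induction hμ using Submodule.span_induction with
    | mem μ hμ =>
      obtain ⟨x, y, rfl⟩ := hμ
      rw [theta_form x y fun a => by rw [V.ev.apply_symm_apply]; rfl, mul_assoc, mul_smul, hm,
        smul_zero]
    | zero => rw [map_zero, map_zero, zero_smul]
    | add μ μ' _ _ h h' => rw [map_add, map_add, add_smul, h, h', add_zero]
    | smul c μ _ h =>
      rw [V.ev_symm_smul, map_smul, smul_eq_mul, mul_smul, h, smul_zero]
  have := key (V.ev f) (hW ▸ Submodule.mem_top)
  rw [V.ev.symm_apply_apply] at this
  exact this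

theorem EtaInj.exists_embedding {M : Type u} [AddCommGroup M] [Module R M] [Module.Finite R M]
    (h : D.EtaInj V M) :
    ∃ (n : ℕ) (j : M →ₗ[R] (Fin n → leftIdeal D.e)), Function.Injective j := by
  let := scalarModule K R M
  have := scalarModule_isScalarTower K R M
  have : Module.Finite K M := Module.Finite.trans R M
  exact D.exists_embedding_aux M fun m hm => h.eq_zero hm

/-- An embedding of M in (Re)ⁿ extends to I. It stays injective because M is essential in I, and
then splits because I is injective. -/
theorem EtaInj.projective_of_essential {M : Type u} [AddCommGroup M] [Module R M]
    [Module.Finite R M] (h : D.EtaInj V M) {I : Type u} [AddCommGroup I] [Module R I]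
    [Module.Injective R I] (ι : M →ₗ[R] I) (hι : Function.Injective ι)
    (hess : IsEssential (LinearMap.range ι)) : Module.Projective R I := by
  obtain ⟨n, j, hj⟩ := h.exists_embedding
  have := D.leftIdeal_injective
  obtain ⟨k, hk⟩ := Module.Injective.out ι hι j
  have hkinj : Function.Injective k := by
    refine LinearMap.ker_eq_bot.1 (hess _ (eq_bot_iff.2 ?_))
    rintro _ ⟨hx, ⟨m, rfl⟩⟩
    rw [SetLike.mem_coe, LinearMap.mem_ker, hk] at hx
    rw [(injective_iff_map_eq_zero j).1 hj m hx, map_zero]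
    exact zero_mem _
  obtain ⟨r, hr⟩ := Module.Injective.out k hkinj LinearMap.id
  exact Module.Projective.of_split k r (LinearMap.ext hr)

/-- The first two projective terms make η bijective; each further projective term yields the
vanishing of one more Ext, by dimension shifting along the cosyzygy. -/
theorem etaBij_and_extZero_of_resolution (n : ℕ) : ∀ {M : Type u} [AddCommGroup M] [Module R M]
    (J : MinimalInjectiveResolution R M), (∀ i < n + 2, Module.Projective R (J.I i)) →
      D.EtaBij V M ∧ ∀ i, 1 ≤ i → i ≤ n → ExtZero R E M i := by
  induction n with
  | zero =>
    intro M _ _ J hJ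
    have := J.finite
    have := hJ 0 (by omega)
    have := hJ 1 (by omega)
    exact ⟨EtaBij.of_exact J.ι_injective J.exact_zero (D.etaBij_of_projective V)
      (D.etaBij_of_projective V (P := J.I 1)).etaInj, fun i hi hi' => by omega⟩
  | succ n ih =>
    intro M _ _ J hJ
    have := J.finite
    have := J.injective
    have := hJ 0 (by omega)
    have := hJ 1 (by omega)
    refine ⟨EtaBij.of_exact J.ι_injective J.exact_zero (D.etaBij_of_projective V)
      (D.etaBij_of_projective V (P := J.I 1)).etaInj, fun i hi hi' => ?_⟩
    obtain ⟨h1, h2⟩ := ih J.shift fun i hi => hJ (i + 1) (by omega)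
    obtain rfl | hi1 := hi.eq_or_lt
    -- For Ext¹, a map from E to the cosyzygy is a value η(w). Lifting the element w to I₀ lifts the
    -- map.
    · refine J.isShortExact.extZero_one_of_lift (extZero_of_injective le_rfl) fun k => ?_
      obtain ⟨w, rfl⟩ := h1.2 k
      obtain ⟨y, rfl⟩ := J.isShortExact.surj w
      exact ⟨D.eta V y, (eta_map D V _ y).symm⟩
    · obtain ⟨i, rfl⟩ := Nat.exists_eq_add_of_le' hi
      exact J.isShortExact.extZero_succ_left' (h2 i (by omega) (by omega))
        (extZero_of_injective (by omega))

theorem etaBij_and_extZero_of_le_domDim {n : ℕ} {M : Type u} [AddCommGroup M] [Module R M]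
    (h : ((n + 2 : ℕ) : ℕ∞) ≤ domDim R M) :
    D.EtaBij V M ∧ ∀ i, 1 ≤ i → i ≤ n → ExtZero R E M i := by
  obtain ⟨J, hJ⟩ := exists_resolution_of_le_domDim (n := n + 1) h
  exact etaBij_and_extZero_of_resolution n J hJ

end GendoCore

section Construction

variable [FiniteDimensional K R] (V) (M : Type u) [AddCommGroup M] [Module R M] [Module.Finite R M]

/-- A chosen injective envelope. -/
def envelope : ModuleCat.{u} R := (exists_injectiveEnvelope V M).choose

/-- The embedding of a module in its chosen injective envelope. -/
def toEnvelope : M →ₗ[R] envelope V M := (exists_injectiveEnvelope V M).choose_spec.choose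

theorem toEnvelope_spec :
    Module.Finite R (envelope V M) ∧ Module.Injective R (envelope V M) ∧
      Function.Injective (toEnvelope V M) ∧ IsEssential (LinearMap.range (toEnvelope V M)) :=
  (exists_injectiveEnvelope V M).choose_spec.choose_spec

instance : Module.Finite R (envelope V M) := (toEnvelope_spec V M).1

instance : Module.Injective R (envelope V M) := (toEnvelope_spec V M).2.1

/-- The cokernel of the injective envelope. -/
abbrev Cosyzygy : Type u := envelope V M ⧸ LinearMap.range (toEnvelope V M)

/-- The iterated cosyzygies. -/
def cosyzygy (M : ModuleCat.{u} R) [Module.Finite R M] :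
    ℕ → {N : ModuleCat.{u} R // Module.Finite R N}
  | 0 => ⟨M, inferInstance⟩
  | n + 1 =>
    have := (cosyzygy M n).2
    ⟨ModuleCat.of R (Cosyzygy V (cosyzygy M n).1), inferInstanceAs (Module.Finite R (_ ⧸ _))⟩

instance (M : ModuleCat.{u} R) [Module.Finite R M] (n : ℕ) :
    Module.Finite R (cosyzygy V M n).1 := (cosyzygy V M n).2

/-- The projection onto the next cosyzygy. -/
def toCosyzygy (M : ModuleCat.{u} R) [Module.Finite R M] (n : ℕ) :
    envelope V (cosyzygy V M n).1 →ₗ[R] (cosyzygy V M (n + 1)).1 :=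
  (LinearMap.range (toEnvelope V (cosyzygy V M n).1)).mkQ

theorem isShortExact_toCosyzygy (M : ModuleCat.{u} R) [Module.Finite R M] (n : ℕ) :
    IsShortExact (toEnvelope V (cosyzygy V M n).1) (toCosyzygy V M n) :=
  IsShortExact.coker _ (toEnvelope_spec V _).2.2.1

/-- The minimal injective resolution built from injective envelopes. -/
def minimalResolution (M : ModuleCat.{u} R) [Module.Finite R M] :
    MinimalInjectiveResolution R M where
  I n := envelope V (cosyzygy V M n).1
  finite n := inferInstance
  injective n := inferInstance
  ι := toEnvelope V M
  d n := toEnvelope V (cosyzygy V M (n + 1)).1 ∘ₗ toCosyzygy V M n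
  ι_injective := (toEnvelope_spec V M).2.2.1
  exact_zero x := by
    refine Iff.trans ?_ ((isShortExact_toCosyzygy V M 0).exact x)
    exact map_eq_zero_iff _ (toEnvelope_spec V (cosyzygy V M 1).1).2.2.1
  exact_succ n x := by
    refine Iff.trans (Iff.trans ?_ ((isShortExact_toCosyzygy V M (n + 1)).exact x)) ?_
    · exact map_eq_zero_iff _ (toEnvelope_spec V (cosyzygy V M (n + 2)).1).2.2.1
    · constructor
      · rintro ⟨y, rfl⟩
        obtain ⟨z, rfl⟩ := (isShortExact_toCosyzygy V M n).surj y
        exact ⟨z, rfl⟩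
      · rintro ⟨z, rfl⟩
        exact ⟨_, rfl⟩
  ι_essential := (toEnvelope_spec V M).2.2.2
  d_essential n := by
    rw [LinearMap.range_comp_of_range_eq_top _
      (LinearMap.range_eq_top.2 (isShortExact_toCosyzygy V M n).surj)]
    exact (toEnvelope_spec V (cosyzygy V M (n + 1)).1).2.2.2

end Construction

namespace GendoCore

variable [FiniteDimensional K R]

/-- Both conditions pass from a module to its cosyzygy, and injectivity of η makes each injective
envelope in the resolution projective. -/
theorem domDim_eq_top (M : Type u) [AddCommGroup M] [Module R M] [Module.Finite R M]
    (h : D.EtaBij V M) (hE : ExtVanishes R E M) : domDim R M = ⊤ := by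
  have key : ∀ n, D.EtaBij V (cosyzygy V (ModuleCat.of R M) n).1 ∧
      ExtVanishes R E (cosyzygy V (ModuleCat.of R M) n).1 ∧
      Module.Projective R (envelope V (cosyzygy V (ModuleCat.of R M) n).1) := by
    intro n
    have hproj : ∀ (N : Type u) [AddCommGroup N] [Module R N] [Module.Finite R N],
        D.EtaBij V N → Module.Projective R (envelope V N) := fun N _ _ _ hN =>
      hN.etaInj.projective_of_essential _ (toEnvelope_spec V N).2.2.1 (toEnvelope_spec V N).2.2.2
    induction n with
    | zero => exact ⟨h, hE, hproj _ h⟩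
    | succ n ih =>
      obtain ⟨h1, h2, h3⟩ := ih
      have hses := isShortExact_toCosyzygy V (ModuleCat.of R M) n
      have h4 : D.EtaBij V (cosyzygy V (ModuleCat.of R M) (n + 1)).1 :=
        EtaBij.coker hses h1 (D.etaBij_of_projective V) (h2 1 le_rfl)
      exact ⟨h4, fun i hi => hses.extZero_right' (extZero_of_injective hi) (h2 (i + 1) (by omega)),
        hproj _ h4⟩
  refine ENat.eq_top_iff_forall_ge.2 fun n => ?_
  exact le_domDim (minimalResolution V (ModuleCat.of R M)) fun i _ => (key i).2.2

theorem domDim_eq_top_iff (M : Type u) [AddCommGroup M] [Module R M] [Module.Finite R M] :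
    domDim R M = ⊤ ↔ D.EtaBij V M ∧ ExtVanishes R E M := by
  refine ⟨fun h => ⟨?_, fun i hi => ?_⟩, fun h => domDim_eq_top M h.1 h.2⟩
  · exact (etaBij_and_extZero_of_le_domDim (n := 0) (by rw [h]; exact le_top)).1
  · exact (etaBij_and_extZero_of_le_domDim (D := D) (V := V) (n := i) (by rw [h]; exact le_top)).2 i hi le_rfl

end GendoCore

end DomDim

end GendoSymm

end

/-! ### Vector space duality, adjoint maps and duality for Ext -/

noncomputable section

namespace GendoSymm

set_option linter.unusedSectionVars false

variable {K : Type u} [Field K] {A : Type u} [Ring A] [Algebra K A]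

instance KDual.instModuleScalar {M : Type u} [AddCommGroup M] [Module K M] :
    Module K (KDual K M) := inferInstanceAs (Module K (M →ₗ[K] K))

instance KDual.instFiniteDimensional {M : Type u} [AddCommGroup M] [Module K M]
    [FiniteDimensional K M] : FiniteDimensional K (KDual K M) :=
  inferInstanceAs (FiniteDimensional K (M →ₗ[K] K))

instance KDual.instIsScalarTowerLeft {M : Type u} [AddCommGroup M] [Module K M] [Module Aᵐᵒᵖ M]
    [IsScalarTower K Aᵐᵒᵖ M] : IsScalarTower K A (KDual K M) :=
  ⟨fun c a f => LinearMap.ext fun m => by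
    change f.toForm (MulOpposite.op (c • a) • m) = c • f.toForm (MulOpposite.op a • m)
    rw [MulOpposite.op_smul, smul_assoc, map_smul]⟩

instance KDual.instIsScalarTowerRight {M : Type u} [AddCommGroup M] [Module K M] [Module A M]
    [IsScalarTower K A M] : IsScalarTower K Aᵐᵒᵖ (KDual K M) :=
  ⟨fun c a f => LinearMap.ext fun m => by
    change f.toForm ((c • a).unop • m) = c • f.toForm (a.unop • m)
    rw [MulOpposite.unop_smul, smul_assoc, map_smul]⟩

theorem finiteDimensional_submodule {R : Type u} [Ring R] [Algebra K R] {M : Type u}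
    [AddCommGroup M] [Module K M] [Module R M] [IsScalarTower K R M] [FiniteDimensional K M]
    (S : Submodule R M) : FiniteDimensional K S :=
  FiniteDimensional.of_injective (S.subtype.restrictScalars K) Subtype.val_injective

/-- A perfect balanced pairing of a right module `X` with a left module `X'`. -/
structure DualPairing (K A : Type u) [Field K] [Ring A] [Algebra K A]
    (X X' : Type u) [AddCommGroup X] [Module K X] [Module Aᵐᵒᵖ X] [AddCommGroup X'] [Module K X']
    [Module A X'] where
  p : X →ₗ[K] X' →ₗ[K] K
  perf : p.IsPerfPair
  bal : ∀ (a : A) (x : X) (x' : X'), p (MulOpposite.op a • x) x' = p x (a • x')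

namespace DualPairing

section

variable (A)

/-- The pairing of a right module with its dual. -/
def self (X : Type u) [AddCommGroup X] [Module K X] [Module Aᵐᵒᵖ X] [IsScalarTower K Aᵐᵒᵖ X]
    [FiniteDimensional K X] : DualPairing K A X (KDual K X) where
  p := Module.Dual.eval K X
  perf := inferInstanceAs (Module.Dual.eval K X).IsPerfPair
  bal _ _ _ := rfl

/-- The pairing of the dual of a left module with this module. -/
def ofLeft (X : Type u) [AddCommGroup X] [Module K X] [Module A X] [IsScalarTower K A X]
    [FiniteDimensional K X] : DualPairing K A (KDual K X) X where
  p := (LinearMap.id : Module.Dual K X →ₗ[K] Module.Dual K X)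
  perf := inferInstanceAs (LinearMap.id : Module.Dual K X →ₗ[K] Module.Dual K X).IsPerfPair
  bal _ _ _ := rfl

end

variable {X X' Y Y' Z Z' : Type u}
  [AddCommGroup X] [Module K X] [Module Aᵐᵒᵖ X] [AddCommGroup X'] [Module K X'] [Module A X']
  [AddCommGroup Y] [Module K Y] [Module Aᵐᵒᵖ Y] [AddCommGroup Y'] [Module K Y'] [Module A Y']
  [AddCommGroup Z] [Module K Z] [Module Aᵐᵒᵖ Z] [AddCommGroup Z'] [Module K Z'] [Module A Z']
  (pX : DualPairing K A X X') (pY : DualPairing K A Y Y') (pZ : DualPairing K A Z Z')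

theorem ext_left {x y : X} (h : ∀ x', pX.p x x' = pX.p y x') : x = y :=
  pX.perf.bijective_left.1 (LinearMap.ext h)

theorem ext_right {x y : X'} (h : ∀ z, pX.p z x = pX.p z y) : x = y :=
  pX.perf.bijective_right.1 (LinearMap.ext h)

theorem exists_left (μ : X' →ₗ[K] K) : ∃ x, ∀ x', pX.p x x' = μ x' := by
  obtain ⟨x, hx⟩ := pX.perf.bijective_left.2 μ
  exact ⟨x, LinearMap.congr_fun hx⟩

theorem exists_right (μ : X →ₗ[K] K) : ∃ x', ∀ x, pX.p x x' = μ x := by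
  obtain ⟨x, hx⟩ := pX.perf.bijective_right.2 μ
  exact ⟨x, LinearMap.congr_fun hx⟩

/-- Two maps are adjoint with respect to the pairings. -/
def IsAdj (k : X →ₗ[Aᵐᵒᵖ] Y) (k' : Y' →ₗ[A] X') : Prop :=
  ∀ x y', pX.p x (k' y') = pY.p (k x) y'

variable [IsScalarTower K Aᵐᵒᵖ X] [IsScalarTower K Aᵐᵒᵖ Y] [IsScalarTower K A X']
  [IsScalarTower K A Y']

theorem exists_adj (k : X →ₗ[Aᵐᵒᵖ] Y) : ∃ k' : Y' →ₗ[A] X', IsAdj pX pY k k' := by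
  choose k' hk' using fun y' : Y' =>
    pX.exists_right ((pY.p.flip y') ∘ₗ k.restrictScalars K)
  refine ⟨⟨⟨k', fun a b => pX.ext_right fun x => ?_⟩, fun a y' => pX.ext_right fun x => ?_⟩,
    fun x y' => hk' y' x⟩
  · rw [hk', map_add, map_add, hk', hk']; rfl
  · change pX.p x (k' (a • y')) = pX.p x (a • k' y')
    rw [← pX.bal, hk', hk']
    simp [pY.bal]

theorem exists_adj' (k' : Y' →ₗ[A] X') : ∃ k : X →ₗ[Aᵐᵒᵖ] Y, IsAdj pX pY k k' := by
  choose k hk using fun x : X => pY.exists_left (pX.p x ∘ₗ k'.restrictScalars K)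
  refine ⟨⟨⟨k, fun a b => pY.ext_left fun y' => ?_⟩, fun a x => pY.ext_left fun y' => ?_⟩,
    fun x y' => (hk x y').symm⟩
  · rw [hk, map_add, map_add, LinearMap.add_apply, hk, hk]; rfl
  · change pY.p (k (a • x)) y' = pY.p (a • k x) y'
    conv_rhs => rw [← MulOpposite.op_unop a, pY.bal, hk]
    rw [hk]
    have := pX.bal a.unop x (k' y')
    rw [MulOpposite.op_unop] at this
    simpa using this

variable {pX pY pZ} [IsScalarTower K Aᵐᵒᵖ Z] [IsScalarTower K A Z']

theorem IsAdj.comp {k : X →ₗ[Aᵐᵒᵖ] Y} {k' : Y' →ₗ[A] X'} {l : Y →ₗ[Aᵐᵒᵖ] Z} {l' : Z' →ₗ[A] Y'}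
    (hk : IsAdj pX pY k k') (hl : IsAdj pY pZ l l') : IsAdj pX pZ (l ∘ₗ k) (k' ∘ₗ l') :=
  fun x z' => (hk x (l' z')).trans (hl (k x) z')

theorem IsAdj.eq_left {k l : X →ₗ[Aᵐᵒᵖ] Y} {k' : Y' →ₗ[A] X'} (hk : IsAdj pX pY k k')
    (hl : IsAdj pX pY l k') : k = l :=
  LinearMap.ext fun x => pY.ext_left fun y' => by rw [← hk, hl]

theorem IsAdj.eq_right {k : X →ₗ[Aᵐᵒᵖ] Y} {k' l' : Y' →ₗ[A] X'} (hk : IsAdj pX pY k k')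
    (hl : IsAdj pX pY k l') : k' = l' :=
  LinearMap.ext fun y' => pX.ext_right fun x => by rw [hk, hl]

theorem IsAdj.surjective {k : X →ₗ[Aᵐᵒᵖ] Y} {k' : Y' →ₗ[A] X'} (hk : IsAdj pX pY k k')
    (h : Function.Injective k') : Function.Surjective k := by
  intro y
  obtain ⟨l, hl⟩ := LinearMap.exists_leftInverse_of_injective (k'.restrictScalars K)
    (LinearMap.ker_eq_bot.2 h)
  have hl' : ∀ y', l (k' y') = y' := LinearMap.congr_fun hl
  obtain ⟨x, hx⟩ := pX.exists_left (pY.p y ∘ₗ l)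
  exact ⟨x, pY.ext_left fun y' => by rw [← hk, hx, LinearMap.comp_apply, hl']⟩

theorem isShortExact_of_isAdj {f : X →ₗ[Aᵐᵒᵖ] Y} {g : Y →ₗ[Aᵐᵒᵖ] Z} {f' : Y' →ₗ[A] X'}
    {g' : Z' →ₗ[A] Y'} (hf : IsAdj pX pY f f') (hg : IsAdj pY pZ g g') (h : IsShortExact f g) :
    IsShortExact g' f' where
  inj := by
    refine (injective_iff_map_eq_zero _).2 fun z' hz' => pZ.ext_right fun z => ?_
    obtain ⟨y, rfl⟩ := h.surj z
    rw [← hg, hz', map_zero, map_zero]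
  surj := by
    intro x'
    obtain ⟨l, hl⟩ := LinearMap.exists_leftInverse_of_injective (f.restrictScalars K)
      (LinearMap.ker_eq_bot.2 h.inj)
    have hl' : ∀ x, l (f x) = x := LinearMap.congr_fun hl
    obtain ⟨y', hy'⟩ := pY.exists_right (pX.p.flip x' ∘ₗ l)
    exact ⟨y', pX.ext_right fun x => by
      rw [hf, hy', LinearMap.comp_apply, hl', LinearMap.flip_apply]⟩
  exact y' := by
    constructor
    · intro hy'
      obtain ⟨s, hs⟩ := LinearMap.exists_rightInverse_of_surjective (g.restrictScalars K)
        (LinearMap.range_eq_top.2 h.surj)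
      have hs' : ∀ z, g (s z) = z := LinearMap.congr_fun hs
      obtain ⟨z', hz'⟩ := pZ.exists_right (pY.p.flip y' ∘ₗ s)
      refine ⟨z', pY.ext_right fun y => ?_⟩
      rw [hg, hz', LinearMap.comp_apply, LinearMap.flip_apply]
      obtain ⟨x, hx⟩ := (h.exact (s (g y) - y)).1 (by rw [map_sub, hs', sub_self])
      rw [← sub_eq_zero, ← LinearMap.sub_apply, ← map_sub, ← hx, ← hf, hy', map_zero]
    · rintro ⟨z', rfl⟩
      exact pX.ext_right fun x => by
        rw [hf, hg, h.exact.apply_apply_eq_zero, map_zero, map_zero, LinearMap.zero_apply]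

end DualPairing

/-- The dual of a projective right module is an injective left module. -/
theorem KDual.injective_of_projective (P : Type u) [AddCommGroup P] [Module K P] [Module Aᵐᵒᵖ P]
    [IsScalarTower K Aᵐᵒᵖ P] [Module.Projective Aᵐᵒᵖ P] : Module.Injective A (KDual K P) :=
  injective_of_forall_extend (K := K) fun X Y _ _ _ _ _ _ _ _ f hf g => by
    let res : KDual K Y →ₗ[Aᵐᵒᵖ] KDual K X :=
      { toFun := fun μ => μ.toForm ∘ₗ f.restrictScalars K
        map_add' := fun _ _ => rfl
        map_smul' := fun a μ => LinearMap.ext fun x => by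
          change μ.toForm (a.unop • f x) = μ.toForm (f (a.unop • x))
          rw [map_smul f] }
    have hres : Function.Surjective res := fun μ => by
      obtain ⟨l, hl⟩ := LinearMap.exists_leftInverse_of_injective (f.restrictScalars K)
        (LinearMap.ker_eq_bot.2 hf)
      exact ⟨μ.toForm ∘ₗ l, LinearMap.ext fun x =>
        congrArg μ.toForm (LinearMap.congr_fun hl x)⟩
    let g' : P →ₗ[Aᵐᵒᵖ] KDual K X :=
      { toFun := fun p =>
          { toFun := fun x => (g x).toForm p
            map_add' := fun x y => by rw [map_add]; rfl
            map_smul' := fun c x => by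
              rw [← algebraMap_smul A c x, map_smul, algebraMap_smul]; rfl }
        map_add' := fun p q => LinearMap.ext fun x => map_add (g x).toForm p q
        map_smul' := fun a p => LinearMap.ext fun x => by
          change (g x).toForm (a • p) = (g (a.unop • x)).toForm p
          rw [map_smul g]; rfl }
    obtain ⟨h, hh⟩ := Module.projective_lifting_property res g' hres
    refine ⟨{ toFun := fun y =>
                { toFun := fun p => (h p).toForm y
                  map_add' := fun p q => by rw [map_add]; rfl
                  map_smul' := fun c p => by
                    rw [← algebraMap_smul Aᵐᵒᵖ c p, map_smul, algebraMap_smul]; rfl }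
              map_add' := fun y z => LinearMap.ext fun p => map_add (h p).toForm y z
              map_smul' := fun a y => LinearMap.ext fun p => by
                change (h p).toForm (a • y) = (h (MulOpposite.op a • p)).toForm y
                rw [map_smul h]; rfl }, fun x => LinearMap.ext fun p => ?_⟩
    exact congrArg (fun μ => KDual.toForm μ x) (LinearMap.congr_fun hh p)

section ExtDuality

variable [FiniteDimensional K A]

/-- A free cover of X dualizes to an embedding of X′ in an injective module. In degree one,
extension of maps along the kernel of the cover is adjoint to lifting of maps along the dual
surjection; higher degrees follow by shifting. -/
theorem extZero_iff_dual (i : ℕ) : ∀ {X X' Y Y' : Type u}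
    [AddCommGroup X] [Module K X] [Module Aᵐᵒᵖ X] [AddCommGroup X'] [Module K X'] [Module A X']
    [AddCommGroup Y] [Module K Y] [Module Aᵐᵒᵖ Y] [AddCommGroup Y'] [Module K Y'] [Module A Y']
    [IsScalarTower K Aᵐᵒᵖ X] [IsScalarTower K Aᵐᵒᵖ Y] [IsScalarTower K A X']
    [IsScalarTower K A Y'] [FiniteDimensional K X]
    (_ : DualPairing K A X X') (_ : DualPairing K A Y Y'),
    ExtZero Aᵐᵒᵖ X Y (i + 1) ↔ ExtZero A Y' X' (i + 1) := by
  induction i with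
  | zero =>
    intro X X' Y Y' _ _ _ _ _ _ _ _ _ _ _ _ _ _ _ _ _ pX pY
    have : Module.Finite Aᵐᵒᵖ X := Module.Finite.of_restrictScalars_finite K Aᵐᵒᵖ X
    obtain ⟨n, π, hπ⟩ := Module.Finite.exists_fin' Aᵐᵒᵖ X
    have hs := IsShortExact.ker π hπ
    have := finiteDimensional_submodule (K := K) (LinearMap.ker π)
    let pP := DualPairing.self A (K := K) (Fin n → Aᵐᵒᵖ)
    let pZ := DualPairing.self A (K := K) (LinearMap.ker π)
    obtain ⟨f', hf'⟩ := pZ.exists_adj pP (LinearMap.ker π).subtype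
    obtain ⟨g', hg'⟩ := pP.exists_adj pX π
    have hs' := DualPairing.isShortExact_of_isAdj hf' hg' hs
    have := KDual.injective_of_projective (K := K) (A := A) (Fin n → Aᵐᵒᵖ)
    constructor
    · intro h
      refine hs'.extZero_one_of_lift (extZero_of_injective le_rfl) fun k' => ?_
      obtain ⟨k, hk⟩ := pZ.exists_adj' pY k'
      obtain ⟨l, rfl⟩ := hs.exists_extend h k
      obtain ⟨l', hl'⟩ := pP.exists_adj pY l
      exact ⟨l', (hf'.comp hl').eq_right hk⟩
    · intro h
      refine hs.extZero_one_of_extend (extZero_of_projective le_rfl) fun k => ?_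
      obtain ⟨k', hk⟩ := pZ.exists_adj pY k
      obtain ⟨l', rfl⟩ := hs'.exists_lift h k'
      obtain ⟨l, hl⟩ := pP.exists_adj' pY l'
      exact ⟨l, (hf'.comp hl).eq_left hk⟩
  | succ i ih =>
    intro X X' Y Y' _ _ _ _ _ _ _ _ _ _ _ _ _ _ _ _ _ pX pY
    have : Module.Finite Aᵐᵒᵖ X := Module.Finite.of_restrictScalars_finite K Aᵐᵒᵖ X
    obtain ⟨n, π, hπ⟩ := Module.Finite.exists_fin' Aᵐᵒᵖ X
    have hs := IsShortExact.ker π hπ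
    have := finiteDimensional_submodule (K := K) (LinearMap.ker π)
    let pP := DualPairing.self A (K := K) (Fin n → Aᵐᵒᵖ)
    let pZ := DualPairing.self A (K := K) (LinearMap.ker π)
    obtain ⟨f', hf'⟩ := pZ.exists_adj pP (LinearMap.ker π).subtype
    obtain ⟨g', hg'⟩ := pP.exists_adj pX π
    have hs' := DualPairing.isShortExact_of_isAdj hf' hg' hs
    have := KDual.injective_of_projective (K := K) (A := A) (Fin n → Aᵐᵒᵖ)
    have h1 := ih pZ pY
    constructor
    · intro h
      exact hs'.extZero_succ_left' (h1.1 (hs.extZero_left (extZero_of_projective (by omega)) h))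
        (extZero_of_injective (by omega))
    · intro h
      exact hs.extZero_succ_right (h1.2 (hs'.extZero_right' (extZero_of_injective (by omega)) h))
        (extZero_of_projective (by omega))

theorem extVanishes_iff_dual {X X' Y Y' : Type u}
    [AddCommGroup X] [Module K X] [Module Aᵐᵒᵖ X] [AddCommGroup X'] [Module K X'] [Module A X']
    [AddCommGroup Y] [Module K Y] [Module Aᵐᵒᵖ Y] [AddCommGroup Y'] [Module K Y'] [Module A Y']
    [IsScalarTower K Aᵐᵒᵖ X] [IsScalarTower K Aᵐᵒᵖ Y] [IsScalarTower K A X']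
    [IsScalarTower K A Y'] [FiniteDimensional K X]
    (pX : DualPairing K A X X') (pY : DualPairing K A Y Y') :
    ExtVanishes Aᵐᵒᵖ X Y ↔ ExtVanishes A Y' X' := by
  constructor
  · intro h i hi
    obtain ⟨i, rfl⟩ := Nat.exists_eq_add_of_le' hi
    exact (extZero_iff_dual i pX pY).1 (h _ hi)
  · intro h i hi
    obtain ⟨i, rfl⟩ := Nat.exists_eq_add_of_le' hi
    exact (extZero_iff_dual i pX pY).2 (h _ hi)

end ExtDuality

end GendoSymm

end

/-! ### Gorenstein projective modules: A-duals and projective copresentations -/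

noncomputable section

namespace GendoSymm

section Bimodule

/-- `A` is free of rank one over both `R` and `S`, with the common generator `u`. -/
structure IsRegularBimodule (R S : Type u) [Ring R] [Ring S] (A : Type u) [AddCommGroup A]
    [Module R A] [Module S A] (u : A) : Prop where
  left : Function.Bijective fun r : R => r • u
  right : Function.Bijective fun s : S => s • u

variable {R S : Type u} [Ring R] [Ring S] {A : Type u} [AddCommGroup A] [Module R A] [Module S A]
  [SMulCommClass R S A] {u : A}

omit [SMulCommClass R S A] in
theorem IsRegularBimodule.symm (h : IsRegularBimodule R S A u) : IsRegularBimodule S R A u :=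
  ⟨h.right, h.left⟩

/-- The `A`-dual of the free module of rank `n`. -/
def dualFreeEquiv (h : IsRegularBimodule R S A u) (n : ℕ) :
    ((Fin n → R) →ₗ[R] A) ≃ₗ[S] (Fin n → S) :=
  (LinearEquiv.piRing R A (Fin n) S).trans (LinearEquiv.piCongrRight fun _ =>
    (LinearEquiv.ofBijective (LinearMap.toSpanSingleton S A u) h.right).symm)

variable (P : Type u) [AddCommGroup P] [Module R P] [Module.Finite R P] [Module.Projective R P]

theorem exists_retract_dual (h : IsRegularBimodule R S A u) :
    ∃ (n : ℕ) (a : (P →ₗ[R] A) →ₗ[S] (Fin n → S)) (b : (Fin n → S) →ₗ[S] (P →ₗ[R] A)),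
      b ∘ₗ a = LinearMap.id := by
  obtain ⟨n, p, s, -, -, hps⟩ := Module.Finite.exists_comp_eq_id_of_projective R P
  refine ⟨n, (dualFreeEquiv h n).toLinearMap ∘ₗ LinearMap.lcomp S A p,
    LinearMap.lcomp S A s ∘ₗ (dualFreeEquiv h n).symm.toLinearMap, ?_⟩
  ext φ x
  simpa using congrArg φ (LinearMap.congr_fun hps x)

theorem projective_dual (h : IsRegularBimodule R S A u) : Module.Projective S (P →ₗ[R] A) := by
  obtain ⟨n, a, b, hab⟩ := exists_retract_dual P h
  exact Module.Projective.of_split a b hab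

theorem finite_dual (h : IsRegularBimodule R S A u) : Module.Finite S (P →ₗ[R] A) := by
  obtain ⟨n, a, b, hab⟩ := exists_retract_dual P h
  exact Module.Finite.of_surjective b fun x => ⟨a x, LinearMap.congr_fun hab x⟩

/-- Dual maps on Rⁿ are S-combinations of the coordinate maps, so Φ is determined by its values on
the coordinates, each of which is a multiple of the common generator u. This is reflexivity of free
modules. -/
theorem exists_eval_free (h : IsRegularBimodule R S A u) (n : ℕ)
    (Φ : ((Fin n → R) →ₗ[R] A) →ₗ[S] A) : ∃ x, ∀ φ, Φ φ = φ x := by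
  let a : Fin n → R → A := fun i r => r • u
  choose x hx using fun i : Fin n =>
    h.left.2 (Φ (LinearMap.toSpanSingleton R A u ∘ₗ LinearMap.proj i))
  refine ⟨x, fun φ => ?_⟩
  choose s hs using fun i : Fin n => h.right.2 (φ (Pi.single i 1))
  have hφ : φ = ∑ i, s i • (LinearMap.toSpanSingleton R A u ∘ₗ LinearMap.proj i) := by
    refine LinearMap.pi_ext' fun i => LinearMap.ext_ring ?_
    simp only [LinearMap.comp_apply, LinearMap.coe_single, ← hs i, LinearMap.sum_apply,
      LinearMap.smul_apply, LinearMap.proj_apply, LinearMap.toSpanSingleton_apply]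
    rw [Finset.sum_eq_single i]
    · simp
    · intro j _ hj
      rw [Pi.single_eq_of_ne hj, zero_smul, smul_zero]
    · simp
  rw [hφ, map_sum, LinearMap.sum_apply]
  refine Finset.sum_congr rfl fun i _ => ?_
  rw [map_smul, ← hx]
  rfl

theorem exists_eval_projective (h : IsRegularBimodule R S A u) (Φ : (P →ₗ[R] A) →ₗ[S] A) :
    ∃ x, ∀ φ, Φ φ = φ x := by
  obtain ⟨n, p, s, -, -, hps⟩ := Module.Finite.exists_comp_eq_id_of_projective R P
  obtain ⟨x, hx⟩ := exists_eval_free h n (Φ ∘ₗ LinearMap.lcomp S A s)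
  refine ⟨p x, fun φ => ?_⟩
  have := hx (φ ∘ₗ p)
  rw [← LinearMap.comp_apply, ← this]
  simp only [LinearMap.comp_apply]
  congr 1
  ext y
  exact (congrArg φ (LinearMap.congr_fun hps y)).symm

omit [SMulCommClass R S A] [Module.Finite R P] in
variable {P} in
theorem eq_of_forall_dual (h : IsRegularBimodule R S A u) {x y : P}
    (hxy : ∀ φ : P →ₗ[R] A, φ x = φ y) : x = y := by
  refine sub_eq_zero.1 ((Module.forall_dual_apply_eq_zero_iff R (x - y)).1 fun ψ => h.left.1 ?_)
  have := hxy (LinearMap.toSpanSingleton R A u ∘ₗ ψ)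
  simp only [LinearMap.comp_apply, LinearMap.toSpanSingleton_apply] at this
  simp [sub_smul, this]

section GP

variable {M : Type u} [AddCommGroup M] [Module R M]

/-- The `A`-dual of a Gorenstein projective module has no extensions with `A`. -/
theorem GorensteinProjectiveAux.extVanishes_dual (h : IsRegularBimodule R S A u)
    (hM : GorensteinProjectiveAux R S A M) : ExtVanishes S (M →ₗ[R] A) A := by
  obtain ⟨-, P₁, P₀, f, p, _, _, _, _, hfp, hp, hT⟩ := hM
  have := projective_dual P₁ h
  have := projective_dual P₀ h
  have h1 : IsShortExact (LinearMap.lcomp S A p)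
      (LinearMap.rangeRestrict (LinearMap.lcomp S A f)) := by
    refine ⟨fun a b hab => ?_, fun φ => ?_, LinearMap.surjective_rangeRestrict _⟩
    · ext m
      obtain ⟨x, rfl⟩ := hp m
      exact LinearMap.congr_fun hab x
    · rw [← Subtype.coe_inj]
      constructor
      · intro hφ
        have hker : LinearMap.ker p ≤ LinearMap.ker φ := fun x hx => by
          obtain ⟨y, rfl⟩ := (hfp x).1 hx
          exact LinearMap.congr_fun hφ y
        refine ⟨(LinearMap.ker p).liftQ φ hker ∘ₗ (p.quotKerEquivOfSurjective hp).symm.toLinearMap,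
          LinearMap.ext fun x => ?_⟩
        have : (p.quotKerEquivOfSurjective hp).symm (p x) = (LinearMap.ker p).mkQ x := by
          rw [LinearEquiv.symm_apply_eq]; rfl
        simp [this]
      · rintro ⟨ψ, rfl⟩
        ext y
        simp [hfp.apply_apply_eq_zero]
  have h2 := IsShortExact.mkQ (LinearMap.range (LinearMap.lcomp S A f))
  intro i hi
  -- The A-dual of M is a second syzygy of Tr M, whence the shift by two.
  exact h1.extZero_left (extZero_of_projective hi)
    (h2.extZero_left (extZero_of_projective (by omega)) (hT (i + 2) (by omega)))

/-- A Gorenstein projective module is the kernel of a map of finitely generated projectives. -/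
theorem GorensteinProjectiveAux.exists_copresentation [IsNoetherianRing S]
    (h : IsRegularBimodule R S A u) (hM : GorensteinProjectiveAux R S A M) :
    ∃ (P P' : ModuleCat.{u} R) (k : M →ₗ[R] P) (l : P →ₗ[R] P'),
      Module.Finite R P ∧ Module.Projective R P ∧ Module.Finite R P' ∧ Module.Projective R P' ∧
      Function.Injective k ∧ Function.Exact k l := by
  have := SMulCommClass.symm R S A
  obtain ⟨-, P₁, P₀, f, p, _, _, _, _, hfp, hp, hT⟩ := hM
  have := projective_dual P₁ h
  have := finite_dual P₀ h
  -- The cokernel of F is Tr M and its kernel is the A-dual of M. Dualizing a free presentation of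
  -- that kernel gives the copresentation; exactness of the dual sequence is governed by Ext¹ and
  -- Ext² of Tr M.
  let F := LinearMap.lcomp S A f
  have hs1 := IsShortExact.mkQ (LinearMap.range F)
  have hs2 : IsShortExact (LinearMap.ker F).subtype F.rangeRestrict :=
    ⟨Subtype.val_injective, fun φ => by
      rw [← Subtype.coe_inj]
      change F φ = 0 ↔ _
      simp, LinearMap.surjective_rangeRestrict _⟩
  have hE1 : ExtZero S _ A 1 := hT 1 le_rfl
  have hE2 : ExtZero S (LinearMap.range F) A 1 :=
    hs1.extZero_left (extZero_of_projective le_rfl) (hT 2 (by omega))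
  obtain ⟨a, π, hπ⟩ := Module.Finite.exists_fin' S (LinearMap.ker F)
  obtain ⟨b, ρ, hρ⟩ := Module.Finite.exists_fin' S (LinearMap.ker π)
  let κ : P₀ →ₗ[R] ((Fin a → S) →ₗ[S] A) :=
    { toFun := fun x =>
        { toFun := fun y => (π y : P₀ →ₗ[R] A) x
          map_add' := fun y z => by simp
          map_smul' := fun s y => by simp }
      map_add' := fun x y => by ext; simp
      map_smul' := fun r x => by ext; simp }
  have hκ : LinearMap.ker p ≤ LinearMap.ker κ := fun x hx => by
    obtain ⟨y, rfl⟩ := (hfp x).1 hx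
    refine LinearMap.ext fun z => ?_
    exact LinearMap.congr_fun (π z).2 y
  let k : M →ₗ[R] ((Fin a → S) →ₗ[S] A) :=
    (LinearMap.ker p).liftQ κ hκ ∘ₗ (p.quotKerEquivOfSurjective hp).symm.toLinearMap
  have hk : ∀ x, k (p x) = κ x := fun x => by
    have : (p.quotKerEquivOfSurjective hp).symm (p x) = (LinearMap.ker p).mkQ x := by
      rw [LinearEquiv.symm_apply_eq]; rfl
    simp [k, this]
  let l : ((Fin a → S) →ₗ[S] A) →ₗ[R] ((Fin b → S) →ₗ[S] A) :=
    LinearMap.lcomp R A ((LinearMap.ker π).subtype ∘ₗ ρ)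
  refine ⟨ModuleCat.of R ((Fin a → S) →ₗ[S] A), ModuleCat.of R ((Fin b → S) →ₗ[S] A), k, l,
    finite_dual _ h.symm, projective_dual _ h.symm, finite_dual _ h.symm, projective_dual _ h.symm,
    ?_, ?_⟩
  -- If p(x) dies, evaluation at x factors through the range of F. It extends to the dual of P₁
  -- since Ext¹(Tr M, A) = 0, and is there evaluation at some y, giving x = f(y).
  · refine (injective_iff_map_eq_zero _).2 fun m hm => ?_
    obtain ⟨x, rfl⟩ := hp m
    rw [hk] at hm
    let e : (P₀ →ₗ[R] A) →ₗ[S] A := ⟨⟨fun φ => φ x, fun _ _ => rfl⟩, fun _ _ => rfl⟩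
    have hker : LinearMap.ker F.rangeRestrict ≤ LinearMap.ker e := fun φ hφ => by
      have hφ' : φ ∈ LinearMap.ker F := congrArg Subtype.val hφ
      obtain ⟨y, hy⟩ := hπ ⟨φ, hφ'⟩
      have := LinearMap.congr_fun hm y
      change (π y : P₀ →ₗ[R] A) x = 0 at this
      rw [hy] at this
      exact this
    let e' : LinearMap.range F →ₗ[S] A := (LinearMap.ker F.rangeRestrict).liftQ e hker ∘ₗ
      (F.rangeRestrict.quotKerEquivOfSurjective F.surjective_rangeRestrict).symm.toLinearMap
    have he' : ∀ φ, e' (F.rangeRestrict φ) = φ x := fun φ => by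
      have : (F.rangeRestrict.quotKerEquivOfSurjective F.surjective_rangeRestrict).symm
          (F.rangeRestrict φ) = (LinearMap.ker F.rangeRestrict).mkQ φ := by
        rw [LinearEquiv.symm_apply_eq]; rfl
      simp [e', this, e]
    obtain ⟨Φ, hΦ⟩ := hs1.exists_extend hE1 e'
    obtain ⟨y, hy⟩ := exists_eval_projective P₁ h Φ
    have : x = f y := eq_of_forall_dual h fun φ => by
      rw [← he', ← hΦ]
      exact hy _
    rw [this, hfp.apply_apply_eq_zero]
  · intro Ψ
    constructor
    -- A map killing the kernel of π descends to the kernel of F. It extends to the dual of P₀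
    -- because Ext¹(range F, A) = Ext²(Tr M, A) = 0, and is there evaluation at some x.
    · intro hΨ
      have hker : LinearMap.ker π ≤ LinearMap.ker Ψ := fun y hy => by
        obtain ⟨z, hz⟩ := hρ ⟨y, hy⟩
        have := LinearMap.congr_fun hΨ z
        change Ψ (ρ z : Fin a → S) = 0 at this
        rw [hz] at this
        exact this
      let e' : LinearMap.ker F →ₗ[S] A := (LinearMap.ker π).liftQ Ψ hker ∘ₗ
        (π.quotKerEquivOfSurjective hπ).symm.toLinearMap
      have he' : ∀ y, e' (π y) = Ψ y := fun y => by
        have : (π.quotKerEquivOfSurjective hπ).symm (π y) = (LinearMap.ker π).mkQ y := by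
          rw [LinearEquiv.symm_apply_eq]; rfl
        simp [e', this]
      obtain ⟨Φ, hΦ⟩ := hs2.exists_extend hE2 e'
      obtain ⟨x, hx⟩ := exists_eval_projective P₀ h Φ
      refine ⟨p x, ?_⟩
      rw [hk]
      refine LinearMap.ext fun y => ?_
      rw [← he', ← hΦ]
      exact (hx _).symm
    · rintro ⟨m, rfl⟩
      obtain ⟨x, rfl⟩ := hp m
      rw [hk]
      refine LinearMap.ext fun z => ?_
      change (π (ρ z : Fin a → S) : P₀ →ₗ[R] A) x = 0
      rw [LinearMap.mem_ker.1 (ρ z).2]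
      rfl

end GP

end Bimodule

theorem isRegularBimodule_right (A : Type u) [Ring A] : IsRegularBimodule Aᵐᵒᵖ A A (1 : A) where
  left := by
    convert unop_bijective (α := A) using 1
    ext r; simp
  right := by
    convert Function.bijective_id (α := A) using 1
    ext r; simp

theorem isRegularBimodule_left (A : Type u) [Ring A] : IsRegularBimodule A Aᵐᵒᵖ A (1 : A) :=
  (isRegularBimodule_right A).symm

end GendoSymm

end

/-! ### The inverse Nakayama functor and the equivalences of the first claim -/

noncomputable section

namespace GendoSymm

variable {K : Type u} [Field K] {A : Type u} [Ring A] [Algebra K A]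

variable (K A) in
/-- The dual of the regular left module, as the dual attached to `Aᵐᵒᵖ`. -/
def regularDualRight : RegularDual K Aᵐᵒᵖ (KDual K A) where
  ev := (((opLinearEquiv K : A ≃ₗ[K] Aᵐᵒᵖ).arrowCongr (LinearEquiv.refl K K)).toAddEquiv :
    (A →ₗ[K] K) ≃+ (Aᵐᵒᵖ →ₗ[K] K))
  ev_smul _ _ _ := rfl

variable (K A) in
/-- The dual of the regular right module, as the dual attached to `A`. -/
def regularDualLeft : RegularDual K A (KDual K A) where
  ev := AddEquiv.refl (A →ₗ[K] K)
  ev_smul _ _ _ := rfl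

section Nakayama

variable [FiniteDimensional K A] {D : GendoCore K A} {M N : Type u}
  [AddCommGroup M] [Module K M] [Module Aᵐᵒᵖ M] [AddCommGroup N] [Module K N] [Module A N]
  [IsScalarTower K Aᵐᵒᵖ M] [IsScalarTower K A N]

/-- Passing to adjoints with respect to the pairings identifies Hom(D(A), M) with Hom(N, A); the
isomorphism is η followed by this identification. -/
theorem nonempty_equiv_dual_right (p : DualPairing K A M N)
    (h : D.op.EtaBij (regularDualRight K A) M) : Nonempty (M ≃ₗ[Aᵐᵒᵖ] (N →ₗ[A] A)) := by
  let q := DualPairing.ofLeft A (K := K) A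
  choose Ψ hΨ using fun m : M => q.exists_adj p (D.op.eta (regularDualRight K A) m)
  let L : M →ₗ[Aᵐᵒᵖ] (N →ₗ[A] A) :=
    { toFun := Ψ
      map_add' := fun m m' => (hΨ (m + m')).eq_right fun f n => by
        rw [LinearMap.add_apply, map_add, hΨ, hΨ, map_add, LinearMap.add_apply, map_add,
          LinearMap.add_apply]
      map_smul' := fun a m => (hΨ (a • m)).eq_right fun f n => by
        have h1 : D.op.theta (regularDualRight K A) (a.unop • f) =
            D.op.theta (regularDualRight K A) f * a := D.op.theta_mul _ fun x => rfl
        have h2 := hΨ m (a.unop • f) n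
        rw [GendoCore.eta_apply, h1, mul_smul] at h2
        exact h2 }
  refine ⟨LinearEquiv.ofBijective L ⟨fun m m' hm => h.1 ?_, fun k => ?_⟩⟩
  · have hm' : Ψ m = Ψ m' := hm
    exact (hΨ m).eq_left (hm' ▸ hΨ m')
  · obtain ⟨l, hl⟩ := q.exists_adj' p k
    obtain ⟨m, rfl⟩ := h.2 l
    exact ⟨m, (hΨ m).eq_right hl⟩

theorem nonempty_equiv_dual_left (p : DualPairing K A M N)
    (h : D.EtaBij (regularDualLeft K A) N) : Nonempty (N ≃ₗ[A] (M →ₗ[Aᵐᵒᵖ] A)) := by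
  let q := DualPairing.self A (K := K) A
  choose Ψ hΨ using fun n : N => p.exists_adj' q (D.eta (regularDualLeft K A) n)
  let L : N →ₗ[A] (M →ₗ[Aᵐᵒᵖ] A) :=
    { toFun := Ψ
      map_add' := fun m m' => (hΨ (m + m')).eq_left fun x f => by
        rw [LinearMap.add_apply, map_add, map_add, LinearMap.add_apply, LinearMap.add_apply,
          map_add, hΨ, hΨ]
      map_smul' := fun a n => (hΨ (a • n)).eq_left fun x f => by
        have h1 : D.theta (regularDualLeft K A) (MulOpposite.op a • f) =
            D.theta (regularDualLeft K A) f * a := D.theta_mul _ fun x => rfl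
        have h2 := hΨ n x (MulOpposite.op a • f)
        rw [GendoCore.eta_apply, h1, mul_smul] at h2
        exact h2 }
  refine ⟨LinearEquiv.ofBijective L ⟨fun m m' hm => h.1 ?_, fun k => ?_⟩⟩
  · have hm' : Ψ m = Ψ m' := hm
    exact (hΨ m).eq_right (hm' ▸ hΨ m')
  · obtain ⟨l, hl⟩ := p.exists_adj q k
    obtain ⟨m, rfl⟩ := h.2 l
    exact ⟨m, (hΨ m).eq_left hl⟩

end Nakayama

theorem ExtVanishes.congr_left {R : Type u} [Ring R] {X Y N : Type u} [AddCommGroup X] [Module R X]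
    [AddCommGroup Y] [Module R Y] [AddCommGroup N] [Module R N] (a : X ≃ₗ[R] Y)
    (h : ExtVanishes R X N) : ExtVanishes R Y N :=
  fun i hi => (extZero_congr_left a).1 (h i hi)

section Main

variable [FiniteDimensional K A] (D : GendoCore K A) (hnearly : IsNearlyGorenstein K A)
  (M : Type u) [AddCommGroup M] [Module K M] [Module Aᵐᵒᵖ M] [IsScalarTower K Aᵐᵒᵖ M]
  [FiniteDimensional K M]

theorem domDim_right_eq_top_iff : domDim Aᵐᵒᵖ M = ⊤ ↔
    D.op.EtaBij (regularDualRight K A) M ∧ ExtVanishes Aᵐᵒᵖ (KDual K A) M := by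
  have : Module.Finite Aᵐᵒᵖ M := Module.Finite.of_restrictScalars_finite K Aᵐᵒᵖ M
  exact GendoCore.domDim_eq_top_iff M

theorem codomDim_eq_top_iff : codomDim K A M = ⊤ ↔
    D.EtaBij (regularDualLeft K A) (KDual K M) ∧ ExtVanishes A (KDual K A) (KDual K M) := by
  have : Module.Finite A (KDual K M) := Module.Finite.of_restrictScalars_finite K A _
  exact GendoCore.domDim_eq_top_iff (KDual K M)

theorem extVanishes_regular_iff :
    ExtVanishes Aᵐᵒᵖ M A ↔ ExtVanishes A (KDual K A) (KDual K M) :=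
  extVanishes_iff_dual (DualPairing.self A M) (DualPairing.self A A)

theorem extVanishes_dual_regular_iff :
    ExtVanishes Aᵐᵒᵖ (KDual K A) M ↔ ExtVanishes A (KDual K M) A :=
  extVanishes_iff_dual (DualPairing.ofLeft A A) (DualPairing.self A M)

-- M is the kernel of a map between projectives, on which η is bijective.
include D in
theorem IsGorensteinProjective.etaBij {M : Type u} [AddCommGroup M] [Module Aᵐᵒᵖ M]
    (h : IsGorensteinProjective A M) : D.op.EtaBij (regularDualRight K A) M := by
  have := isNoetherianRing_of_finiteDimensional K A
  obtain ⟨P, P', k, l, _, _, _, _, hk, hkl⟩ :=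
    GorensteinProjectiveAux.exists_copresentation (isRegularBimodule_right A) h
  exact GendoCore.EtaBij.of_exact hk hkl (D.op.etaBij_of_projective _)
    (D.op.etaBij_of_projective _).etaInj

include D in
theorem GorensteinProjectiveAux.etaBij_left {N : Type u} [AddCommGroup N] [Module A N]
    (h : GorensteinProjectiveAux A Aᵐᵒᵖ A N) : D.EtaBij (regularDualLeft K A) N := by
  have := isNoetherianRing_of_finiteDimensional K Aᵐᵒᵖ
  obtain ⟨P, P', k, l, _, _, _, _, hk, hkl⟩ :=
    GorensteinProjectiveAux.exists_copresentation (isRegularBimodule_left A) h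
  exact GendoCore.EtaBij.of_exact hk hkl (D.etaBij_of_projective _)
    (D.etaBij_of_projective _).etaInj

-- Each dominant-dimension condition supplies an Ext vanishing, which near Gorensteinness turns into
-- one half of Gorenstein projective-injectivity, and bijectivity of η, which transports the other
-- half through an A-dual.
include D hnearly in
theorem tfae_domDim_eq_top : List.TFAE [
    domDim Aᵐᵒᵖ M = ⊤,
    IsGorensteinProjectiveInjective K A M ∧ Nonempty (NakayamaInv K A M ≃ₗ[Aᵐᵒᵖ] M),
    IsGorensteinProjectiveInjective K A M,
    codomDim K A M = ⊤] := by
  obtain ⟨hinj, hproj⟩ := hnearly M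
  tfae_have 1 → 2 := by
    intro h
    obtain ⟨h1, h2⟩ := (domDim_right_eq_top_iff D M).1 h
    obtain ⟨ψ⟩ := nonempty_equiv_dual_right (DualPairing.self A M) h1
    have hGI := hinj.2 h2
    exact ⟨⟨hproj.2 ((GorensteinProjectiveAux.extVanishes_dual (isRegularBimodule_left A)
      hGI).congr_left ψ.symm), hGI⟩, ⟨ψ.symm⟩⟩
  tfae_have 2 → 3 := fun h => h.1
  tfae_have 3 → 1 := fun h =>
    (domDim_right_eq_top_iff D M).2 ⟨h.1.etaBij D, hinj.1 h.2⟩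
  tfae_have 3 → 4 := fun h =>
    (codomDim_eq_top_iff D M).2 ⟨GorensteinProjectiveAux.etaBij_left D h.2,
      (extVanishes_regular_iff M).1 (hproj.1 h.1)⟩
  tfae_have 4 → 3 := by
    intro h
    obtain ⟨h1, h2⟩ := (codomDim_eq_top_iff D M).1 h
    have hGP := hproj.2 ((extVanishes_regular_iff M).2 h2)
    obtain ⟨ψ⟩ := nonempty_equiv_dual_left (DualPairing.self A M) h1
    exact ⟨hGP, hinj.2 ((extVanishes_dual_regular_iff M).2
      ((GorensteinProjectiveAux.extVanishes_dual (isRegularBimodule_right A) hGP).congr_left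
        ψ.symm))⟩
  tfae_finish

end Main

end GendoSymm

end

noncomputable section

namespace GendoSymm

variable {K : Type u} [Field K] {R : Type u} [Ring R] [Algebra K R]

/-! ### The trace pairing between `Hom(Qⁿ, Z)` and `Hom(Z, Qⁿ)` for `Q = Re` -/

namespace GendoCore

variable (D : GendoCore K R)

/-- The module `(Re)ⁿ`. -/
abbrev QPow (n : ℕ) : Type u := Fin n → leftIdeal D.e

instance (n : ℕ) : Module.Injective R (D.QPow n) :=
  have := D.leftIdeal_injective
  inferInstance

/-- The generator `e` of the `i`-th summand of `(Re)ⁿ`. -/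
def gen {n : ℕ} (i : Fin n) : D.QPow n := Pi.single i ⟨D.e, ⟨D.e, D.idem⟩⟩

theorem e_smul_gen {n : ℕ} (i : Fin n) : D.e • D.gen i = D.gen i := by
  rw [gen, ← Pi.single_smul]
  congr 1
  exact Subtype.ext D.idem

theorem sum_smul_gen {n : ℕ} (y : D.QPow n) : ∑ i, (y i : R) • D.gen i = y := by
  conv_rhs => rw [← Finset.univ_sum_single y]
  refine Finset.sum_congr rfl fun i _ => ?_
  rw [gen, ← Pi.single_smul]
  congr 1
  exact Subtype.ext (D.mul_e (y i))

variable {D} in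
theorem map_eq_sum {n : ℕ} {Z : Type u} [AddCommGroup Z] [Module R Z] (a : D.QPow n →ₗ[R] Z)
    (y : D.QPow n) : a y = ∑ i, (y i : R) • a (D.gen i) := by
  conv_lhs => rw [← D.sum_smul_gen y, map_sum]
  simp only [map_smul]

theorem e_mul_map_gen {n m : ℕ} (c : D.QPow n →ₗ[R] D.QPow m) (i : Fin n) (j : Fin m) :
    D.e * (c (D.gen i) j : R) = c (D.gen i) j := by
  conv_rhs => rw [← D.e_smul_gen, map_smul]
  rfl

theorem map_gen_eq {n m : ℕ} (c : D.QPow n →ₗ[R] D.QPow m) (i : Fin n) (j : Fin m) :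
    D.e * (c (D.gen i) j : R) * D.e = c (D.gen i) j := by
  rw [e_mul_map_gen, D.mul_e]

/-- The trace of an endomorphism of `(Re)ⁿ`. -/
def trace {n : ℕ} (h : D.QPow n →ₗ[R] D.QPow n) : K := ∑ i, D.tr (h (D.gen i) i : R)

/-- In matrix form the entries lie in eRe, where the trace form is symmetric. -/
theorem trace_comp_comm {n m : ℕ} (c : D.QPow n →ₗ[R] D.QPow m) (d : D.QPow m →ₗ[R] D.QPow n) :
    D.trace (d ∘ₗ c) = D.trace (c ∘ₗ d) := by
  have key : ∀ {n m : ℕ} (c : D.QPow n →ₗ[R] D.QPow m) (d : D.QPow m →ₗ[R] D.QPow n),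
      D.trace (d ∘ₗ c) = ∑ i, ∑ j, D.tr ((c (D.gen i) j : R) * d (D.gen j) i) := by
    intro n m c d
    refine Finset.sum_congr rfl fun i _ => ?_
    rw [LinearMap.comp_apply, map_eq_sum d, Finset.sum_apply, AddSubmonoidClass.coe_finsetSum,
      map_sum]
    rfl
  rw [key, key, Finset.sum_comm]
  refine Finset.sum_congr rfl fun j _ => Finset.sum_congr rfl fun i _ => ?_
  have := D.tr_comm (c (D.gen i) j) (d (D.gen j) i)
  have h1 : D.e * (c (D.gen i) j : R) * D.e * d (D.gen j) i * D.e = c (D.gen i) j * d (D.gen j) i := by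
    rw [map_gen_eq, mul_assoc, D.mul_e]
  have h2 : D.e * (d (D.gen j) i : R) * D.e * c (D.gen i) j * D.e = d (D.gen j) i * c (D.gen i) j := by
    rw [map_gen_eq, mul_assoc, D.mul_e]
  rwa [h1, h2] at this

variable {Z : Type u} [AddCommGroup Z] [Module R Z] [Module K Z] [IsScalarTower K R Z]

/-- The map `(Re)ⁿ → Z`, `y ↦ yᵢ z`. -/
def coordMap {n : ℕ} (i : Fin n) : Z →ₗ[K] (D.QPow n →ₗ[R] Z) where
  toFun z := LinearMap.toSpanSingleton R Z z ∘ₗ (leftIdeal D.e).subtype ∘ₗ LinearMap.proj i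
  map_add' z z' := LinearMap.ext fun y => smul_add (y i : R) z z'
  map_smul' c z := LinearMap.ext fun y => by
    change (y i : R) • c • z = c • (y i : R) • z
    rw [← algebraMap_smul R c z, ← algebraMap_smul R c ((y i : R) • z), smul_smul, smul_smul,
      Algebra.commutes]

theorem coordMap_apply {n : ℕ} (i : Fin n) (z : Z) (y : D.QPow n) :
    D.coordMap (K := K) i z y = (y i : R) • z := rfl

theorem eq_sum_coordMap {n : ℕ} (a : D.QPow n →ₗ[R] Z) :
    a = ∑ i, D.coordMap (K := K) i (a (D.gen i)) := by
  refine LinearMap.ext fun y => ?_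
  rw [map_eq_sum a, LinearMap.sum_apply]
  rfl

/-- The form on `Hom(Qⁿ, Z)` attached to a map `Z → Qⁿ`. -/
def traceAgainst {n : ℕ} (b : Z →ₗ[R] D.QPow n) : (D.QPow n →ₗ[R] Z) →ₗ[K] K where
  toFun a := D.trace (b ∘ₗ a)
  map_add' a a' := by simp [trace, Finset.sum_add_distrib]
  map_smul' c a := by
    simp only [trace, LinearMap.comp_apply, LinearMap.smul_apply, RingHom.id_apply,
      Finset.smul_sum, ← map_smul]
    refine Finset.sum_congr rfl fun i _ => congrArg D.tr ?_
    rw [← algebraMap_smul R c (a (D.gen i)), map_smul, ← algebraMap_smul R c (_ : R)]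
    rfl

/-- The pairing (a, b) ↦ tr(b ∘ a) of Hom(Qⁿ, Z) with Hom(Z, Qⁿ) detects b: on the coordinate maps
it becomes the perfect pairing of eR with Re. -/
theorem eq_of_trace_eq {n : ℕ} {b b' : Z →ₗ[R] D.QPow n}
    (h : ∀ a : D.QPow n →ₗ[R] Z, D.trace (b ∘ₗ a) = D.trace (b' ∘ₗ a)) : b = b' := by
  have key : ∀ (b : Z →ₗ[R] D.QPow n) (i : Fin n) (z : Z) (x : R),
      D.trace (b ∘ₗ D.coordMap (K := K) i (x • z)) = D.tr (D.e * x * b z i) := by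
    intro b i z x
    rw [trace, Finset.sum_eq_single i]
    · rw [LinearMap.comp_apply, coordMap_apply, gen, Pi.single_eq_same, map_smul, map_smul,
        mul_assoc]
      rfl
    · intro j _ hj
      rw [LinearMap.comp_apply, coordMap_apply, gen, Pi.single_eq_of_ne' hj]
      simp
    · simp
  refine LinearMap.ext fun z => funext fun i => D.leftIdeal_ext fun x => ?_
  rw [← key, ← key, h]

/-- With the preceding nondegeneracy this identifies Hom(Z, Qⁿ) with the dual of Hom(Qⁿ, Z),
reflecting that Re is the dual of eR. -/
theorem exists_traceAgainst {n : ℕ} (Φ : (D.QPow n →ₗ[R] Z) →ₗ[K] K) :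
    ∃ b : Z →ₗ[R] D.QPow n, ∀ a, Φ a = D.trace (b ∘ₗ a) := by
  refine ⟨LinearMap.pi fun i => D.formMap (Φ ∘ₗ D.coordMap i), fun a => ?_⟩
  conv_lhs => rw [D.eq_sum_coordMap (K := K) a, map_sum]
  refine Finset.sum_congr rfl fun i _ => ?_
  have h1 := D.tr_formMap (Φ ∘ₗ D.coordMap (n := n) i) (a (D.gen i)) 1
  rw [mul_one, ← map_smul, D.e_smul_gen] at h1
  refine h1.symm.trans (congrArg D.tr ?_)
  rw [LinearMap.comp_apply, LinearMap.pi_apply]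
  conv_rhs => rw [← D.e_smul_gen, map_smul, map_smul]
  rfl

/-- If `Hom(-, Z)` is exact at `Qⁿ` for `Qᵖ → Qⁿ → Qᵐ`, then so is `Hom(Z, -)`. -/
theorem exists_lift_of_exact_hom {n m p : ℕ} (d : D.QPow p →ₗ[R] D.QPow n)
    (c : D.QPow n →ₗ[R] D.QPow m)
    (hex : ∀ a : D.QPow n →ₗ[R] Z, a ∘ₗ d = 0 → ∃ a' : D.QPow m →ₗ[R] Z, a' ∘ₗ c = a)
    (g : Z →ₗ[R] D.QPow n) (hg : c ∘ₗ g = 0) : ∃ g' : Z →ₗ[R] D.QPow p, d ∘ₗ g' = g := by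
  let L : (D.QPow n →ₗ[R] Z) →ₗ[K] (D.QPow p →ₗ[R] Z) := LinearMap.lcomp K Z d
  -- The form tr(g ∘ a) vanishes when a ∘ d = 0: then a = a′ ∘ c, and commuting the trace produces c
  -- ∘ g = 0. So the form factors through composition with d, and the map representing the factor is
  -- the lift.
  have hmem : D.traceAgainst (K := K) g ∈ LinearMap.range L.dualMap := by
    rw [LinearMap.range_dualMap_eq_dualAnnihilator_ker, Submodule.mem_dualAnnihilator]
    intro a ha
    obtain ⟨a', rfl⟩ := hex a ha
    change D.trace (g ∘ₗ a' ∘ₗ c) = 0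
    rw [← LinearMap.comp_assoc, trace_comp_comm, ← LinearMap.comp_assoc, hg]
    simp [trace]
  obtain ⟨Φ, hΦ⟩ := hmem
  obtain ⟨g', hg'⟩ := D.exists_traceAgainst Φ
  refine ⟨g', D.eq_of_trace_eq (K := K) fun a => ?_⟩
  have h1 : D.trace (g ∘ₗ a) = Φ (a ∘ₗ d) := (LinearMap.congr_fun hΦ a).symm
  rw [h1, hg', LinearMap.comp_assoc, trace_comp_comm, LinearMap.comp_assoc]

end GendoCore

/-! ### Pushouts -/

theorem IsShortExact.exists_pushout {W P V U : Type u} [AddCommGroup W] [Module R W]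
    [AddCommGroup P] [Module R P] [AddCommGroup V] [Module R V] [AddCommGroup U] [Module R U]
    {i : W →ₗ[R] P} {q : P →ₗ[R] V} (h : IsShortExact i q) (a : W →ₗ[R] U) :
    ∃ (O : ModuleCat.{u} R) (jU : U →ₗ[R] O) (jP : P →ₗ[R] O) (g : O →ₗ[R] V),
      IsShortExact jU g ∧ jU ∘ₗ a = jP ∘ₗ i ∧
      ∀ (T : Type u) [AddCommGroup T] [Module R T] (α : U →ₗ[R] T) (β : P →ₗ[R] T),
        α ∘ₗ a = β ∘ₗ i → ∃ γ : O →ₗ[R] T, γ ∘ₗ jU = α ∧ γ ∘ₗ jP = β := by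
  let N := LinearMap.range (LinearMap.prod a (-i))
  have hlift : ∀ (T : Type u) [AddCommGroup T] [Module R T] (α : U →ₗ[R] T) (β : P →ₗ[R] T),
      α ∘ₗ a = β ∘ₗ i → N ≤ LinearMap.ker (LinearMap.coprod α β) := by
    rintro T _ _ α β hαβ _ ⟨w, rfl⟩
    have := LinearMap.congr_fun hαβ w
    simp only [LinearMap.comp_apply] at this
    simp [this]
  have hq : N ≤ LinearMap.ker (LinearMap.coprod (0 : U →ₗ[R] V) q) :=
    hlift V 0 q (by ext w; simp [h.exact.apply_apply_eq_zero])
  refine ⟨ModuleCat.of R ((U × P) ⧸ N), N.mkQ ∘ₗ LinearMap.inl R U P, N.mkQ ∘ₗ LinearMap.inr R U P,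
    N.liftQ (LinearMap.coprod 0 q) hq, ⟨?_, ?_, ?_⟩, ?_, fun T _ _ α β hαβ => ?_⟩
  · refine (injective_iff_map_eq_zero _).2 fun x hx => ?_
    obtain ⟨w, hw⟩ := (Submodule.Quotient.mk_eq_zero N).1 hx
    have h1 : a w = x := congrArg Prod.fst hw
    have h2 : -i w = 0 := congrArg Prod.snd hw
    rw [neg_eq_zero] at h2
    rw [← h1, h.inj (h2.trans (map_zero i).symm), map_zero]
  · intro z
    obtain ⟨⟨x, y⟩, rfl⟩ := N.mkQ_surjective z
    constructor
    · intro hz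
      have hy : q y = 0 := by simpa using hz
      obtain ⟨w, rfl⟩ := (h.exact y).1 hy
      refine ⟨x + a w, (Submodule.Quotient.eq N).2 ⟨w, ?_⟩⟩
      ext <;> simp
    · rintro ⟨x', hx'⟩
      rw [← hx']
      simp
  · intro v
    obtain ⟨y, rfl⟩ := h.surj v
    exact ⟨N.mkQ (0, y), by simp⟩
  · refine LinearMap.ext fun w => (Submodule.Quotient.eq N).2 ⟨w, ?_⟩
    ext <;> simp
  · exact ⟨N.liftQ (LinearMap.coprod α β) (hlift T α β hαβ), by ext; simp, by ext; simp⟩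

/-- A map vanishing on the kernel of a surjection factors through it. -/
theorem IsShortExact.exists_factor {X Y Z T : Type u} [AddCommGroup X] [Module R X]
    [AddCommGroup Y] [Module R Y] [AddCommGroup Z] [Module R Z] [AddCommGroup T] [Module R T]
    {f : X →ₗ[R] Y} {g : Y →ₗ[R] Z} (h : IsShortExact f g) (a : Y →ₗ[R] T) (ha : a ∘ₗ f = 0) :
    ∃ b : Z →ₗ[R] T, b ∘ₗ g = a := by
  have hker : LinearMap.ker g ≤ LinearMap.ker a := fun y hy => by
    obtain ⟨x, rfl⟩ := (h.exact y).1 hy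
    exact LinearMap.congr_fun ha x
  refine ⟨(LinearMap.ker g).liftQ a hker ∘ₗ (g.quotKerEquivOfSurjective h.surj).symm.toLinearMap,
    LinearMap.ext fun y => ?_⟩
  have : (g.quotKerEquivOfSurjective h.surj).symm (g y) = (LinearMap.ker g).mkQ y := by
    rw [LinearEquiv.symm_apply_eq]; rfl
  simp [this]

end GendoSymm

end

/-! ### Admissible classes and minimal approximations of simple modules -/

noncomputable section

namespace GendoSymm

variable {K : Type u} [Field K] {R : Type u} [Ring R] [Algebra K R]

/-- A contravariantly finite, extension closed class of modules in which `(Re)ⁿ` gives both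
syzygies and cosyzygies, and in which projective modules are injective. -/
structure AdmissibleClass (D : GendoCore K R)
    (𝒳 : ∀ (V : Type u) [AddCommGroup V] [Module R V], Prop) : Prop where
  finite : ∀ (V : Type u) [AddCommGroup V] [Module R V], 𝒳 V → Module.Finite R V
  retract : ∀ {V W : Type u} [AddCommGroup V] [Module R V] [AddCommGroup W] [Module R W]
    (a : V →ₗ[R] W) (b : W →ₗ[R] V), b ∘ₗ a = LinearMap.id → 𝒳 W → 𝒳 V
  extension : ∀ {X Y Z : Type u} [AddCommGroup X] [Module R X] [AddCommGroup Y] [Module R Y]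
    [AddCommGroup Z] [Module R Z] {f : X →ₗ[R] Y} {g : Y →ₗ[R] Z},
    IsShortExact f g → 𝒳 X → 𝒳 Z → 𝒳 Y
  qpow : ∀ n, 𝒳 (D.QPow n)
  cosyzygy : ∀ (V : Type u) [AddCommGroup V] [Module R V], 𝒳 V →
    ∃ (n : ℕ) (W : ModuleCat.{u} R) (f : V →ₗ[R] D.QPow n) (g : D.QPow n →ₗ[R] W),
      IsShortExact f g ∧ 𝒳 W
  syzygy : ∀ (V : Type u) [AddCommGroup V] [Module R V], 𝒳 V →
    ∃ (n : ℕ) (W : ModuleCat.{u} R) (f : W →ₗ[R] D.QPow n) (g : D.QPow n →ₗ[R] V),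
      IsShortExact f g ∧ 𝒳 W
  injective : ∀ (V : Type u) [AddCommGroup V] [Module R V], 𝒳 V → Module.Projective R V →
    Module.Injective R V
  approx : ∀ (T : Type u) [AddCommGroup T] [Module R T], Module.Finite R T →
    ∃ (U : ModuleCat.{u} R) (f : U →ₗ[R] T), 𝒳 U ∧
      ∀ (V : Type u) [AddCommGroup V] [Module R V], 𝒳 V → ∀ φ : V →ₗ[R] T,
        ∃ l : V →ₗ[R] U, f ∘ₗ l = φ

/-- A minimal right approximation. -/
structure IsMinimalApprox (𝒳 : ∀ (V : Type u) [AddCommGroup V] [Module R V], Prop)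
    {U T : Type u} [AddCommGroup U] [Module R U] [AddCommGroup T] [Module R T]
    (f : U →ₗ[R] T) : Prop where
  mem : 𝒳 U
  lift : ∀ (V : Type u) [AddCommGroup V] [Module R V], 𝒳 V → ∀ φ : V →ₗ[R] T,
    ∃ l : V →ₗ[R] U, f ∘ₗ l = φ
  bijective : ∀ h : U →ₗ[R] U, f ∘ₗ h = f → Function.Bijective h

/-- A submodule minimal with a given property. -/
theorem exists_minimal_submodule {M : Type u} [AddCommGroup M] [Module R M] [IsArtinian R M]
    (P : Submodule R M → Prop) (h : ∃ N, P N) : ∃ N, P N ∧ ∀ N', P N' → ¬ N' < N :=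
  (wellFounded_lt (α := Submodule R M)).has_min {N | P N} h

/-- The image of a submodule of a submodule. -/
def mapSubtypeEquiv {M : Type u} [AddCommGroup M] [Module R M] (N : Submodule R M)
    (S : Submodule R N) : S ≃ₗ[R] S.map N.subtype :=
  Submodule.equivMapOfInjective _ N.injective_subtype S

theorem exists_simple_quotient {M : Type u} [AddCommGroup M] [Module R M]
    [Module.Finite R M] [Nontrivial M] :
    ∃ (T : ModuleCat.{u} R) (q : M →ₗ[R] T), IsSimpleModule R T ∧ Function.Surjective q := by
  obtain ⟨m, hm⟩ := IsCoatomic.exists_coatom (Submodule R M)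
  exact ⟨ModuleCat.of R (M ⧸ m), m.mkQ, isSimpleModule_iff_isCoatom.2 hm, m.mkQ_surjective⟩

/-- If a map `N → T` factors through a finitely generated projective module, then `N` has a
projective summand not in its kernel. -/
theorem exists_projective_summand [IsArtinianRing R] {N T P : Type u}
    [AddCommGroup N] [Module R N]
    [AddCommGroup T] [Module R T] [AddCommGroup P] [Module R P] [Module.Finite R P]
    [Module.Projective R P] {π : N →ₗ[R] T} (hsurj : Function.Surjective π)
    (q : P →ₗ[R] T) (l : N →ₗ[R] P) (hql : q ∘ₗ l = π) :
    ∃ (P' : ModuleCat.{u} R) (q' : P' →ₗ[R] T) (l' : N →ₗ[R] P') (s : P' →ₗ[R] N),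
      Module.Projective R P' ∧ q' ∘ₗ l' = π ∧ l' ∘ₗ s = LinearMap.id := by
  obtain ⟨P', ⟨hP', q', l', hq⟩, hmin⟩ := exists_minimal_submodule
    (fun P' : Submodule R P => Module.Projective R P' ∧
      ∃ (q' : P' →ₗ[R] T) (l' : N →ₗ[R] P'), q' ∘ₗ l' = π) ⟨⊤,
        Module.Projective.of_equiv (Submodule.topEquiv (R := R) (M := P)).symm,
        q ∘ₗ Submodule.topEquiv.toLinearMap, Submodule.topEquiv.symm.toLinearMap ∘ₗ l, hql⟩
  -- Since q′ lifts through π, the composite l′ ∘ m is an endomorphism of P′ over T. Minimality of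
  -- P′ makes it bijective, and P′ splits off N.
  obtain ⟨m, hm⟩ := Module.projective_lifting_property π q' hsurj
  have hh : q' ∘ₗ (l' ∘ₗ m) = q' := by rw [← LinearMap.comp_assoc, hq, hm]
  have hbij := bijective_of_minimal hmin (l' ∘ₗ m) fun k hk => by
    obtain ⟨r, hr⟩ := exists_retraction_of_isCompl hk
    have : Module.Projective R (LinearMap.range ((l' ∘ₗ m) ^ k)) :=
      Module.Projective.of_split _ r hr
    refine ⟨Module.Projective.of_equiv (mapSubtypeEquiv P' _),
      q' ∘ₗ (LinearMap.range ((l' ∘ₗ m) ^ k)).subtype ∘ₗ (mapSubtypeEquiv P' _).symm.toLinearMap,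
      (mapSubtypeEquiv P' _).toLinearMap ∘ₗ ((l' ∘ₗ m) ^ k).rangeRestrict ∘ₗ l',
      LinearMap.ext fun v => ?_⟩
    simp only [LinearMap.comp_apply, LinearEquiv.coe_coe, LinearEquiv.symm_apply_apply]
    exact (LinearMap.congr_fun (pow_apply_of_apply_eq hh k) (l' v)).trans
      (LinearMap.congr_fun hq v)
  let s := LinearEquiv.ofBijective _ hbij
  exact ⟨ModuleCat.of R P', q', l', m ∘ₗ s.symm.toLinearMap, hP', hq,
    LinearMap.ext fun x => s.apply_symm_apply x⟩

namespace AdmissibleClass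

variable {D : GendoCore K R} {𝒳 : ∀ (V : Type u) [AddCommGroup V] [Module R V], Prop}
  (h𝒳 : AdmissibleClass D 𝒳)

include h𝒳

theorem congr {V W : Type u} [AddCommGroup V] [Module R V] [AddCommGroup W] [Module R W]
    (a : V ≃ₗ[R] W) (hW : 𝒳 W) : 𝒳 V :=
  h𝒳.retract a.toLinearMap a.symm.toLinearMap (by ext; simp) hW

/-- Restrict an approximation to a minimal submodule of its source that still approximates.
Fitting's lemma then makes every endomorphism over T bijective. -/
theorem exists_minimalApprox [IsArtinianRing R] (T : Type u) [AddCommGroup T] [Module R T]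
    [hT : Module.Finite R T] : ∃ (U : ModuleCat.{u} R) (f : U →ₗ[R] T), IsMinimalApprox 𝒳 f := by
  obtain ⟨U, f, hU, hf⟩ := h𝒳.approx T hT
  have := h𝒳.finite U hU
  obtain ⟨N, ⟨hN, hfN⟩, hmin⟩ := exists_minimal_submodule
    (fun N : Submodule R U => 𝒳 N ∧ ∀ (V : Type u) [AddCommGroup V] [Module R V], 𝒳 V →
      ∀ φ : V →ₗ[R] T, ∃ l : V →ₗ[R] N, f ∘ₗ N.subtype ∘ₗ l = φ) ⟨⊤,
        h𝒳.congr Submodule.topEquiv hU, fun V _ _ hV φ => by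
          obtain ⟨l, hl⟩ := hf V hV φ
          exact ⟨Submodule.topEquiv.symm.toLinearMap ∘ₗ l, hl⟩⟩
  refine ⟨ModuleCat.of R N, f ∘ₗ N.subtype, hN, fun V _ _ hV φ => hfN V hV φ, fun h hh => ?_⟩
  refine bijective_of_minimal hmin h fun k hk => ⟨?_, fun V _ _ hV φ => ?_⟩
  · obtain ⟨r, hr⟩ := exists_retraction_of_isCompl hk
    exact h𝒳.congr (mapSubtypeEquiv N _).symm (h𝒳.retract _ r hr hN)
  · obtain ⟨l, hl⟩ := hfN V hV φ
    refine ⟨(mapSubtypeEquiv N _).toLinearMap ∘ₗ (h ^ k).rangeRestrict ∘ₗ l,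
      LinearMap.ext fun v => ?_⟩
    exact (LinearMap.congr_fun (pow_apply_of_apply_eq hh k) (l v)).trans (LinearMap.congr_fun hl v)

section MinimalApprox

variable {U T : Type u} [AddCommGroup U] [Module R U] [AddCommGroup T] [Module R T]
  {f : U →ₗ[R] T} (hf : IsMinimalApprox 𝒳 f)

include hf

/-- Wakamatsu's lemma. -/
theorem exists_extend_ker {W P V : Type u} [AddCommGroup W] [Module R W]
    [AddCommGroup P] [Module R P] [AddCommGroup V] [Module R V] {i : W →ₗ[R] P} {q : P →ₗ[R] V}
    (h : IsShortExact i q) (hV : 𝒳 V) (a : W →ₗ[R] LinearMap.ker f) :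
    ∃ b : P →ₗ[R] LinearMap.ker f, b ∘ₗ i = a := by
  -- The pushout O is an extension of V by U, hence in the class. The map O → T given by f on U and
  -- zero on P lifts through f; its restriction to U is invertible by minimality, and correcting by
  -- the inverse sends P into the kernel.
  obtain ⟨O, jU, jP, g, hO, hcomm, hdesc⟩ := h.exists_pushout ((LinearMap.ker f).subtype ∘ₗ a)
  obtain ⟨γ, hγU, hγP⟩ := hdesc T f 0 (LinearMap.ext fun w => (a w).2)
  obtain ⟨k, hk⟩ := hf.lift O (h𝒳.extension hO hf.mem hV) γ
  have hh : f ∘ₗ (k ∘ₗ jU) = f := by rw [← LinearMap.comp_assoc, hk, hγU]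
  let s := LinearEquiv.ofBijective (k ∘ₗ jU) (hf.bijective _ hh)
  have hs : ∀ x, f (s.symm x) = f x := fun x => by
    conv_rhs => rw [← s.apply_symm_apply x]
    exact (LinearMap.congr_fun hh (s.symm x)).symm
  refine ⟨LinearMap.codRestrict _ (s.symm.toLinearMap ∘ₗ k ∘ₗ jP) fun p => ?_,
    LinearMap.ext fun w => Subtype.ext ?_⟩
  · rw [LinearMap.mem_ker]
    refine (hs _).trans ((LinearMap.congr_fun hk (jP p)).trans (LinearMap.congr_fun hγP p))
  · change s.symm (k (jP (i w))) = a w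
    rw [LinearEquiv.symm_apply_eq]
    exact congrArg k (LinearMap.congr_fun hcomm w).symm

/-- A map from the kernel of a minimal approximation to a module in the class factors through
some `(Re)ⁿ`. -/
theorem exists_factor_ker {V : Type u} [AddCommGroup V] [Module R V] (hV : 𝒳 V)
    (g : LinearMap.ker f →ₗ[R] V) :
    ∃ (p : ℕ) (a : LinearMap.ker f →ₗ[R] D.QPow p) (b : D.QPow p →ₗ[R] V), b ∘ₗ a = g := by
  obtain ⟨n, W₁, ι, π, h₁, hW₁⟩ := h𝒳.cosyzygy V hV
  obtain ⟨m, W₂, κ, ρ, h₂, hW₂⟩ := h𝒳.cosyzygy W₁ hW₁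
  obtain ⟨p, W', _, σ, h₃, -⟩ := h𝒳.syzygy V hV
  let := scalarModule K R (LinearMap.ker f)
  have := scalarModule_isScalarTower K R (LinearMap.ker f)
  -- The complex Qᵖ → Qⁿ → Qᵐ splices a syzygy and two cosyzygies of V. Hom(-, ker f) is exact on it
  -- by Wakamatsu's lemma, so trace duality lifts the map into V ⊆ Qⁿ to Qᵖ.
  obtain ⟨g', hg'⟩ := D.exists_lift_of_exact_hom (ι ∘ₗ σ) (κ ∘ₗ π) (fun a ha => by
    obtain ⟨a₁, rfl⟩ := h₁.exists_factor a (LinearMap.ext fun v => by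
      obtain ⟨y, rfl⟩ := h₃.surj v
      exact LinearMap.congr_fun ha y)
    obtain ⟨a₂, rfl⟩ := h𝒳.exists_extend_ker hf h₂ hW₂ a₁
    exact ⟨a₂, rfl⟩) (ι ∘ₗ g) (LinearMap.ext fun z => by
      simp [h₁.exact.apply_apply_eq_zero])
  exact ⟨p, g', σ, LinearMap.ext fun z => h₁.inj (LinearMap.congr_fun hg' z)⟩

/-- The map factors through some Qᵖ, which is injective. -/
theorem exists_extend_of_ker {V : Type u} [AddCommGroup V] [Module R V] (hV : 𝒳 V)
    (g : LinearMap.ker f →ₗ[R] V) : ∃ g' : U →ₗ[R] V, g' ∘ₗ (LinearMap.ker f).subtype = g := by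
  obtain ⟨p, a, b, rfl⟩ := h𝒳.exists_factor_ker hf hV g
  obtain ⟨a', ha'⟩ := Module.Injective.out (Q := D.QPow p) (LinearMap.ker f).subtype
    (LinearMap.ker f).injective_subtype a
  exact ⟨b ∘ₗ a', LinearMap.ext fun z => congrArg b (ha' z)⟩

/-- The minimal approximation of a simple module outside the class is a summand of `(Re)ⁿ`. -/
theorem exists_retract_of_isSimpleModule [IsSimpleModule R T] (hT : ¬ 𝒳 T)
    (hsurj : Function.Surjective f) :
    ∃ (n : ℕ) (a : U →ₗ[R] D.QPow n) (b : D.QPow n →ₗ[R] U), b ∘ₗ a = LinearMap.id := by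
  obtain ⟨n, a, b, hba⟩ := h𝒳.exists_factor_ker hf hf.mem (LinearMap.ker f).subtype
  obtain ⟨a', ha'⟩ := Module.Injective.out (Q := D.QPow n) (LinearMap.ker f).subtype
    (LinearMap.ker f).injective_subtype a
  -- The inclusion of ker f factors through Qⁿ, so id - b ∘ a′ vanishes on ker f and factors through
  -- T. Were the composite T → U → T nonzero, it would make T a summand of U, contrary to T lying
  -- outside the class; hence b ∘ a′ is an endomorphism over T and is invertible.
  obtain ⟨c, hc⟩ := (IsShortExact.ker f hsurj).exists_factor (LinearMap.id - b ∘ₗ a')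
    (LinearMap.ext fun z => by
      have h1 := LinearMap.congr_fun hba z
      simp only [LinearMap.comp_apply, Submodule.subtype_apply] at h1
      have h2 := ha' z
      simp only [Submodule.subtype_apply] at h2
      simp [h1, h2])
  have hs : f ∘ₗ (b ∘ₗ a') = f := by
    rcases LinearMap.bijective_or_eq_zero (f ∘ₗ c) with hbij | h0
    · let s := LinearEquiv.ofBijective _ hbij
      exact absurd (h𝒳.retract c (s.symm.toLinearMap ∘ₗ f)
        (LinearMap.ext fun t => s.symm_apply_apply t) hf.mem) hT
    · have : f ∘ₗ (LinearMap.id - b ∘ₗ a') = 0 := by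
        rw [← hc, ← LinearMap.comp_assoc, h0, LinearMap.zero_comp]
      rw [LinearMap.comp_sub, sub_eq_zero] at this
      exact this.symm
  let s := LinearEquiv.ofBijective _ (hf.bijective _ hs)
  exact ⟨n, a', s.symm.toLinearMap ∘ₗ b, LinearMap.ext fun x => s.symm_apply_apply x⟩

omit h𝒳 hf in
theorem exists_map_ne_zero {T : Type u} [AddCommGroup T] [Module R T] {t : T} (ht : D.e • t ≠ 0) :
    ∃ a : D.QPow 1 →ₗ[R] T, a ≠ 0 :=
  ⟨LinearMap.toSpanSingleton R T t ∘ₗ (leftIdeal D.e).subtype ∘ₗ LinearMap.proj 0, fun h => ht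
    (LinearMap.congr_fun h fun _ => ⟨D.e, D.e, D.idem⟩)⟩

theorem surjective_of_isSimpleModule [IsSimpleModule R T] {t : T} (ht : D.e • t ≠ 0) :
    Function.Surjective f := by
  obtain ⟨a, ha⟩ := exists_map_ne_zero ht
  obtain ⟨l, rfl⟩ := hf.lift _ (h𝒳.qpow 1) a
  exact LinearMap.surjective_of_ne_zero fun h => ha (by rw [h, LinearMap.zero_comp])

end MinimalApprox

omit h𝒳 in
theorem map_qpow_eq_zero {T : Type u} [AddCommGroup T] [Module R T] (hT : ∀ t : T, D.e • t = 0)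
    {n : ℕ} (a : D.QPow n →ₗ[R] T) : a = 0 := by
  refine LinearMap.ext fun y => ?_
  rw [GendoCore.map_eq_sum a]
  refine Finset.sum_eq_zero fun i _ => ?_
  rw [← D.e_smul_gen, map_smul, hT, smul_zero]

omit h𝒳 in
theorem map_to_qpow_eq_zero {T : Type u} [AddCommGroup T] [Module R T]
    (hT : ∀ t : T, D.e • t = 0) {n : ℕ} (a : T →ₗ[R] D.QPow n) : a = 0 := by
  refine LinearMap.ext fun t => funext fun i => D.leftIdeal_ext fun x => ?_
  have : D.e * x * (a t i : R) = (a (D.e • x • t) i : R) := by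
    rw [map_smul, map_smul, mul_assoc]; rfl
  rw [this, hT, map_zero]
  simp

/-- Simple modules which are projective or outside the class do not extend with the class. -/
theorem extZero_of_isSimpleModule [IsArtinianRing R] {T : Type u} [AddCommGroup T] [Module R T]
    [IsSimpleModule R T] (hT : ¬ (𝒳 T ∧ ¬ Module.Projective R T))
    {V : Type u} [AddCommGroup V] [Module R V] (hV : 𝒳 V) :
    ExtZero R V T 1 ∧ ExtZero R T V 1 := by
  obtain ⟨n, W, i, q, h, hW⟩ := h𝒳.syzygy V hV
  by_cases hTX : 𝒳 T
  · have hp : Module.Projective R T := by tauto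
    have := h𝒳.injective T hTX hp
    exact ⟨extZero_of_injective le_rfl, extZero_of_projective le_rfl⟩
  -- If eT = 0 there are no nonzero maps between T and the powers of Q. A syzygy in the class is a
  -- quotient of such a power and a cosyzygy embeds in one, so the relevant maps vanish.
  by_cases he : ∀ t : T, D.e • t = 0
  · constructor
    · refine h.extZero_one_of_extend (extZero_of_projective le_rfl) fun k => ⟨0, ?_⟩
      obtain ⟨n', W', i', q', h', -⟩ := h𝒳.syzygy W hW
      refine LinearMap.ext fun w => ?_
      obtain ⟨y, rfl⟩ := h'.surj w
      exact (LinearMap.congr_fun (map_qpow_eq_zero he (k ∘ₗ q')) y).symm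
    · obtain ⟨n', W', i', q', h', hW'⟩ := h𝒳.cosyzygy V hV
      obtain ⟨m, W₂, i₂, q₂, h₂, -⟩ := h𝒳.cosyzygy W' hW'
      refine h'.extZero_one_of_lift (extZero_of_injective le_rfl) fun k => ⟨0, ?_⟩
      refine LinearMap.ext fun t => h₂.inj ?_
      simpa using (LinearMap.congr_fun (map_to_qpow_eq_zero he (i₂ ∘ₗ k)) t).symm
  push Not at he
  obtain ⟨t, ht⟩ := he
  -- If eT ≠ 0, the approximation U of T is both projective and injective: maps to T extend after
  -- being lifted to U, and maps out of ker f extend to U.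
  obtain ⟨U, f, hf⟩ := h𝒳.exists_minimalApprox T
  have hsurj := h𝒳.surjective_of_isSimpleModule hf ht
  obtain ⟨m, a, b, hab⟩ := h𝒳.exists_retract_of_isSimpleModule hf hTX hsurj
  have : Module.Injective R U := injective_of_retract a b hab
  have : Module.Projective R U := Module.Projective.of_split a b hab
  constructor
  · refine h.extZero_one_of_extend (extZero_of_projective le_rfl) fun k => ?_
    obtain ⟨l, rfl⟩ := hf.lift W hW k
    obtain ⟨l', hl'⟩ := Module.Injective.out (Q := U) i h.inj l
    exact ⟨f ∘ₗ l', LinearMap.ext fun w => congrArg f (hl' w)⟩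
  · exact (IsShortExact.ker f hsurj).extZero_one_of_extend (extZero_of_projective le_rfl)
      fun k => h𝒳.exists_extend_of_ker hf hV k

/-- A simple quotient T of a minimal nonprojective submodule N in the class will do. Otherwise N → T
factors through a projective, T itself or its approximation, and N has a nonzero projective summand;
by minimality the complement is projective too, so N would be projective. -/
theorem exists_isSimpleModule [IsArtinianRing R] {V : Type u} [AddCommGroup V] [Module R V]
    (hV : 𝒳 V) (hVp : ¬ Module.Projective R V) :
    ∃ T : ModuleCat.{u} R, IsSimpleModule R T ∧ 𝒳 T ∧ ¬ Module.Projective R T := by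
  have := h𝒳.finite V hV
  obtain ⟨N, ⟨hN, hNp⟩, hmin⟩ := exists_minimal_submodule
    (fun N : Submodule R V => 𝒳 N ∧ ¬ Module.Projective R N) ⟨⊤,
      h𝒳.congr Submodule.topEquiv hV, fun _ => hVp (Module.Projective.of_equiv
        (Submodule.topEquiv (R := R) (M := V)))⟩
  have hNf := h𝒳.finite N hN
  have : Nontrivial N := by
    by_contra hn
    rw [not_nontrivial_iff_subsingleton] at hn
    exact hNp inferInstance
  obtain ⟨T, π, hT, hπ⟩ := exists_simple_quotient (R := R) (M := N)
  refine ⟨T, hT, ?_⟩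
  by_contra hcon
  obtain ⟨P, q, l, hPf, hPp, hql⟩ : ∃ (P : ModuleCat.{u} R) (q : P →ₗ[R] T) (l : N →ₗ[R] P),
      Module.Finite R P ∧ Module.Projective R P ∧ q ∘ₗ l = π := by
    by_cases hTX : 𝒳 T
    · exact ⟨T, LinearMap.id, π, h𝒳.finite T hTX, by tauto, rfl⟩
    · have he : ∃ t : T, D.e • t ≠ 0 := by
        by_contra he
        push Not at he
        obtain ⟨n, W, i, p, h, -⟩ := h𝒳.syzygy N hN
        have h0 := map_qpow_eq_zero he (π ∘ₗ p)
        have := IsSimpleModule.nontrivial R T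
        obtain ⟨t, ht⟩ := exists_ne (0 : T)
        obtain ⟨x, rfl⟩ := hπ t
        obtain ⟨y, rfl⟩ := h.surj x
        exact ht (LinearMap.congr_fun h0 y)
      obtain ⟨t, ht⟩ := he
      obtain ⟨U, f, hf⟩ := h𝒳.exists_minimalApprox T
      obtain ⟨m, a, b, hab⟩ := h𝒳.exists_retract_of_isSimpleModule hf hTX
        (h𝒳.surjective_of_isSimpleModule hf ht)
      obtain ⟨l, hl⟩ := hf.lift N hN π
      exact ⟨U, f, l, h𝒳.finite U hf.mem, Module.Projective.of_split a b hab, hl⟩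
  obtain ⟨P', q', l', s, hP', hq', hs⟩ := exists_projective_summand hπ q l hql
  have hs' : ∀ x, l' (s x) = x := LinearMap.congr_fun hs
  let r : N →ₗ[R] LinearMap.ker l' := LinearMap.codRestrict _ (LinearMap.id - s ∘ₗ l') fun x => by
    simp [hs']
  have hr : r ∘ₗ (LinearMap.ker l').subtype = LinearMap.id :=
    LinearMap.ext fun x => Subtype.ext (by
      have : l' x = 0 := x.2
      simp [r, this])
  refine hmin ((LinearMap.ker l').map N.subtype)
    ⟨h𝒳.congr (mapSubtypeEquiv N _).symm (h𝒳.retract _ r hr hN), fun hk => hNp ?_⟩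
    (lt_of_le_of_ne (Submodule.map_subtype_le _ _) fun heq => ?_)
  · have : Module.Projective R (LinearMap.ker l') :=
      Module.Projective.of_equiv (mapSubtypeEquiv N _).symm
    refine Module.Projective.of_split (M := LinearMap.ker l' × P') (LinearMap.prod r l')
      (LinearMap.coprod (LinearMap.ker l').subtype s) (LinearMap.ext fun x => ?_)
    simp [r]
  · have hl0 : ∀ x : N, l' x = 0 := fun x => by
      obtain ⟨y, hy, hyx⟩ : (x : V) ∈ (LinearMap.ker l').map N.subtype := heq.symm ▸ x.2
      exact (Subtype.ext hyx : y = x) ▸ hy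
    have := IsSimpleModule.nontrivial R T
    obtain ⟨t, ht⟩ := exists_ne (0 : T)
    obtain ⟨x, rfl⟩ := hπ t
    rw [← hq', LinearMap.comp_apply, hl0, map_zero] at ht
    exact ht rfl

end AdmissibleClass

end GendoSymm

end

/-! ### Filtrations by simple modules and splitting off a block -/

noncomputable section

namespace GendoSymm

section Filtration

variable {R : Type u} [Ring R]

/-- Modules with a finite filtration by simple modules in a class `𝒯`. -/
inductive Filtered (𝒯 : ∀ (V : Type u) [AddCommGroup V] [Module R V], Prop) :
    ∀ (M : Type u) [AddCommGroup M] [Module R M], Prop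
  | of_subsingleton {M : Type u} [AddCommGroup M] [Module R M] (h : Subsingleton M) : Filtered 𝒯 M
  | extension {X Y Z : Type u} [AddCommGroup X] [Module R X] [AddCommGroup Y] [Module R Y]
      [AddCommGroup Z] [Module R Z] {f : X →ₗ[R] Y} {g : Y →ₗ[R] Z} (h : IsShortExact f g)
      (hX : Filtered 𝒯 X) (hZ : IsSimpleModule R Z) (hT : 𝒯 Z) : Filtered 𝒯 Y

variable {𝒯 𝒯' : ∀ (V : Type u) [AddCommGroup V] [Module R V], Prop}

theorem Filtered.of_isSimpleModule {S : Type u} [AddCommGroup S] [Module R S]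
    (hS : IsSimpleModule R S) (hT : 𝒯 S) : Filtered 𝒯 S :=
  .extension (X := PUnit.{u + 1}) (f := 0) (g := LinearMap.id)
    ⟨fun _ _ _ => rfl, fun _ => ⟨fun h => ⟨0, h.symm⟩, fun ⟨_, h⟩ => h.symm⟩,
      Function.surjective_id⟩ (.of_subsingleton inferInstance) hS hT

/-- A map into the middle term which vanishes in the quotient factors through the submodule. -/
theorem IsShortExact.exists_factor_left {X Y Z T : Type u} [AddCommGroup X] [Module R X]
    [AddCommGroup Y] [Module R Y] [AddCommGroup Z] [Module R Z] [AddCommGroup T] [Module R T]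
    {f : X →ₗ[R] Y} {g : Y →ₗ[R] Z} (h : IsShortExact f g) (a : T →ₗ[R] Y) (ha : g ∘ₗ a = 0) :
    ∃ b : T →ₗ[R] X, f ∘ₗ b = a := by
  let s := LinearEquiv.ofInjective f h.inj
  refine ⟨s.symm.toLinearMap ∘ₗ LinearMap.codRestrict (LinearMap.range f) a fun t =>
    (h.exact _).1 (LinearMap.congr_fun ha t), LinearMap.ext fun t => ?_⟩
  exact congrArg Subtype.val (s.apply_symm_apply _)

theorem Filtered.map_eq_zero_of_forall_simple {S : Type u} [AddCommGroup S] [Module R S]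
    (hS : ∀ (Z : Type u) [AddCommGroup Z] [Module R Z], IsSimpleModule R Z → 𝒯 Z →
      ∀ φ : S →ₗ[R] Z, φ = 0)
    {M : Type u} [AddCommGroup M] [Module R M] (hM : Filtered 𝒯 M) (φ : S →ₗ[R] M) : φ = 0 := by
  induction hM with
  | of_subsingleton h => exact LinearMap.ext fun x => Subsingleton.elim _ _
  | extension h hX hZ hT ih =>
    obtain ⟨b, rfl⟩ := h.exists_factor_left φ (hS _ hZ hT _)
    rw [ih b, LinearMap.comp_zero]

/-- Filtered modules with disjoint simple constituents have no nonzero maps between them. -/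
theorem Filtered.map_eq_zero
    (hdisj : ∀ (S Z : Type u) [AddCommGroup S] [Module R S] [AddCommGroup Z] [Module R Z],
      IsSimpleModule R S → 𝒯 S → IsSimpleModule R Z → 𝒯' Z → IsEmpty (S ≃ₗ[R] Z))
    {M N : Type u} [AddCommGroup M] [Module R M] [AddCommGroup N] [Module R N]
    (hM : Filtered 𝒯 M) (hN : Filtered 𝒯' N) (φ : M →ₗ[R] N) : φ = 0 := by
  induction hM with
  | of_subsingleton h =>
    exact LinearMap.ext fun x => by rw [Subsingleton.elim x 0, map_zero, map_zero]
  | extension h hX hZ hT ih =>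
    obtain ⟨b, rfl⟩ := h.exists_factor φ (ih _)
    rw [hN.map_eq_zero_of_forall_simple (fun Z' _ _ hZ' hT' ψ => ?_) b, LinearMap.zero_comp]
    rcases LinearMap.bijective_or_eq_zero ψ with hψ | hψ
    · exact ((hdisj _ Z' hZ hT hZ' hT').false (LinearEquiv.ofBijective ψ hψ)).elim
    · exact hψ

theorem Filtered.extZero {S : Type u} [AddCommGroup S] [Module R S]
    (hS : ∀ (Z : Type u) [AddCommGroup Z] [Module R Z], IsSimpleModule R Z → 𝒯 Z → ExtZero R S Z 1)
    {M : Type u} [AddCommGroup M] [Module R M] (hM : Filtered 𝒯 M) : ExtZero R S M 1 := by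
  induction hM with
  | @of_subsingleton M _ _ h =>
    have : Module.Injective R M := ⟨fun X Y _ _ _ _ f _ g => ⟨0, fun x => Subsingleton.elim _ _⟩⟩
    exact extZero_of_injective le_rfl
  | extension h hX hZ hT ih => exact h.extZero_mid' ih (hS _ hZ hT)

/-- Since Ext¹(S, N₂) = 0, the projection to N₂ extends to M. So N₂ remains a summand, with
complement an extension of S by N₁. -/
theorem Filtered.exists_prod_of_extension {N N₁ N₂ M S : Type u} [AddCommGroup N] [Module R N]
    [AddCommGroup N₁] [Module R N₁] [AddCommGroup N₂] [Module R N₂] [AddCommGroup M] [Module R M]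
    [AddCommGroup S] [Module R S] {f : N →ₗ[R] M} {g : M →ₗ[R] S} (h : IsShortExact f g)
    (s : N ≃ₗ[R] N₁ × N₂) (hN₁ : Filtered 𝒯 N₁) (hS : IsSimpleModule R S) (hT : 𝒯 S)
    (hE : ExtZero R S N₂ 1) :
    ∃ M₁ : ModuleCat.{u} R, Filtered 𝒯 M₁ ∧ Nonempty (M ≃ₗ[R] M₁ × N₂) := by
  obtain ⟨p, hp⟩ := h.exists_extend hE (LinearMap.snd R N₁ N₂ ∘ₗ s.toLinearMap)
  have hp' : ∀ x, p (f x) = (s x).2 := LinearMap.congr_fun hp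
  let f₁ : N₁ →ₗ[R] LinearMap.ker p := LinearMap.codRestrict _
    (f ∘ₗ s.symm.toLinearMap ∘ₗ LinearMap.inl R N₁ N₂) fun x => by simp [hp']
  let j : N₂ →ₗ[R] M := f ∘ₗ s.symm.toLinearMap ∘ₗ LinearMap.inr R N₁ N₂
  have hj : ∀ x, p (j x) = x := fun x => by simp [j, hp']
  have hgj : ∀ x, g (j x) = 0 := fun x => h.exact.apply_apply_eq_zero _
  refine ⟨ModuleCat.of R (LinearMap.ker p), .extension (f := f₁)
    (g := g ∘ₗ (LinearMap.ker p).subtype) ⟨?_, fun y => ⟨fun hy => ?_, ?_⟩, fun z => ?_⟩ hN₁ hS hT,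
    ⟨LinearEquiv.ofLinearMap
      (LinearMap.prod (LinearMap.codRestrict _ (LinearMap.id - j ∘ₗ p) fun x => by simp [hj]) p)
      (LinearMap.coprod (LinearMap.ker p).subtype j) ?_ ?_⟩⟩
  · intro x x' hx
    have h1 : s.symm (x, 0) = s.symm (x', 0) := h.inj (congrArg Subtype.val hx)
    exact congrArg Prod.fst (s.symm.injective h1)
  · obtain ⟨x, hx⟩ := (h.exact y).1 hy
    refine ⟨(s x).1, Subtype.ext ?_⟩
    have h2 : (s x).2 = 0 := by rw [← hp', hx]; exact y.2
    change f (s.symm ((s x).1, 0)) = y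
    rw [← h2, Prod.mk.eta, s.symm_apply_apply, hx]
  · rintro ⟨x, rfl⟩
    exact h.exact.apply_apply_eq_zero _
  · obtain ⟨y, rfl⟩ := h.surj z
    exact ⟨⟨y - j (p y), by simp [hj]⟩, by simp [hgj]⟩
  · ext x
    · have : p x = 0 := x.2
      simp [this]
    · have : p x = 0 := x.2
      simp [this]
    · simp [hj]
    · simp [hj]
  · ext x
    simp

/-- A module of finite length splits along a class of simple modules which does not extend with
its complement. -/
theorem exists_prod_filtered
    (hE : ∀ (S Z : Type u) [AddCommGroup S] [Module R S] [AddCommGroup Z] [Module R Z],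
      IsSimpleModule R S → 𝒯 S → IsSimpleModule R Z → ¬ 𝒯 Z → ExtZero R S Z 1 ∧ ExtZero R Z S 1)
    {M : Type u} [AddCommGroup M] [Module R M] (hM : IsFiniteLength R M) :
    ∃ M₁ M₂ : ModuleCat.{u} R, Filtered 𝒯 M₁ ∧ Filtered (R := R) (fun V _ _ => ¬ 𝒯 V) M₂ ∧
      Nonempty (M ≃ₗ[R] M₁ × M₂) := by
  induction hM with
  | @of_subsingleton M _ _ h =>
    exact ⟨ModuleCat.of R M, ModuleCat.of R M, .of_subsingleton h, .of_subsingleton h,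
      ⟨LinearEquiv.ofLinearMap 0 0 (LinearMap.ext fun x => Subsingleton.elim _ _)
        (LinearMap.ext fun x => Subsingleton.elim _ _)⟩⟩
  | @of_simple_quotient M _ _ N hS _ ih =>
    obtain ⟨N₁, N₂, h₁, h₂, ⟨s⟩⟩ := ih
    by_cases hT : 𝒯 (M ⧸ N)
    · obtain ⟨M₁, hM₁, hs⟩ := Filtered.exists_prod_of_extension (IsShortExact.mkQ N) s h₁ hS hT
        (h₂.extZero fun Z _ _ hZ hZ' => (hE _ Z hS hT hZ hZ').1)
      exact ⟨M₁, N₂, hM₁, h₂, hs⟩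
    · obtain ⟨M₂, hM₂, ⟨t⟩⟩ := Filtered.exists_prod_of_extension
        (𝒯 := fun V _ _ => ¬ 𝒯 V) (IsShortExact.mkQ N)
        (s ≪≫ₗ LinearEquiv.prodComm R N₁ N₂) h₂ hS hT
        (h₁.extZero fun Z _ _ hZ hZ' => (hE Z _ hZ hZ' hS hT).2)
      exact ⟨N₁, M₂, h₁, hM₂, ⟨t ≪≫ₗ LinearEquiv.prodComm R M₂ N₁⟩⟩

/-- A decomposition of the regular module without maps between the summands is trivial if the
ring is connected. -/
theorem subsingleton_or_subsingleton_of_connected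
    (hconn : ∀ c : R, IsIdempotentElem c → (∀ a, c * a = a * c) → c = 0 ∨ c = 1)
    {M₁ M₂ : Type u} [AddCommGroup M₁] [Module R M₁] [AddCommGroup M₂] [Module R M₂]
    (s : R ≃ₗ[R] M₁ × M₂) (h₁₂ : ∀ φ : M₁ →ₗ[R] M₂, φ = 0) (h₂₁ : ∀ φ : M₂ →ₗ[R] M₁, φ = 0) :
    Subsingleton M₁ ∨ Subsingleton M₂ := by
  let φ : R →ₗ[R] R := s.symm.toLinearMap ∘ₗ LinearMap.inl R M₁ M₂ ∘ₗ LinearMap.fst R M₁ M₂ ∘ₗ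
    s.toLinearMap
  have hφ : ∀ x, φ x = x * φ 1 := fun x => by rw [← smul_eq_mul, ← map_smul, smul_eq_mul, mul_one]
  have hsφ : ∀ x, s (φ x) = ((s x).1, 0) := fun x => s.apply_symm_apply _
  have hidem : φ 1 * φ 1 = φ 1 := by
    rw [← hφ]
    apply s.injective
    rw [hsφ, hsφ]
  have hcentral : ∀ a, φ 1 * a = a * φ 1 := by
    intro a
    let ψ : R →ₗ[R] R := LinearMap.toSpanSingleton R R a
    have hψ : ∀ x, ψ x = x * a := fun _ => rfl
    rw [← hψ, ← hφ, ← one_mul a, ← hψ]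
    apply s.injective
    -- Right multiplication by a is an endomorphism of the regular module. It preserves both
    -- summands, hence commutes with the projection, which is multiplication by φ(1).
    have key1 : ∀ x : M₁, (s (ψ (s.symm (x, 0)))).2 = 0 := fun x => LinearMap.congr_fun
      (h₁₂ (LinearMap.snd R M₁ M₂ ∘ₗ s.toLinearMap ∘ₗ ψ ∘ₗ s.symm.toLinearMap ∘ₗ
        LinearMap.inl R M₁ M₂)) x
    have key2 : ∀ x : M₂, (s (ψ (s.symm (0, x)))).1 = 0 := fun x => LinearMap.congr_fun
      (h₂₁ (LinearMap.fst R M₁ M₂ ∘ₗ s.toLinearMap ∘ₗ ψ ∘ₗ s.symm.toLinearMap ∘ₗ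
        LinearMap.inr R M₁ M₂)) x
    have hsplit : (1 : R) = s.symm ((s 1).1, 0) + s.symm (0, (s 1).2) := by
      rw [← map_add]
      simp
    rw [hsφ]
    refine Prod.ext ?_ (key1 _)
    conv_rhs => rw [hsplit, map_add, map_add, Prod.fst_add, key2, add_zero]
    rfl
  rcases hconn (φ 1) hidem hcentral with h0 | h1
  · refine .inl ⟨fun x y => ?_⟩
    have key : ∀ x : M₁, x = 0 := fun x => by
      have := hsφ (s.symm (x, 0))
      rw [hφ, h0, mul_zero, map_zero, s.apply_symm_apply] at this
      exact (congrArg Prod.fst this).symm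
    rw [key x, key y]
  · refine .inr ⟨fun x y => ?_⟩
    have key : ∀ x : M₂, x = 0 := fun x => by
      have := hsφ (s.symm (0, x))
      rw [hφ, h1, mul_one, s.apply_symm_apply] at this
      exact congrArg Prod.snd this
    rw [key x, key y]

end Filtration

variable {K : Type u} [Field K] {R : Type u} [Ring R] [Algebra K R]

theorem AdmissibleClass.of_filtered {D : GendoCore K R}
    {𝒳 𝒯 : ∀ (V : Type u) [AddCommGroup V] [Module R V], Prop} (h𝒳 : AdmissibleClass D 𝒳)
    (h𝒯 : ∀ (V : Type u) [AddCommGroup V] [Module R V], 𝒯 V → 𝒳 V)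
    {M : Type u} [AddCommGroup M] [Module R M] (hM : Filtered 𝒯 M) : 𝒳 M := by
  induction hM with
  | of_subsingleton h =>
    exact h𝒳.retract (W := D.QPow 0) 0 0 (LinearMap.ext fun x => Subsingleton.elim _ _)
      (h𝒳.qpow 0)
  | extension h hX hZ hT ih => exact h𝒳.extension h ih (h𝒯 _ hT)

/-- Over a connected algebra which is not selfinjective, an admissible class consists of injective
modules. -/
theorem AdmissibleClass.injective_of_mem [FiniteDimensional K R] {D : GendoCore K R}
    {𝒳 : ∀ (V : Type u) [AddCommGroup V] [Module R V], Prop} (h𝒳 : AdmissibleClass D 𝒳)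
    (hconn : ∀ c : R, IsIdempotentElem c → (∀ a, c * a = a * c) → c = 0 ∨ c = 1)
    (hself : ¬ Module.Injective R R) (V : Type u) [AddCommGroup V] [Module R V] (hV : 𝒳 V) :
    Module.Injective R V := by
  have := isArtinianRing_of_finiteDimensional K R
  have := isNoetherianRing_of_finiteDimensional K R
  refine h𝒳.injective V hV ?_
  by_contra hVp
  obtain ⟨S, hS, hSX, hSp⟩ := h𝒳.exists_isSimpleModule hV hVp
  let 𝒯 : ∀ (V : Type u) [AddCommGroup V] [Module R V], Prop :=
    fun V _ _ => 𝒳 V ∧ ¬ Module.Projective R V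
  have hiso : ∀ (S Z : Type u) [AddCommGroup S] [Module R S] [AddCommGroup Z] [Module R Z],
      (S ≃ₗ[R] Z) → 𝒯 S → 𝒯 Z := fun S Z _ _ _ _ a h =>
    ⟨h𝒳.congr a.symm h.1, fun _ => h.2 (Module.Projective.of_equiv a.symm)⟩
  have h₁₂ : ∀ {M₁ M₂ : Type u} [AddCommGroup M₁] [Module R M₁] [AddCommGroup M₂] [Module R M₂],
      Filtered 𝒯 M₁ → Filtered (R := R) (fun V _ _ => ¬ 𝒯 V) M₂ → ∀ φ : M₁ →ₗ[R] M₂, φ = 0 :=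
    fun h₁ h₂ φ => h₁.map_eq_zero (fun S Z _ _ _ _ _ h _ h' => ⟨fun a => h' (hiso S Z a h)⟩) h₂ φ
  have h₂₁ : ∀ {M₁ M₂ : Type u} [AddCommGroup M₁] [Module R M₁] [AddCommGroup M₂] [Module R M₂],
      Filtered 𝒯 M₁ → Filtered (R := R) (fun V _ _ => ¬ 𝒯 V) M₂ → ∀ φ : M₂ →ₗ[R] M₁, φ = 0 :=
    fun h₁ h₂ φ => h₂.map_eq_zero (fun S Z _ _ _ _ _ h _ h' => ⟨fun a => h (hiso Z S a.symm h')⟩)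
      h₁ φ
  obtain ⟨M₁, M₂, h₁, h₂, ⟨s⟩⟩ := exists_prod_filtered (𝒯 := 𝒯) (M := R)
    (fun S Z _ _ _ _ _ hST _ hZT => (h𝒳.extZero_of_isSimpleModule hZT hST.1))
    (isFiniteLength_iff_isNoetherian_isArtinian.2 ⟨inferInstance, inferInstance⟩)
  -- If M₁ = 0, the regular module has no constituent in 𝒯, so it cannot map onto S. If M₂ = 0, the
  -- regular module is filtered by 𝒯, so it lies in the class and is selfinjective.
  rcases subsingleton_or_subsingleton_of_connected hconn s (h₁₂ h₁ h₂) (h₂₁ h₁ h₂) with h0 | h0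
  · have := IsSimpleModule.nontrivial R S
    obtain ⟨x, hx⟩ := exists_ne (0 : S)
    have hzero := h₂₁ (Filtered.of_isSimpleModule hS ⟨hSX, hSp⟩) h₂
      (LinearMap.toSpanSingleton R S x ∘ₗ s.symm.toLinearMap ∘ₗ LinearMap.inr R M₁ M₂)
    refine hx ?_
    have h1 : s.symm (0, (s 1).2) = 1 := by
      rw [LinearEquiv.symm_apply_eq]
      exact Prod.ext (Subsingleton.elim _ _) rfl
    have := LinearMap.congr_fun hzero (s 1).2
    simpa [h1] using this
  · refine hself (h𝒳.injective R (h𝒳.retract (LinearMap.fst R M₁ M₂ ∘ₗ s.toLinearMap)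
      (s.symm.toLinearMap ∘ₗ LinearMap.inl R M₁ M₂) (LinearMap.ext fun x => ?_)
      (h𝒳.of_filtered (fun _ _ _ h => h.1) h₁)) inferInstance)
    refine (s.symm_apply_eq).2 (Prod.ext rfl (Subsingleton.elim _ _))

end GendoSymm

end

/-! ### Closure properties of infinite dominant dimension, and finite approximation -/

noncomputable section

namespace GendoSymm

/-- Finitely generated modules of infinite dominant dimension. -/
def IsDomInfinite (R : Type u) [Ring R] (V : Type u) [AddCommGroup V] [Module R V] : Prop :=
  Module.Finite R V ∧ domDim R V = ⊤

section General

variable {K : Type u} [Field K] {R : Type u} [Ring R] [Algebra K R] [FiniteDimensional K R]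
  (D : GendoCore K R) {E : Type u} [AddCommGroup E] [Module R E] (𝒱 : RegularDual K R E)
  {V : Type u} [AddCommGroup V] [Module R V]

theorem isDomInfinite_iff : IsDomInfinite R V ↔
    Module.Finite R V ∧ D.EtaBij 𝒱 V ∧ ExtVanishes R E V :=
  and_congr_right fun _ => GendoCore.domDim_eq_top_iff V

include D 𝒱

theorem IsDomInfinite.retract {W : Type u} [AddCommGroup W] [Module R W]
    (a : V →ₗ[R] W) (b : W →ₗ[R] V) (hab : b ∘ₗ a = LinearMap.id) (hW : IsDomInfinite R W) :
    IsDomInfinite R V := by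
  obtain ⟨h1, h2, h3⟩ := (isDomInfinite_iff D 𝒱).1 hW
  exact (isDomInfinite_iff D 𝒱).2
    ⟨Module.Finite.of_surjective b (LinearMap.surjective_of_comp_eq_id a b hab),
      h2.retract a b hab, fun i hi => extZero_of_retract_right a b hab (h3 i hi)⟩

theorem IsDomInfinite.extension {X Y Z : Type u} [AddCommGroup X] [Module R X]
    [AddCommGroup Y] [Module R Y] [AddCommGroup Z] [Module R Z] {f : X →ₗ[R] Y} {g : Y →ₗ[R] Z}
    (h : IsShortExact f g) (hX : IsDomInfinite R X) (hZ : IsDomInfinite R Z) :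
    IsDomInfinite R Y := by
  have := isNoetherianRing_of_finiteDimensional K R
  obtain ⟨_, hX2, hX3⟩ := (isDomInfinite_iff D 𝒱).1 hX
  obtain ⟨_, hZ2, hZ3⟩ := (isDomInfinite_iff D 𝒱).1 hZ
  have := isNoetherian_of_range_eq_ker f g h.exact.linearMap_ker_eq.symm
  exact (isDomInfinite_iff D 𝒱).2 ⟨inferInstance, GendoCore.EtaBij.extension h hX2 hZ2,
    fun i hi => h.extZero_mid' (hX3 i hi) (hZ3 i hi)⟩

theorem isDomInfinite_qpow (n : ℕ) : IsDomInfinite R (D.QPow n) :=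
  (isDomInfinite_iff D 𝒱).2 ⟨inferInstance, D.etaBij_of_projective 𝒱,
    fun _ hi => extZero_of_injective hi⟩

theorem IsDomInfinite.of_coker {n : ℕ} {W : Type u} [AddCommGroup W] [Module R W]
    {f : V →ₗ[R] D.QPow n} {g : D.QPow n →ₗ[R] W} (h : IsShortExact f g)
    (hV : IsDomInfinite R V) : IsDomInfinite R W := by
  obtain ⟨_, h2, h3⟩ := (isDomInfinite_iff D 𝒱).1 hV
  exact (isDomInfinite_iff D 𝒱).2 ⟨Module.Finite.of_surjective g h.surj,
    GendoCore.EtaBij.coker h h2 (D.etaBij_of_projective 𝒱) (h3 1 le_rfl),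
    fun i hi => h.extZero_right' (extZero_of_injective hi) (h3 (i + 1) (by omega))⟩

theorem IsDomInfinite.exists_embedding (hV : IsDomInfinite R V) :
    ∃ (n : ℕ) (f : V →ₗ[R] D.QPow n), Function.Injective f := by
  obtain ⟨_, h2, -⟩ := (isDomInfinite_iff D 𝒱).1 hV
  exact h2.etaInj.exists_embedding

theorem IsDomInfinite.exists_cosyzygy (hV : IsDomInfinite R V) :
    ∃ (n : ℕ) (W : ModuleCat.{u} R) (f : V →ₗ[R] D.QPow n) (g : D.QPow n →ₗ[R] W),
      IsShortExact f g ∧ IsDomInfinite R W := by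
  obtain ⟨n, f, hf⟩ := hV.exists_embedding D 𝒱
  have h := IsShortExact.coker f hf
  exact ⟨n, ModuleCat.of R _, f, _, h, hV.of_coker D 𝒱 h⟩

omit D 𝒱 in
theorem extZero_pi {X N : Type u} [AddCommGroup X] [Module R X] [AddCommGroup N] [Module R N]
    {i : ℕ} (hi : 1 ≤ i) (h : ExtZero R X N i) (n : ℕ) : ExtZero R X (Fin n → N) i := by
  induction n with
  | zero =>
    have : Module.Injective R (Fin 0 → N) :=
      ⟨fun X Y _ _ _ _ f _ g => ⟨0, fun x => Subsingleton.elim _ _⟩⟩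
    exact extZero_of_injective hi
  | succ n ih =>
    have hs : IsShortExact (LinearMap.single R (fun _ : Fin (n + 1) => N) 0)
        (LinearMap.funLeft R N Fin.succ) := by
      refine ⟨Pi.single_injective (M := fun _ : Fin (n + 1) => N) 0, fun x => ⟨fun hx => ⟨x 0, ?_⟩, ?_⟩, ?_⟩
      · funext j
        refine Fin.cases ?_ (fun k => ?_) j
        · simp
        · have : x k.succ = 0 := congrFun hx k
          simp [this]
      · rintro ⟨y, rfl⟩
        funext j
        simp [LinearMap.funLeft_apply]
      · exact LinearMap.funLeft_surjective_of_injective R N _ (Fin.succ_injective n)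
    exact hs.extZero_mid' h ih

/-- A projective module of infinite dominant dimension is injective, if the regular module has
finite injective dimension. -/
theorem IsDomInfinite.injective_of_projective {g : ℕ}
    (hR : ∀ (X : Type u) [AddCommGroup X] [Module R X] (i : ℕ), g < i → ExtZero R X R i)
    (hV : IsDomInfinite R V) [Module.Projective R V] : Module.Injective R V := by
  have := hV.1
  obtain ⟨n, p, s, -, -, hps⟩ := Module.Finite.exists_comp_eq_id_of_projective R V
  have hext : ∀ (X : Type u) [AddCommGroup X] [Module R X], ExtZero R X V (g + 1) :=
    fun X _ _ => extZero_of_retract_right s p hps (extZero_pi (by omega) (hR X _ (by omega)) n)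
  -- Embedding X in a power of Re replaces Ext^{j+1}(X, V) by Ext^{j+2} of the cosyzygy, which has
  -- infinite dominant dimension again. Thus vanishing in degree g + 1 descends to degree one, and
  -- the embedding of V in a power of Re splits.
  have key : ∀ j, (∀ (X : Type u) [AddCommGroup X] [Module R X], IsDomInfinite R X →
      ExtZero R X V (j + 1)) → ∀ (X : Type u) [AddCommGroup X] [Module R X], IsDomInfinite R X →
      ExtZero R X V 1 := by
    intro j
    induction j with
    | zero => exact fun h => h
    | succ j ih =>
      refine fun h => ih fun X _ _ hX => ?_
      obtain ⟨m, W, f, q, hs, hW⟩ := hX.exists_cosyzygy D 𝒱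
      exact hs.extZero_left (extZero_of_projective (by omega)) (h W hW)
  obtain ⟨m, W, f, q, hs, hW⟩ := hV.exists_cosyzygy D 𝒱
  obtain ⟨r, hr⟩ := hs.exists_retraction (key g (fun X _ _ _ => hext X) W hW)
  exact injective_of_retract f r hr

end General

section Approximation

variable {R : Type u} [Ring R]

/-- A class of finitely generated modules closed under summands and extensions. -/
structure IsExtensionClosed (𝒳 : ∀ (V : Type u) [AddCommGroup V] [Module R V], Prop) : Prop where
  finite : ∀ (V : Type u) [AddCommGroup V] [Module R V], 𝒳 V → Module.Finite R V
  zero : 𝒳 PUnit.{u + 1}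
  retract : ∀ {V W : Type u} [AddCommGroup V] [Module R V] [AddCommGroup W] [Module R W]
    (a : V →ₗ[R] W) (b : W →ₗ[R] V), b ∘ₗ a = LinearMap.id → 𝒳 W → 𝒳 V
  extension : ∀ {X Y Z : Type u} [AddCommGroup X] [Module R X] [AddCommGroup Y] [Module R Y]
    [AddCommGroup Z] [Module R Z] {f : X →ₗ[R] Y} {g : Y →ₗ[R] Z},
    IsShortExact f g → 𝒳 X → 𝒳 Z → 𝒳 Y

/-- All maps from `V` to the target of `f` factor through `f`. -/
def Lifts {U T : Type u} [AddCommGroup U] [Module R U] [AddCommGroup T] [Module R T]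
    (f : U →ₗ[R] T) (V : Type u) [AddCommGroup V] [Module R V] : Prop :=
  ∀ φ : V →ₗ[R] T, ∃ l : V →ₗ[R] U, f ∘ₗ l = φ

theorem isShortExact_prod (X Y : Type u) [AddCommGroup X] [Module R X] [AddCommGroup Y]
    [Module R Y] : IsShortExact (LinearMap.inl R X Y) (LinearMap.snd R X Y) :=
  ⟨LinearMap.inl_injective, .inl_snd, LinearMap.snd_surjective⟩

/-- Hom(G, T) is finite dimensional, so a direct sum of copies of G, one for each element of a
finite spanning set, captures all maps. -/
theorem IsExtensionClosed.exists_lifts_single (K : Type u) [Field K] [Algebra K R]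
    [FiniteDimensional K R] {𝒳 : ∀ (V : Type u) [AddCommGroup V] [Module R V], Prop}
    (h𝒳 : IsExtensionClosed 𝒳) (T : Type u) [AddCommGroup T] [Module R T]
    [Module.Finite R T] (G : Type u) [AddCommGroup G] [Module R G] (hG : 𝒳 G) :
    ∃ (U : ModuleCat.{u} R) (f : U →ₗ[R] T), 𝒳 U ∧ Lifts f G := by
  let := scalarModule K R T
  have := scalarModule_isScalarTower K R T
  let := scalarModule K R G
  have := scalarModule_isScalarTower K R G
  have := h𝒳.finite G hG
  have : Module.Finite K G := Module.Finite.trans R G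
  have : Module.Finite K T := Module.Finite.trans R T
  have : Module.Finite K (G →ₗ[R] T) := Module.Finite.of_injective
    (LinearMap.restrictScalarsₗ K R G T K) (LinearMap.restrictScalars_injective K)
  have key : ∀ N : Submodule K (G →ₗ[R] T), N.FG →
      ∃ (U : ModuleCat.{u} R) (f : U →ₗ[R] T), 𝒳 U ∧ ∀ φ ∈ N, ∃ l : G →ₗ[R] U, f ∘ₗ l = φ := by
    intro N hN
    induction N, hN using Submodule.fg_induction with
    | singleton φ =>
      refine ⟨ModuleCat.of R G, φ, hG, fun ψ hψ => ?_⟩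
      obtain ⟨c, rfl⟩ := Submodule.mem_span_singleton.1 hψ
      exact ⟨c • LinearMap.id, LinearMap.ext fun x => by simp⟩
    | sup _ _ _ _ h₁ h₂ =>
      obtain ⟨U₁, f₁, hU₁, hf₁⟩ := h₁
      obtain ⟨U₂, f₂, hU₂, hf₂⟩ := h₂
      refine ⟨ModuleCat.of R (U₁ × U₂), LinearMap.coprod f₁ f₂,
        h𝒳.extension (isShortExact_prod U₁ U₂) hU₁ hU₂, fun φ hφ => ?_⟩
      obtain ⟨φ₁, hφ₁, φ₂, hφ₂, rfl⟩ := Submodule.mem_sup.1 hφ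
      obtain ⟨l₁, rfl⟩ := hf₁ φ₁ hφ₁
      obtain ⟨l₂, rfl⟩ := hf₂ φ₂ hφ₂
      exact ⟨LinearMap.prod l₁ l₂, LinearMap.coprod_comp_prod _ _ _ _⟩
  obtain ⟨U, f, hU, hf⟩ := key ⊤ Module.Finite.fg_top
  exact ⟨U, f, hU, fun φ => hf φ Submodule.mem_top⟩

theorem IsExtensionClosed.exists_lifts_finset (K : Type u) [Field K] [Algebra K R]
    [FiniteDimensional K R] {𝒳 : ∀ (V : Type u) [AddCommGroup V] [Module R V], Prop}
    (h𝒳 : IsExtensionClosed 𝒳) (T : Type u) [AddCommGroup T] [Module R T]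
    [Module.Finite R T] {ι : Type} (G : ι → ModuleCat.{u} R) (s : Finset ι) :
    ∃ (U : ModuleCat.{u} R) (f : U →ₗ[R] T), 𝒳 U ∧ ∀ i ∈ s, 𝒳 (G i) → Lifts f (G i) := by
  classical
  induction s using Finset.induction_on with
  | empty => exact ⟨ModuleCat.of R PUnit, 0, h𝒳.zero, by simp⟩
  | insert i s _ ih =>
    obtain ⟨U₁, f₁, hU₁, hf₁⟩ := ih
    by_cases hi : 𝒳 (G i)
    · obtain ⟨U₂, f₂, hU₂, hf₂⟩ := h𝒳.exists_lifts_single K T (G i) hi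
      refine ⟨ModuleCat.of R (U₁ × U₂), LinearMap.coprod f₁ f₂,
        h𝒳.extension (isShortExact_prod U₁ U₂) hU₁ hU₂, fun j hj hGj φ => ?_⟩
      rcases Finset.mem_insert.1 hj with rfl | hj
      · obtain ⟨l, rfl⟩ := hf₂ φ
        exact ⟨LinearMap.inr R U₁ U₂ ∘ₗ l, by rw [← LinearMap.comp_assoc, LinearMap.coprod_inr]⟩
      · obtain ⟨l, rfl⟩ := hf₁ j hj hGj φ
        exact ⟨LinearMap.inl R U₁ U₂ ∘ₗ l, by rw [← LinearMap.comp_assoc, LinearMap.coprod_inl]⟩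
    · refine ⟨U₁, f₁, hU₁, fun j hj hGj => ?_⟩
      rcases Finset.mem_insert.1 hj with rfl | hj
      · exact absurd hGj hi
      · exact hf₁ j hj hGj

/-- A class closed under summands and extensions with finitely many indecomposables up to
isomorphism is contravariantly finite. -/
theorem IsExtensionClosed.exists_approx_of_finite (K : Type u) [Field K] [Algebra K R]
    [FiniteDimensional K R] {𝒳 : ∀ (V : Type u) [AddCommGroup V] [Module R V], Prop}
    (h𝒳 : IsExtensionClosed 𝒳) {n : ℕ} (G : Fin n → ModuleCat.{u} R)
    (hG : ∀ M : ModuleCat.{u} R, 𝒳 M → Indecomposable M → ∃ i, Nonempty (M ≅ G i))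
    (T : Type u) [AddCommGroup T] [Module R T] [Module.Finite R T] :
    ∃ (U : ModuleCat.{u} R) (f : U →ₗ[R] T), 𝒳 U ∧
      ∀ (V : Type u) [AddCommGroup V] [Module R V], 𝒳 V → Lifts f V := by
  have := isNoetherianRing_of_finiteDimensional K R
  have := isArtinianRing_of_finiteDimensional K R
  obtain ⟨U, f, hU, hf⟩ := h𝒳.exists_lifts_finset K T G Finset.univ
  have key : ∀ (m : ℕ) (V : ModuleCat.{u} R), 𝒳 V → Module.length R V ≤ m → Lifts f V := by
    intro m
    induction m with
    | zero =>
      intro V _ hm φ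
      have : Subsingleton V := Module.length_eq_zero_iff.1 (le_antisymm hm bot_le)
      exact ⟨0, LinearMap.ext fun x => by rw [Subsingleton.elim x 0, map_zero, map_zero]⟩
    | succ m ih =>
      intro V hV hm φ
      by_cases hz : Subsingleton V
      · exact ⟨0, LinearMap.ext fun x => by rw [Subsingleton.elim x 0, map_zero, map_zero]⟩
      by_cases hind : Indecomposable V
      · obtain ⟨i, ⟨a⟩⟩ := hG V hV hind
        let s := a.toLinearEquiv
        obtain ⟨l, hl⟩ := hf i (Finset.mem_univ i)
          (h𝒳.retract s.symm.toLinearMap s.toLinearMap (by ext; simp) hV) (φ ∘ₗ s.symm.toLinearMap)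
        refine ⟨l ∘ₗ s.toLinearMap, ?_⟩
        rw [← LinearMap.comp_assoc, hl]
        ext; simp
      -- Both summands are nonzero, so each has strictly smaller length; the lifts on them combine
      -- to a lift on V.
      · obtain ⟨Y, Z, ⟨a⟩, hY, hZ⟩ : ∃ Y Z : ModuleCat.{u} R, Nonempty (V ≅ Y ⊞ Z) ∧
            ¬ Limits.IsZero Y ∧ ¬ Limits.IsZero Z := by
          by_contra hcon
          refine hind ⟨fun h => hz (ModuleCat.isZero_iff_subsingleton.1 h), fun Y Z a => ?_⟩
          by_contra hYZ
          rw [not_or] at hYZ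
          exact hcon ⟨Y, Z, ⟨a⟩, hYZ⟩
        rw [ModuleCat.isZero_iff_subsingleton, not_subsingleton_iff_nontrivial] at hY hZ
        let s : V ≃ₗ[R] Y × Z := (a ≪≫ ModuleCat.biprodIsoProd Y Z).toLinearEquiv
        have hlen : Module.length R Y + Module.length R Z ≤ (m : ℕ∞) + 1 := by
          rw [← Module.length_prod, ← s.length_eq]
          exact hm
        have hY1 : 1 ≤ Module.length R Y := Order.one_le_iff_pos.2 Module.length_pos
        have hZ1 : 1 ≤ Module.length R Z := Order.one_le_iff_pos.2 Module.length_pos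
        have h1 : Module.length R Y ≤ m := by
          refine (ENat.add_le_add_iff_right ENat.one_ne_top).1 ((add_le_add le_rfl hZ1).trans hlen)
        have h2 : Module.length R Z ≤ m := by
          refine (ENat.add_le_add_iff_right ENat.one_ne_top).1
            ((add_le_add le_rfl hY1).trans ((add_comm _ _).trans_le hlen))
        obtain ⟨l₁, hl₁⟩ := ih Y (h𝒳.retract (s.symm.toLinearMap ∘ₗ LinearMap.inl R Y Z)
          (LinearMap.fst R Y Z ∘ₗ s.toLinearMap) (by ext; simp) hV) h1
          (φ ∘ₗ s.symm.toLinearMap ∘ₗ LinearMap.inl R Y Z)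
        obtain ⟨l₂, hl₂⟩ := ih Z (h𝒳.retract (s.symm.toLinearMap ∘ₗ LinearMap.inr R Y Z)
          (LinearMap.snd R Y Z ∘ₗ s.toLinearMap) (by ext; simp) hV) h2
          (φ ∘ₗ s.symm.toLinearMap ∘ₗ LinearMap.inr R Y Z)
        refine ⟨LinearMap.coprod l₁ l₂ ∘ₗ s.toLinearMap, ?_⟩
        rw [← LinearMap.comp_assoc, LinearMap.comp_coprod, hl₁, hl₂]
        refine LinearMap.ext fun x => ?_
        simp only [LinearMap.comp_apply, LinearMap.coprod_apply, ← map_add]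
        refine congrArg φ ((s.symm_apply_eq).2 ?_)
        simp
  refine ⟨U, f, hU, fun V _ _ hV => ?_⟩
  have := h𝒳.finite V hV
  obtain ⟨m, hm⟩ := ENat.ne_top_iff_exists.1 (Module.length_ne_top (R := R) (M := V))
  exact key m (ModuleCat.of R V) hV hm.symm.le

end Approximation

end GendoSymm

end

/-! ### The second claim: injectivity and the bound on the finitistic dominant dimension -/

noncomputable section

namespace GendoSymm

variable {K : Type u} [Field K] {A : Type u} [Ring A] [Algebra K A] [FiniteDimensional K A]

section Pairing

variable (D : GendoCore K A) (n : ℕ)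

/-- The pairing of `(eA)ⁿ` and `(Ae)ⁿ` given by the trace. -/
def GendoCore.qpowForm : D.op.QPow n →ₗ[K] D.QPow n →ₗ[K] K :=
  LinearMap.mk₂ K (fun x y => ∑ i, D.tr ((x i : Aᵐᵒᵖ).unop * y i))
    (fun x x' y => by simp [add_mul, Finset.sum_add_distrib])
    (fun c x y => by simp [Finset.mul_sum])
    (fun x y y' => by simp [mul_add, Finset.sum_add_distrib])
    (fun c x y => by simp [Finset.mul_sum])

omit [FiniteDimensional K A] in
theorem GendoCore.qpowForm_apply (x : D.op.QPow n) (y : D.QPow n) :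
    D.qpowForm n x y = ∑ i, D.tr ((x i : Aᵐᵒᵖ).unop * y i) := rfl

omit [FiniteDimensional K A] in
theorem GendoCore.qpowForm_single (x : D.op.QPow n) (i : Fin n) (y : leftIdeal D.e) :
    D.qpowForm n x (Pi.single i y) = D.tr ((x i : Aᵐᵒᵖ).unop * y) := by
  rw [qpowForm_apply, Finset.sum_eq_single i]
  · simp
  · intro j _ hj
    simp [Pi.single_eq_of_ne hj]
  · simp

omit [FiniteDimensional K A] in
theorem GendoCore.unop_coe_eq (x : leftIdeal D.op.e) :
    (x : Aᵐᵒᵖ).unop = D.e * (x : Aᵐᵒᵖ).unop :=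
  (congrArg unop (D.op.mul_e x)).symm

/-- The perfect pairing of `(eA)ⁿ` and `(Ae)ⁿ`. -/
def GendoCore.qpowPairing : DualPairing K A (D.op.QPow n) (D.QPow n) where
  p := D.qpowForm n
  perf := by
    have : FiniteDimensional K (D.QPow n) := Module.Finite.trans A _
    refine LinearMap.IsPerfPair.of_bijective _ ⟨?_, fun μ => ?_⟩
    · refine (injective_iff_map_eq_zero _).2 fun x hx => funext fun i => Subtype.ext ?_
      refine unop_injective ?_
      rw [D.unop_coe_eq]
      refine D.nondeg_left _ fun y => ?_
      have := LinearMap.congr_fun hx (Pi.single i ⟨y * D.e, y, rfl⟩)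
      rw [qpowForm_single] at this
      rw [← D.unop_coe_eq, mul_assoc]
      exact this
    · let ρ : A →ₗ[K] leftIdeal D.e := (LinearMap.codRestrict (leftIdeal D.e)
        (LinearMap.toSpanSingleton A A D.e) fun x => ⟨x, rfl⟩).restrictScalars K
      choose x hx using fun i : Fin n => D.rep_left (μ ∘ₗ LinearMap.single K _ i ∘ₗ ρ)
      refine ⟨fun i => ⟨MulOpposite.op (D.e * x i), MulOpposite.op (x i), rfl⟩, LinearMap.pi_ext fun i y => ?_⟩
      rw [qpowForm_single]
      have h1 := hx i y
      have h2 : ρ (y * D.e) = y := Subtype.ext (by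
        change (y * D.e : A) * D.e = y
        rw [D.mul_e, D.mul_e])
      rw [LinearMap.comp_apply, LinearMap.comp_apply, h2, mul_assoc, D.mul_e] at h1
      exact h1
  bal a x y := by
    simp [qpowForm_apply, mul_assoc]

end Pairing

section Right

variable (D : GendoCore K A) (hnearly : IsNearlyGorenstein K A)

-- Infinite codominant dimension embeds D(V) in a power of Ae; dualizing gives a surjection from a
-- power of eA onto V. Its kernel is dual to a cosyzygy of D(V), so it has infinite codominant,
-- hence infinite dominant, dimension.
include D hnearly in
theorem IsDomInfinite.exists_syzygy {V : Type u} [AddCommGroup V] [Module Aᵐᵒᵖ V]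
    (hV : IsDomInfinite Aᵐᵒᵖ V) :
    ∃ (n : ℕ) (W : ModuleCat.{u} Aᵐᵒᵖ) (f : W →ₗ[Aᵐᵒᵖ] D.op.QPow n)
      (g : D.op.QPow n →ₗ[Aᵐᵒᵖ] V), IsShortExact f g ∧ IsDomInfinite Aᵐᵒᵖ W := by
  have := hV.1
  let := scalarModule K Aᵐᵒᵖ V
  have := scalarModule_isScalarTower K Aᵐᵒᵖ V
  have : FiniteDimensional K V := Module.Finite.trans Aᵐᵒᵖ V
  have hV' : IsDomInfinite A (KDual K V) := ⟨Module.Finite.of_restrictScalars_finite K A _,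
    ((tfae_domDim_eq_top D hnearly V).out 0 3).1 hV.2⟩
  obtain ⟨n, j, hj⟩ := hV'.exists_embedding D (regularDualLeft K A)
  obtain ⟨k, hk⟩ := (D.qpowPairing n).exists_adj' (DualPairing.self A V) j
  have hs := IsShortExact.ker k (hk.surjective hj)
  have : FiniteDimensional K (D.op.QPow n) := Module.Finite.trans Aᵐᵒᵖ _
  have := finiteDimensional_submodule (K := K) (LinearMap.ker k)
  obtain ⟨f', hf'⟩ := (DualPairing.self A (LinearMap.ker k)).exists_adj (D.qpowPairing n)
    (LinearMap.ker k).subtype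
  have hW := hV'.of_coker D (regularDualLeft K A) (DualPairing.isShortExact_of_isAdj hf' hk hs)
  exact ⟨n, ModuleCat.of Aᵐᵒᵖ (LinearMap.ker k), _, k, hs,
    Module.Finite.of_restrictScalars_finite K Aᵐᵒᵖ _,
    ((tfae_domDim_eq_top D hnearly (LinearMap.ker k)).out 0 3).2 hW.2⟩

/-- The isomorphism of right modules from `A` to the opposite ring. -/
def opRegularEquiv (A : Type u) [Ring A] : A ≃ₗ[Aᵐᵒᵖ] Aᵐᵒᵖ where
  toFun := op
  invFun := unop
  map_add' _ _ := rfl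
  map_smul' _ _ := rfl
  left_inv _ := rfl
  right_inv _ := rfl

theorem extZero_of_injectiveDimension {R : Type u} [Ring R] {N : Type u} [AddCommGroup N]
    [Module R N] {g : ℕ} (h : injectiveDimension (ModuleCat.of R N) = g) (X : Type u)
    [AddCommGroup X] [Module R X] (i : ℕ) (hi : g < i) : ExtZero R X N i := by
  have := (injectiveDimension_le_iff (ModuleCat.of R N) g).1 h.le
  exact HasInjectiveDimensionLT.subsingleton _ (g + 1) i hi _

variable {g : ℕ} (hCM : IsCMFinite A) (hG : IsGorensteinOfDim A g)

-- CM-finiteness applies since modules of infinite dominant dimension are Gorenstein projective, so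
-- only finitely many indecomposables occur. The right injective dimension of A handles the
-- projective members.
include hnearly hCM hG in
theorem admissibleClass_isDomInfinite : AdmissibleClass D.op (IsDomInfinite Aᵐᵒᵖ) where
  finite _ _ _ h := h.1
  retract a b hab h := h.retract D.op (regularDualRight K A) a b hab
  extension h hX hZ := IsDomInfinite.extension D.op (regularDualRight K A) h hX hZ
  qpow := isDomInfinite_qpow D.op (regularDualRight K A)
  cosyzygy _ _ _ h := h.exists_cosyzygy D.op (regularDualRight K A)
  syzygy _ _ _ h := h.exists_syzygy D hnearly
  injective _ _ _ h _ := h.injective_of_projective D.op (regularDualRight K A) (g := g)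
    fun X _ _ i hi => (extZero_congr_right (opRegularEquiv A)).1
      (extZero_of_injectiveDimension hG.1 X i hi)
  approx T _ _ _ := by
    obtain ⟨n, G, hGn⟩ := hCM
    have hcl : IsExtensionClosed (IsDomInfinite Aᵐᵒᵖ) :=
      { finite := fun _ _ _ h => h.1
        zero := (isDomInfinite_qpow D.op (regularDualRight K A) 0).retract D.op
          (regularDualRight K A) 0 0 (LinearMap.ext fun x => rfl)
        retract := fun a b hab h => h.retract D.op (regularDualRight K A) a b hab
        extension := fun h hX hZ =>
          IsDomInfinite.extension D.op (regularDualRight K A) h hX hZ }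
    refine hcl.exists_approx_of_finite K G (fun M hM hind => ?_) T
    have := hM.1
    let := scalarModule K Aᵐᵒᵖ M
    have := scalarModule_isScalarTower K Aᵐᵒᵖ M
    have : FiniteDimensional K M := Module.Finite.trans Aᵐᵒᵖ M
    have hGPI : IsGorensteinProjectiveInjective K A M :=
      ((tfae_domDim_eq_top D hnearly M).out 0 2).1 hM.2
    exact hGn M hM.1 hind hGPI.1

include D hnearly hCM hG in
/-- Modules of infinite dominant dimension are injective. -/
theorem injective_of_domDim_eq_top (hconn : IsConnectedAlgebra A)
    (hself : ¬ Module.Injective Aᵐᵒᵖ A) {V : Type u} [AddCommGroup V] [Module Aᵐᵒᵖ V]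
    [Module.Finite Aᵐᵒᵖ V] (hV : domDim Aᵐᵒᵖ V = ⊤) : Module.Injective Aᵐᵒᵖ V := by
  refine (admissibleClass_isDomInfinite D hnearly hCM hG).injective_of_mem (fun c hc hcomm => ?_)
    (fun _ => hself (injective_of_linearEquiv (opRegularEquiv A))) V ⟨inferInstance, hV⟩
  refine (hconn.2 c.unop (congrArg unop hc) fun a => (congrArg unop (hcomm (op a))).symm).imp
    (fun h => unop_injective h) fun h => unop_injective h

-- The dominant dimension controls Ext^i(D(A), V) for 1 ≤ i ≤ g. Beyond g, duality turns it into
-- Ext^i(D(V), A) over left modules, which vanishes by the left injective dimension.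
include D hG in
theorem domDim_eq_top_of_le {V : Type u} [AddCommGroup V] [Module Aᵐᵒᵖ V]
    [Module.Finite Aᵐᵒᵖ V] (hV : ((g + 2 : ℕ) : ℕ∞) ≤ domDim Aᵐᵒᵖ V) : domDim Aᵐᵒᵖ V = ⊤ := by
  let := scalarModule K Aᵐᵒᵖ V
  have := scalarModule_isScalarTower K Aᵐᵒᵖ V
  have : FiniteDimensional K V := Module.Finite.trans Aᵐᵒᵖ V
  obtain ⟨h1, h2⟩ := GendoCore.etaBij_and_extZero_of_le_domDim (D := D.op)
    (V := regularDualRight K A) hV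
  refine GendoCore.domDim_eq_top V h1 fun i hi => ?_
  rcases le_or_gt i g with hig | hig
  · exact h2 i hi hig
  · obtain ⟨i, rfl⟩ := Nat.exists_eq_add_of_le' hi
    exact (extZero_iff_dual i (DualPairing.ofLeft A A) (DualPairing.self A V)).2
      (extZero_of_injectiveDimension hG.2 _ _ hig)

include D hG in
theorem finitisticDomDim_le : finitisticDomDim Aᵐᵒᵖ ≤ g + 1 := by
  refine sSup_le ?_
  rintro _ ⟨M, _, rfl, hlt⟩
  by_contra hgt
  refine hlt.ne (domDim_eq_top_of_le D hG ?_)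
  rw [not_le] at hgt
  have := Order.add_one_le_of_lt hgt
  exact_mod_cast this

end Right

end GendoSymm

end

theorem mainTheorem3 {K A : Type u} [Field K] [Ring A] [Algebra K A] [FiniteDimensional K A]
    (hconn : GendoSymm.IsConnectedAlgebra A)
    (hself : ¬ Module.Injective Aᵐᵒᵖ A)
    (hgendo : GendoSymm.IsGendoSymmetric K A)
    (hnearly : GendoSymm.IsNearlyGorenstein K A) :
    (∀ (M : Type u) [AddCommGroup M] [Module K M] [Module Aᵐᵒᵖ M] [IsScalarTower K Aᵐᵒᵖ M]
        [FiniteDimensional K M],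
        CategoryTheory.Indecomposable (ModuleCat.of Aᵐᵒᵖ M) →
        ¬ Module.Injective Aᵐᵒᵖ M → ¬ Module.Projective Aᵐᵒᵖ M →
        List.TFAE [
          GendoSymm.domDim Aᵐᵒᵖ M = ⊤,
          GendoSymm.IsGorensteinProjectiveInjective K A M ∧
            Nonempty (GendoSymm.NakayamaInv K A M ≃ₗ[Aᵐᵒᵖ] M),
          GendoSymm.IsGorensteinProjectiveInjective K A M,
          GendoSymm.codomDim K A M = ⊤]) ∧
    (∀ g : ℕ, GendoSymm.IsCMFinite A → GendoSymm.IsGorensteinOfDim A g →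
        (∀ (M : Type u) [AddCommGroup M] [Module K M] [Module Aᵐᵒᵖ M] [IsScalarTower K Aᵐᵒᵖ M]
          [FiniteDimensional K M],
          ¬ Module.Injective Aᵐᵒᵖ M → GendoSymm.domDim Aᵐᵒᵖ M < ⊤) ∧
        GendoSymm.finitisticDomDim Aᵐᵒᵖ ≤ g + 1) := by
  obtain ⟨D⟩ := hgendo.nonempty_gendoCore
  refine ⟨fun M _ _ _ _ _ _ _ _ => GendoSymm.tfae_domDim_eq_top D hnearly M, ?_⟩
  refine fun g hCM hG => ⟨fun M _ _ _ _ _ hM => lt_top_iff_ne_top.2 fun h => hM ?_,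
    GendoSymm.finitisticDomDim_le D hG⟩
  have : Module.Finite Aᵐᵒᵖ M := Module.Finite.of_restrictScalars_finite K Aᵐᵒᵖ M
  exact GendoSymm.injective_of_domDim_eq_top D hnearly hCM hG hconn hself h
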